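/- Let $n\ge 2$, $\mathbf T=\mathbf R/2\pi\mathbf Z$, and let $U_1,\dots,U_{n-1}:\mathbf T\to\mathbf R$ be smooth functions such that (a) the Fourier series of each $U_i$ contains only finitely many modes; (b) for each $i$ there is no $\phi\in\mathbf T$ with $U_i'(\phi)=U_i''(\phi)=0$. On $\Omega=\mathbf R^n\times\mathbf T^n$, with points $x=(I,\phi)$, consider $$H(I,\phi)=\frac12\sum_{i=1}^n I_i^2+\sum_{i=1}^{n-1}U_i(\phi_{i+1}-\phi_i),$$ and, for a fixed $\gamma>0$, the equations of motion $$\dot I_i=-\partial_{\phi_i}H-\delta_{i,1}\gamma I_1,\qquad \dot\phi_i=\partial_{I_i}H,\qquad i=1,\dots,n.$$ Fix an integer $k$ with $2\le k\le n$, and for $L,\rho>0$ let $$\mathcal B_{L,\rho}=\{(I,\phi)\in\Omega:\ |I_i-L\delta_{i,k}|<\rho,\ i=1,\dots,n\}.$$ Fix $\alpha>0$ and $\rho>0$. Then there exist constants $L_0,\rho^*,C_1>0$ such that for all $L\ge L_0$ and all initial conditions $x(0)\in\mathcal B_{L,\rho}$ the following holds with $T=\alpha L^{2k-3}$: a solution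 $x(t)$ of the equations of motion exists on $[0,T]$, and every such solution satisfies (i) $x(t)\in\mathcal B_{L,\rho^*}$ for $0\le t\le T$; (ii) $\displaystyle H(x(T))-H(x(0))\le -C_1\,\frac{T}{L^{4k-6}}$. -/

import Mathlib

open scoped ContDiff

namespace RotatorChain

noncomputable section

/-- The circle `ℝ / 2πℤ`. -/
abbrev Torus : Type := AddCircle (2 * Real.pi)

/-- The phase space `ℝⁿ × 𝕋ⁿ`; a point is `x = (I, φ)` with actions `x.1` and angles `x.2`.
The rotator with number `j ∈ {1, …, n}` has the index `i : Fin n` with `i + 1 = j`. -/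
abbrev Phase (n : ℕ) : Type := (Fin n → ℝ) × (Fin n → Torus)

/-- The `2π`-periodic function on `ℝ` that a function on the circle defines. -/
def lift (V : Torus → ℝ) (s : ℝ) : ℝ := V (s : Torus)

/-- The potential is a smooth function on the circle. -/
def IsSmooth (V : Torus → ℝ) : Prop := ContDiff ℝ ∞ (lift V)

/-- The Fourier series of the potential contains finitely many modes. -/
def HasFinitelyManyModes (V : Torus → ℝ) : Prop :=
  haveI : Fact (0 < 2 * Real.pi) := ⟨Real.two_pi_pos⟩
  {m : ℤ | fourierCoeff (fun φ : Torus => (V φ : ℂ)) m ≠ 0}.Finite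

/-- There is no point of the circle at which the first and the second derivative both vanish. -/
def IsNondegenerate (V : Torus → ℝ) : Prop :=
  ¬ ∃ s : ℝ, deriv (lift V) s = 0 ∧ deriv (deriv (lift V)) s = 0

/-- The Hamiltonian `½ ∑ᵢ Iᵢ² + ∑ᵢ Uᵢ(φᵢ₊₁ - φᵢ)` of the chain of `n` rotators. -/
def hamiltonian {n : ℕ} (U : Fin (n - 1) → Torus → ℝ) (x : Phase n) : ℝ :=
  (1 / 2) * ∑ i : Fin n, x.1 i ^ 2
    + ∑ i : Fin (n - 1),
        U i (x.2 ⟨(i : ℕ) + 1, by omega⟩ - x.2 ⟨(i : ℕ), by omega⟩)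

/-- The partial derivative of a function on phase space with respect to the action `Iᵢ`. -/
def partialAction {n : ℕ} (F : Phase n → ℝ) (i : Fin n) (x : Phase n) : ℝ :=
  deriv (fun s : ℝ => F (Function.update x.1 i (x.1 i + s), x.2)) 0

/-- The partial derivative of a function on phase space with respect to the angle `φᵢ`. -/
def partialAngle {n : ℕ} (F : Phase n → ℝ) (i : Fin n) (x : Phase n) : ℝ :=
  deriv (fun s : ℝ => F (x.1, Function.update x.2 i (x.2 i + (s : Torus)))) 0

/-- `x` solves on the time interval `[0, T]` the equations of motion
`İᵢ = -∂H/∂φᵢ - δ_{i,1} γ I₁`, `φ̇ᵢ = ∂H/∂Iᵢ`.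
The derivative of a curve of angles is that of a lift `θ` of the curve to `ℝⁿ`. -/
def IsSolutionOn {n : ℕ} (U : Fin (n - 1) → Torus → ℝ) (γ T : ℝ) (x : ℝ → Phase n) : Prop :=
  ∃ θ : ℝ → Fin n → ℝ, ∀ t ∈ Set.Icc 0 T, ∀ i : Fin n,
    ((θ t i : ℝ) : Torus) = (x t).2 i ∧
    HasDerivWithinAt (fun s => (x s).1 i)
      (-partialAngle (hamiltonian U) i (x t) - (if (i : ℕ) + 1 = 1 then γ * (x t).1 i else 0))
      (Set.Icc 0 T) t ∧
    HasDerivWithinAt (fun s => θ s i) (partialAction (hamiltonian U) i (x t)) (Set.Icc 0 T) t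

/-- The set of all `(I, φ)` with `|Iᵢ - L δ_{i,k}| < ρ` for all `i = 1, …, n`. -/
def box (n k : ℕ) (L ρ : ℝ) : Set (Phase n) :=
  {x | ∀ i : Fin n, |x.1 i - (if (i : ℕ) + 1 = k then L else 0)| < ρ}

end

end RotatorChain

/-!
The damping acts on the first rotator only, so the energy `H` changes at the rate `-γ I₁²`. The
rotator `k` starts with the action `L`, and the task is to see how this fast rotation shows up,
very weakly, in `I₁`. After the shift `I_k ↦ I_k - L` and division of the Hamiltonian by `L`, the
system becomes a perturbation, with the small parameter `ε = 1 / L`, of the Hamiltonian "action of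
the rotator `k`". Since the potentials are trigonometric polynomials, everything happens in an
algebra of polynomials in `ε`, in the actions and in the exponentials `exp (± i φ)`, which is a
Lie algebra under the Poisson bracket. The perturbation expansion is thus purely algebraic
(`exists_integral_of_homological`), and solutions enter only when observables are evaluated along
them.

*Stability* (`exists_stability`). The normal form around the fast rotator provides an adiabatic
invariant: an observable close to `I_k - L` that commutes with the Hamiltonian up to `O(ε ^ N)`
with `N` as large as desired (`exists_adiabatic_invariant`). It is local: at order `m` it involves
only the actions of rotators at a distance of at most `m / 2` from the rotator `k`
(`localSeries`). So its derivative with respect to `I₁` is of order `ε ^ (2 g)` with `g = k - 1`,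
and the damping changes it slowly. The Hamiltonian minus the invariant is the energy of the slow
motion; its derivative consists of `-γ I₁²`, a term `I₁ O(ε ^ (2 g - 1))` and a negligible
remainder. Completing the square bounds its growth over the times in question, hence all shifted
actions stay bounded.

*Dissipation* (`exists_dissipation`). It suffices to bound `∫ |I₁|` from below by
`c ε ^ (2 k - 3)` on each unit time interval (`exists_lower_bound_damped_action`). If `|I₁|` exceeds a fixed
threshold somewhere on the interval, this holds as `I₁` is Lipschitz. Otherwise the rotators to
the left of the fast one are nearly at rest and the forces between them are small
(`exists_small_chain`), so by nondegeneracy the second derivatives of these potentials stay away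
from zero. The equations of motion can then be solved along the chain: the force across the bond
`k - 1`, which turns fast, is a combination of the derivatives of `I₁` of order at most `2 k - 3`
(`exists_mem_derIdeal`). Multiplied by the force itself and tested against a cut-off function,
integration by parts bounds it by `∫ |I₁|` (`exists_bound_integral_derIdeal`); on the other hand
the average of the square of a fast force is bounded below (`exists_fast_force_lower_bound`).
-/

namespace RotatorChain

/-! ### Birkhoff normal form in filtered Lie algebras -/

section NormalForm

variable {𝔤 : Type*} [LieRing 𝔤] [LieAlgebra ℚ 𝔤] {F : ℕ → Submodule ℚ 𝔤} {D : 𝔤 →ₗ[ℚ] 𝔤} {j : ℕ}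

lemma iterate_mem_filtration (hD : ∀ i, ∀ x ∈ F i, D x ∈ F (i + j)) {i : ℕ} {x : 𝔤}
    (hx : x ∈ F i) (m : ℕ) : (D ^ m) x ∈ F (i + m * j) := by
  induction m with
  | zero => simpa using hx
  | succ m ih =>
    rw [pow_succ', Module.End.mul_apply]
    have := hD _ _ ih
    rwa [show i + (m + 1) * j = i + m * j + j by ring]

/-- The exponential of a nilpotent map that raises the filtration degree by `j` agrees with its
expansion to first order up to degree `j + 1`. -/
lemma exp_sub_mem_filtration (hanti : Antitone F) (hD : ∀ i, ∀ x ∈ F i, D x ∈ F (i + j))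
    (hj : 1 ≤ j) (hnil : IsNilpotent D) {y : 𝔤} (hy : D y ∈ F j) :
    IsNilpotent.exp D y - (y + D y) ∈ F (j + 1) := by
  obtain ⟨N, hN⟩ := hnil
  have hN2 : D ^ (N + 2) = 0 := by rw [pow_add, hN, zero_mul]
  rw [IsNilpotent.exp_eq_sum hN2, Finset.sum_range_succ', Finset.sum_range_succ']
  simp only [LinearMap.add_apply, LinearMap.sum_apply]
  have : (∑ d ∈ Finset.range N, (((d + 1 + 1).factorial : ℚ)⁻¹ • D ^ (d + 1 + 1)) y) ∈ F (j + 1) := by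
    refine Submodule.sum_mem _ fun d _ => Submodule.smul_mem _ _ ?_
    have h1 := iterate_mem_filtration hD hy (d + 1)
    rw [pow_succ, Module.End.mul_apply]
    refine hanti ?_ h1
    nlinarith
  convert this using 1
  simp
  abel

lemma exp_sub_mem_filtration_one (hanti : Antitone F) (hD : ∀ i, ∀ x ∈ F i, D x ∈ F (i + j))
    (hj : 1 ≤ j) (hnil : IsNilpotent D) {p y : 𝔤} (hy : y - p ∈ F 1) (hp : D p ∈ F j) :
    IsNilpotent.exp D y - p ∈ F 1 := by
  have hDy : D y ∈ F j := by
    have h1 : D (y - p) ∈ F j := hanti (by omega) (hD _ _ hy)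
    rw [map_sub] at h1
    simpa using add_mem h1 hp
  have h2 := hanti (by omega : 1 ≤ j + 1) (exp_sub_mem_filtration hanti hD hj hnil hDy)
  have h3 := add_mem (add_mem h2 hy) (hanti hj hDy)
  convert h3 using 1
  abel

/-- **Birkhoff normal form in a filtered Lie algebra.** Whenever the homological equation for
`ad p` can be solved within each `F j`, the perturbation `p + z₀ + f` of `p` has an integral close
to `p`: conjugating by exponentials of inner derivations removes the part of the perturbation that
does not commute with `p`, and the integral is the preimage of `p` under the conjugation. -/
theorem exists_integral_of_homological {p z₀ f : 𝔤} {N : ℕ} (hanti : Antitone F)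
    (hlie : ∀ i j, ∀ x ∈ F i, ∀ y ∈ F j, ⁅x, y⁆ ∈ F (i + j))
    (hp : ∀ i, ∀ x ∈ F i, ⁅p, x⁆ ∈ F i) (hz : ∀ i, ∀ x ∈ F i, ⁅z₀, x⁆ ∈ F (i + 1))
    (hN : F N = ⊥) (hnil : ∀ g ∈ F 1, IsNilpotent (LieDerivation.inner ℚ 𝔤 𝔤 g).toLinearMap)
    (hpz : ⁅p, z₀⁆ = 0)
    (hom : ∀ j, ∀ x ∈ F j, ∃ g ∈ F j, ⁅p, x + ⁅p, g⁆⁆ = 0) (hf : f ∈ F 1) :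
    ∃ J : 𝔤, J - p ∈ F 1 ∧ ⁅J, p + z₀ + f⁆ = 0 := by
  -- each step raises the degree `j` of the part `f` that need not commute with `p`, until it vanishes
  suffices key : ∀ m j, 1 ≤ j → N ≤ j + m → ∀ z f : 𝔤, z - z₀ ∈ F 1 → ⁅p, z⁆ = 0 → f ∈ F j →
      ∃ J : 𝔤, J - p ∈ F 1 ∧ ⁅J, p + z + f⁆ = 0 by
    exact key N 1 le_rfl (by omega) z₀ f (by simp) hpz hf
  intro m
  induction m with
  | zero =>
    intro j _ hNj z f _ hz hf
    have : f = 0 := by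
      have := hanti (by omega : N ≤ j) hf
      simpa [hN] using this
    exact ⟨p, by simp, by simp [this, hz]⟩
  | succ m ih =>
    intro j hj hNj z f hzz hpz' hf
    obtain ⟨g, hg, hgp⟩ := hom j f hf
    set D := (LieDerivation.inner ℚ 𝔤 𝔤 g).toLinearMap with hDdef
    have hDx : ∀ x, D x = ⁅x, g⁆ := fun x => rfl
    have hDF : ∀ i, ∀ x ∈ F i, D x ∈ F (i + j) := fun i x hx => hlie i j x hx g hg
    have hDn : IsNilpotent D := hnil g (hanti hj hg)
    have hDp : D p ∈ F j := hp j g hg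
    have hDz : D z ∈ F (j + 1) := by
      have h1 := hlie 1 j _ hzz g hg
      have h2 := hz j g hg
      rw [hDx]
      have : ⁅z, g⁆ = ⁅z - z₀, g⁆ + ⁅z₀, g⁆ := by rw [sub_lie]; abel
      rw [this, add_comm j 1]
      exact add_mem h1 (by rwa [add_comm])
    have hDf : D f ∈ F (j + 1) := hanti (by omega) (hDF j f hf)
    set y := p + z + f with hy
    have hDy : D y ∈ F j := by
      rw [hy, map_add, map_add]
      exact add_mem (add_mem hDp (hanti (by omega) hDz)) (hanti (by omega) hDf)
    have hrem := exp_sub_mem_filtration hanti hDF hj hDn hDy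
    set E := LieDerivation.exp (LieDerivation.inner ℚ 𝔤 𝔤 g) hDn with hE
    have hEy : E y = IsNilpotent.exp D y := rfl
    obtain ⟨J', hJ', hJ'0⟩ := ih (j + 1) (by omega) (by omega) (z + (f + ⁅p, g⁆))
      (E y - (p + z + (f + ⁅p, g⁆)))
      (by
        have := add_mem hzz (hanti hj (add_mem hf hDp))
        convert this using 1
        rw [hDx]; abel)
      (by rw [lie_add, hpz', hgp, add_zero])
      (by
        have := add_mem hrem (add_mem hDz hDf)
        convert this using 1
        rw [hEy, show D y = ⁅p, g⁆ + D z + D f by rw [hy, map_add, map_add, hDx p], hy]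
        abel)
    refine ⟨E.symm J', ?_, ?_⟩
    · have : E.symm J' = IsNilpotent.exp (-D) J' := rfl
      rw [this]
      refine exp_sub_mem_filtration_one hanti (j := j) ?_ hj hDn.neg hJ' ?_
      · intro i x hx
        rw [LinearMap.neg_apply]
        exact neg_mem (hDF i x hx)
      · rw [LinearMap.neg_apply]
        exact neg_mem hDp
    · apply E.injective
      have h0 : E ⁅E.symm J', y⁆ = 0 := by
        rw [LieEquiv.map_lie, LieEquiv.apply_symm_apply]
        convert hJ'0 using 2
        abel
      exact h0.trans (map_zero E.toLieHom).symm

end NormalForm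

open MvPolynomial

/-! ### The Poisson algebra of observables -/

section PoissonBracket

variable {A ι : Type*} [CommRing A] [Algebra ℚ A] [Fintype ι]

/-- The bracket `∑ᵢ (aᵢ f · bᵢ g - bᵢ f · aᵢ g)` of two families of derivations. -/
def poisson (a b : ι → A → A) (f g : A) : A := ∑ i, (a i f * b i g - b i f * a i g)

lemma sum_sum_eq_zero_of_antisymm {T : ι → ι → A} (hT : ∀ i j, T i j + T j i = 0) :
    ∑ i, ∑ j, T i j = 0 := by
  have h2 : (2 : ℚ) • ∑ i, ∑ j, T i j = 0 := by
    rw [two_smul]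
    nth_rewrite 2 [Finset.sum_comm]
    simp only [← Finset.sum_add_distrib, hT, Finset.sum_const_zero]
  simpa using congrArg (fun s => (2 : ℚ)⁻¹ • s) h2

lemma poisson_jacobi {R : Type*} [CommRing R] [Algebra R A] (a b : ι → Derivation R A A)
    (haa : ∀ i j f, a i (a j f) = a j (a i f)) (hbb : ∀ i j f, b i (b j f) = b j (b i f))
    (hab : ∀ i j f, a i (b j f) = b j (a i f)) (f g h : A) :
    poisson (fun i => a i) (fun i => b i) f (poisson (fun i => a i) (fun i => b i) g h) =
      poisson (fun i => a i) (fun i => b i) (poisson (fun i => a i) (fun i => b i) f g) h +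
      poisson (fun i => a i) (fun i => b i) g (poisson (fun i => a i) (fun i => b i) f h) := by
  -- The difference is a double sum whose summand is antisymmetric in its two indices.
  rw [← sub_eq_zero]
  simp only [poisson, map_sum, map_sub, Derivation.leibniz, smul_eq_mul, Finset.mul_sum,
    Finset.sum_mul, ← Finset.sum_sub_distrib, ← Finset.sum_add_distrib]
  refine sum_sum_eq_zero_of_antisymm fun i j => ?_
  simp only [hab, haa j i, hbb j i]
  ring

end PoissonBracket

/-- Variables of the algebra of observables: `eps` stands for `1 / L`, `act i` for the action of
the rotator `i` (relative to `L` for the fast rotator), `pos i` and `neg i` for the exponentials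
`exp (√-1 φᵢ)` and `exp (-√-1 φᵢ)`. No relation `pos i * neg i = 1` is imposed. -/
inductive Var (n : ℕ)
  | eps
  | act (i : Fin n)
  | pos (i : Fin n)
  | neg (i : Fin n)

/-- Observables: polynomials in the actions and in the exponentials of the angles, whose
coefficients are polynomials in the small parameter. -/
abbrev Obs (n : ℕ) : Type := MvPolynomial (Var n) ℂ

variable {n : ℕ}

/-- The small parameter as an observable. -/
noncomputable abbrev eps : Obs n := X Var.eps

/-- The partial derivative with respect to the action `i`. -/
noncomputable def dAct (i : Fin n) : Derivation ℂ (Obs n) (Obs n) :=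
  mkDerivation ℂ fun v => match v with
    | Var.act j => if j = i then 1 else 0
    | _ => 0

/-- The partial derivative with respect to the angle `i`. -/
noncomputable def dAng (i : Fin n) : Derivation ℂ (Obs n) (Obs n) :=
  mkDerivation ℂ fun v => match v with
    | Var.pos j => if j = i then C Complex.I * X (Var.pos j) else 0
    | Var.neg j => if j = i then - (C Complex.I * X (Var.neg j)) else 0
    | _ => 0

@[simp] lemma dAct_eps (i : Fin n) : dAct i (X Var.eps) = 0 := by simp [dAct]
@[simp] lemma dAct_act (i j : Fin n) : dAct i (X (Var.act j)) = if j = i then 1 else 0 := by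
  simp [dAct]
@[simp] lemma dAct_pos (i j : Fin n) : dAct i (X (Var.pos j)) = 0 := by simp [dAct]
@[simp] lemma dAct_neg (i j : Fin n) : dAct i (X (Var.neg j)) = 0 := by simp [dAct]
@[simp] lemma dAng_eps (i : Fin n) : dAng i (X Var.eps) = 0 := by simp [dAng]
@[simp] lemma dAng_act (i j : Fin n) : dAng i (X (Var.act j)) = 0 := by simp [dAng]
@[simp] lemma dAng_pos (i j : Fin n) :
    dAng i (X (Var.pos j)) = if j = i then C Complex.I * X (Var.pos j) else 0 := by simp [dAng]
@[simp] lemma dAng_neg (i j : Fin n) :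
    dAng i (X (Var.neg j)) = if j = i then - (C Complex.I * X (Var.neg j)) else 0 := by
  simp [dAng]

lemma derivation_comm_of_X {σ : Type*} {D₁ D₂ : Derivation ℂ (MvPolynomial σ ℂ) (MvPolynomial σ ℂ)}
    (h : ∀ v, D₁ (D₂ (X v)) = D₂ (D₁ (X v))) (f : MvPolynomial σ ℂ) :
    D₁ (D₂ f) = D₂ (D₁ f) := by
  have : ⁅D₁, D₂⁆ = 0 := by
    refine derivation_ext fun v => ?_
    rw [Derivation.commutator_apply, h, sub_self, Derivation.zero_apply]
  have h2 := congrArg (fun D : Derivation ℂ (MvPolynomial σ ℂ) (MvPolynomial σ ℂ) => D f) this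
  simpa [Derivation.commutator_apply, sub_eq_zero] using h2

lemma dAct_comm (i j : Fin n) (f : Obs n) : dAct i (dAct j f) = dAct j (dAct i f) := by
  refine derivation_comm_of_X (fun v => ?_) f
  rcases v with _ | l | l | l <;> simp <;> split_ifs <;> simp

lemma dAng_comm (i j : Fin n) (f : Obs n) : dAng i (dAng j f) = dAng j (dAng i f) := by
  refine derivation_comm_of_X (fun v => ?_) f
  rcases v with _ | l | l | l <;> simp <;> split_ifs <;> simp_all

lemma dAng_dAct_comm (i j : Fin n) (f : Obs n) : dAng i (dAct j f) = dAct j (dAng i f) := by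
  refine derivation_comm_of_X (fun v => ?_) f
  rcases v with _ | l | l | l <;> simp <;> split_ifs <;> simp

/-- The canonical Poisson bracket makes the observables a Lie algebra. -/
noncomputable instance : LieRing (Obs n) where
  bracket f g := poisson (fun i => dAng i) (fun i => dAct i) f g
  add_lie f g h := by
    simp only [poisson, map_add, ← Finset.sum_add_distrib]
    exact Finset.sum_congr rfl fun _ _ => by ring
  lie_add f g h := by
    simp only [poisson, map_add, ← Finset.sum_add_distrib]
    exact Finset.sum_congr rfl fun _ _ => by ring
  lie_self f := Finset.sum_eq_zero fun _ _ => by ring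
  leibniz_lie f g h := poisson_jacobi dAng dAct dAng_comm dAct_comm dAng_dAct_comm f g h

lemma lie_def (f g : Obs n) : ⁅f, g⁆ = ∑ i, (dAng i f * dAct i g - dAct i f * dAng i g) := rfl

noncomputable instance : LieAlgebra ℚ (Obs n) where
  lie_smul t f g := by
    simp only [lie_def, Finset.smul_sum, map_rat_smul]
    exact Finset.sum_congr rfl fun _ _ => by
      simp only [mul_smul_comm, smul_sub]

@[simp] lemma dAct_eps_pow_mul (i : Fin n) (m : ℕ) (f : Obs n) :
    dAct i (eps ^ m * f) = eps ^ m * dAct i f := by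
  simp [Derivation.leibniz, Derivation.leibniz_pow]

@[simp] lemma dAng_eps_pow_mul (i : Fin n) (m : ℕ) (f : Obs n) :
    dAng i (eps ^ m * f) = eps ^ m * dAng i f := by
  simp [Derivation.leibniz, Derivation.leibniz_pow]

lemma eps_pow_mul_lie (m : ℕ) (f g : Obs n) : ⁅eps ^ m * f, g⁆ = eps ^ m * ⁅f, g⁆ := by
  simp only [lie_def, dAct_eps_pow_mul, dAng_eps_pow_mul, Finset.mul_sum]
  exact Finset.sum_congr rfl fun _ _ => by ring

lemma lie_eps_pow_mul (m : ℕ) (f g : Obs n) : ⁅f, eps ^ m * g⁆ = eps ^ m * ⁅f, g⁆ := by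
  simp only [lie_def, dAct_eps_pow_mul, dAng_eps_pow_mul, Finset.mul_sum]
  exact Finset.sum_congr rfl fun _ _ => by ring

lemma act_lie (κ : Fin n) (f : Obs n) : ⁅(X (Var.act κ) : Obs n), f⁆ = - dAng κ f := by
  rw [lie_def, Finset.sum_eq_single κ]
  · simp
  · intro b _ hb
    simp [hb.symm]
  · simp

/-! ### Locality of observables -/

lemma derivation_mem_supported {σ : Type*} {D : Derivation ℂ (MvPolynomial σ ℂ) (MvPolynomial σ ℂ)}
    {s : Set σ} (hD : ∀ v ∈ s, D (X v) ∈ supported ℂ s) {f : MvPolynomial σ ℂ}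
    (hf : f ∈ supported ℂ s) : D f ∈ supported ℂ s := by
  rw [supported_eq_adjoin_X] at hf
  induction hf using Algebra.adjoin_induction with
  | mem x hx =>
    obtain ⟨v, hv, rfl⟩ := hx
    exact hD v hv
  | algebraMap r => simp
  | add x y _ _ hx hy => rw [map_add]; exact add_mem hx hy
  | mul x y hx' hy' hx hy =>
    rw [Derivation.leibniz, smul_eq_mul, smul_eq_mul]
    rw [← supported_eq_adjoin_X] at hx' hy'
    exact add_mem (mul_mem hx' hy) (mul_mem hy' hx)

lemma C_mem_supported {σ : Type*} {s : Set σ} (a : ℂ) : (C a : MvPolynomial σ ℂ) ∈ supported ℂ s :=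
  (supported ℂ s).algebraMap_mem a

lemma dAct_mem_supported {s : Set (Var n)} (i : Fin n) {f : Obs n} (hf : f ∈ supported ℂ s) :
    dAct i f ∈ supported ℂ s := by
  refine derivation_mem_supported (fun v _ => ?_) hf
  rcases v with _ | l | l | l
  · simp
  · rw [dAct_act]; split_ifs
    · exact one_mem _
    · exact zero_mem _
  · simp
  · simp

lemma dAng_mem_supported {s : Set (Var n)} (i : Fin n) {f : Obs n} (hf : f ∈ supported ℂ s) :
    dAng i f ∈ supported ℂ s := by
  refine derivation_mem_supported (fun v hv => ?_) hf
  rcases v with _ | l | l | l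
  · simp
  · simp
  · rw [dAng_pos]; split_ifs
    · exact mul_mem (C_mem_supported _) (X_mem_supported.2 hv)
    · exact zero_mem _
  · rw [dAng_neg]; split_ifs
    · exact neg_mem (mul_mem (C_mem_supported _) (X_mem_supported.2 hv))
    · exact zero_mem _

lemma derivation_eq_zero_of_supported {σ : Type*}
    {D : Derivation ℂ (MvPolynomial σ ℂ) (MvPolynomial σ ℂ)}
    {s : Set σ} (hD : ∀ v ∈ s, D (X v) = 0) {f : MvPolynomial σ ℂ} (hf : f ∈ supported ℂ s) :
    D f = 0 :=
  derivation_eq_zero_of_forall_mem_vars fun v hv => hD v (mem_supported.1 hf hv)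

lemma dAct_eq_zero {s : Set (Var n)} {i : Fin n} (hi : Var.act i ∉ s) {f : Obs n}
    (hf : f ∈ supported ℂ s) : dAct i f = 0 := by
  refine derivation_eq_zero_of_supported (fun v hv => ?_) hf
  rcases v with _ | l | l | l
  · simp
  · rw [dAct_act, if_neg]
    rintro rfl
    exact hi hv
  · simp
  · simp

lemma dAng_eq_zero {s : Set (Var n)} {i : Fin n} (hi : Var.pos i ∉ s) (hi' : Var.neg i ∉ s)
    {f : Obs n} (hf : f ∈ supported ℂ s) : dAng i f = 0 := by
  refine derivation_eq_zero_of_supported (fun v hv => ?_) hf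
  rcases v with _ | l | l | l
  · simp
  · simp
  · rw [dAng_pos, if_neg]
    rintro rfl
    exact hi hv
  · rw [dAng_neg, if_neg]
    rintro rfl
    exact hi' hv

lemma lie_mem_supported {s : Set (Var n)} {f g : Obs n} (hf : f ∈ supported ℂ s)
    (hg : g ∈ supported ℂ s) : ⁅f, g⁆ ∈ supported ℂ s := by
  rw [lie_def]
  exact sum_mem fun i _ => sub_mem (mul_mem (dAng_mem_supported i hf) (dAct_mem_supported i hg))
    (mul_mem (dAct_mem_supported i hf) (dAng_mem_supported i hg))

/-- Averaging over the angle `κ`: every observable is, up to a `κ`-derivative, independent of the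
angle `κ`. On monomials the derivative acts as multiplication by a number. -/
lemma exists_primitive (κ : Fin n) {s : Set (Var n)} {f : Obs n} (hf : f ∈ supported ℂ s) :
    ∃ g ∈ supported ℂ s, dAng κ (f - dAng κ g) = 0 := by
  have hmon : ∀ (a : Var n →₀ ℕ) (c : ℂ), ∃ w : ℂ,
      dAng κ (monomial a c) = C w * monomial a c := by
    intro a c
    refine ⟨a (Var.pos κ) * Complex.I - a (Var.neg κ) * Complex.I, ?_⟩
    induction a using Finsupp.induction_linear generalizing c with
    | zero => simp [monomial_zero']
    | add a b ha hb =>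
      have : (monomial (a + b) c : Obs n) = monomial a c * monomial b 1 := by
        rw [monomial_mul, mul_one]
      rw [this, Derivation.leibniz, ha, hb, smul_eq_mul, smul_eq_mul]
      simp only [Finsupp.add_apply, Nat.cast_add, C_sub, C_mul, C_add]
      ring
    | single v m =>
      rw [← mul_one c, ← C_mul_monomial, ← X_pow_eq_monomial, Derivation.leibniz]
      rw [derivation_C, Derivation.leibniz_pow]
      cases m with
      | zero => simp
      | succ m =>
      rcases v with _ | l | l | l
      · simp
      · simp
      · by_cases h : l = κ
        · subst h
          simp [pow_succ]
          ring
        · simp [h]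
      · by_cases h : l = κ
        · subst h
          simp [pow_succ]
          ring
        · simp [h]
  have hmon' : ∀ a : Var n →₀ ℕ, ∀ c : ℂ, (monomial a c : Obs n) ∈ supported ℂ s →
      ∃ g ∈ supported ℂ s, dAng κ (monomial a c - dAng κ g) = 0 := by
    intro a c hac
    obtain ⟨w, hw⟩ := hmon a c
    by_cases h0 : w = 0
    · exact ⟨0, zero_mem _, by simp [hw, h0]⟩
    · refine ⟨C w⁻¹ * monomial a c, mul_mem (C_mem_supported _) hac, ?_⟩
      have : dAng κ (C w⁻¹ * monomial a c) = monomial a c := by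
        rw [Derivation.leibniz, derivation_C, hw, smul_zero, add_zero, smul_eq_mul, ← mul_assoc,
          ← C_mul, inv_mul_cancel₀ h0, C_1, one_mul]
      rw [this, sub_self, map_zero]
  have hsup : ∀ a ∈ f.support, (monomial a (coeff a f) : Obs n) ∈ supported ℂ s := by
    intro a ha
    rw [mem_supported]
    refine fun v hv => mem_supported.1 hf ?_
    have h1 := (vars_monomial (mem_support_iff.1 ha)) ▸ hv
    exact (mem_vars_iff_mem_support v).2 ⟨a, ha, h1⟩
  choose! g hg hg' using fun a => hmon' a (coeff a f)
  refine ⟨∑ a ∈ f.support, g a, sum_mem fun a ha => hg a (hsup a ha), ?_⟩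
  nth_rewrite 1 [← support_sum_monomial_coeff f]
  rw [map_sum, ← Finset.sum_sub_distrib, map_sum]
  exact Finset.sum_eq_zero fun a ha => hg' a (hsup a ha)

/-! ### The adiabatic invariant -/

/-- The left end of the bond `j`. -/
def lo (j : Fin (n - 1)) : Fin n := ⟨j, by omega⟩

/-- The right end of the bond `j`. -/
def hi (j : Fin (n - 1)) : Fin n := ⟨(j : ℕ) + 1, by omega⟩

/-- The distance of two rotators along the chain. -/
def gap (i κ : Fin n) : ℕ := ((i : ℕ) - κ) + (κ - i)

/-- The variables that may occur at order `m` of the perturbation expansion around the fast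
rotator `κ`: angles propagate along the chain at odd orders and actions at even orders. -/
def reach (κ : Fin n) (m : ℕ) : Set (Var n) :=
  {v | match v with
    | Var.eps => False
    | Var.act i => 2 * gap i κ ≤ m ∧ 2 ≤ m
    | Var.pos i => 2 * gap i κ ≤ m + 1
    | Var.neg i => 2 * gap i κ ≤ m + 1}

/-- The angle variables at the two ends of the bond `j`. -/
def bondVars (j : Fin (n - 1)) : Set (Var n) :=
  {v | v = Var.pos (lo j) ∨ v = Var.neg (lo j) ∨ v = Var.pos (hi j) ∨ v = Var.neg (hi j)}

lemma reach_mono (κ : Fin n) {m l : ℕ} (h : m ≤ l) : reach κ m ⊆ reach κ l := by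
  intro v hv
  rcases v with _ | i | i | i <;> simp only [reach, Set.mem_ofPred_eq] at hv ⊢ <;> omega

/-- Series in the small parameter that start at the order `max 1 j` and whose coefficient of
order `m` involves only the variables in `reach κ m`. -/
noncomputable def localSeries (κ : Fin n) (j : ℕ) : Submodule ℚ (Obs n) :=
  Submodule.span ℚ {f | ∃ m, 1 ≤ m ∧ j ≤ m ∧ ∃ v ∈ supported ℂ (reach κ m), f = eps ^ m * v}

lemma mem_localSeries {κ : Fin n} {j m : ℕ} (h1 : 1 ≤ m) (hj : j ≤ m) {v : Obs n}
    (hv : v ∈ supported ℂ (reach κ m)) : eps ^ m * v ∈ localSeries κ j :=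
  Submodule.subset_span ⟨m, h1, hj, v, hv, rfl⟩

lemma localSeries_antitone (κ : Fin n) : Antitone (localSeries κ) := by
  intro i j hij
  refine Submodule.span_mono ?_
  rintro f ⟨m, h1, hj, h⟩
  exact ⟨m, h1, hij.trans hj, h⟩

/-- A linear map that respects the filtration on the generators respects it. -/
lemma localSeries_induction {κ : Fin n} {j : ℕ} {P : Obs n → Prop} (h0 : P 0)
    (hadd : ∀ f g, P f → P g → P (f + g)) (hsmul : ∀ (a : ℚ) f, P f → P (a • f))
    (hgen : ∀ m, 1 ≤ m → j ≤ m → ∀ v ∈ supported ℂ (reach κ m), P (eps ^ m * v)) {f : Obs n}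
    (hf : f ∈ localSeries κ j) : P f := by
  refine Submodule.span_induction ?_ h0 (fun _ _ _ _ => hadd _ _) (fun _ _ _ => hsmul _ _) hf
  rintro f ⟨m, h1, hj, v, hv, rfl⟩
  exact hgen m h1 hj v hv

lemma lie_mem_localSeries {κ : Fin n} {i j : ℕ} {f g : Obs n} (hf : f ∈ localSeries κ i)
    (hg : g ∈ localSeries κ j) : ⁅f, g⁆ ∈ localSeries κ (i + j) := by
  refine localSeries_induction (P := fun f => ⁅f, g⁆ ∈ localSeries κ (i + j)) (by simp)
    (fun f f' h h' => by rw [add_lie]; exact add_mem h h')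
    (fun a f h => by rw [smul_lie]; exact Submodule.smul_mem _ _ h) ?_ hf
  intro m h1 hm v hv
  refine localSeries_induction (P := fun g => ⁅eps ^ m * v, g⁆ ∈ localSeries κ (i + j)) (by simp)
    (fun f f' h h' => by rw [lie_add]; exact add_mem h h')
    (fun a f h => by rw [lie_smul]; exact Submodule.smul_mem _ _ h) ?_ hg
  intro l hl1 hl w hw
  rw [eps_pow_mul_lie, lie_eps_pow_mul, ← mul_assoc, ← pow_add]
  exact mem_localSeries (by omega) (by omega) (lie_mem_supported
    (supported_mono (reach_mono κ (by omega)) hv) (supported_mono (reach_mono κ (by omega)) hw))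

lemma dAng_mem_localSeries {κ i : Fin n} {j : ℕ} {f : Obs n} (hf : f ∈ localSeries κ j) :
    dAng i f ∈ localSeries κ j := by
  refine localSeries_induction (P := fun f => dAng i f ∈ localSeries κ j) (by simp)
    (fun f f' h h' => by rw [map_add]; exact add_mem h h')
    (fun a f h => by rw [map_rat_smul]; exact Submodule.smul_mem _ _ h) ?_ hf
  intro m h1 hm v hv
  rw [dAng_eps_pow_mul]
  exact mem_localSeries h1 hm (dAng_mem_supported i hv)

lemma exists_primitive_localSeries {κ : Fin n} {j : ℕ} {f : Obs n} (hf : f ∈ localSeries κ j) :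
    ∃ g ∈ localSeries κ j, dAng κ (f - dAng κ g) = 0 := by
  refine localSeries_induction
    (P := fun f => ∃ g ∈ localSeries κ j, dAng κ (f - dAng κ g) = 0)
    ⟨0, by simp⟩ ?_ ?_ ?_ hf
  · rintro f f' ⟨g, hg, h⟩ ⟨g', hg', h'⟩
    refine ⟨g + g', add_mem hg hg', ?_⟩
    rw [map_add, add_sub_add_comm, map_add, h, h', add_zero]
  · rintro a f ⟨g, hg, h⟩
    refine ⟨a • g, Submodule.smul_mem _ _ hg, ?_⟩
    rw [map_rat_smul, ← smul_sub, map_rat_smul, h, smul_zero]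
  · intro m h1 hm v hv
    obtain ⟨g, hg, h⟩ := exists_primitive κ hv
    refine ⟨eps ^ m * g, mem_localSeries h1 hm hg, ?_⟩
    rw [dAng_eps_pow_mul, ← mul_sub, dAng_eps_pow_mul, h, mul_zero]

/-- The Hamiltonian `½ ∑ Iᵢ² + ∑ uⱼ` as an observable. -/
noncomputable def obsEnergy (u : Fin (n - 1) → Obs n) : Obs n :=
  C (1 / 2) * ∑ i, X (Var.act i) ^ 2 + ∑ j, u j

section Energy

variable {u : Fin (n - 1) → Obs n}

lemma dAct_bond (hu : ∀ j, u j ∈ supported ℂ (bondVars j)) (i : Fin n) (j : Fin (n - 1)) :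
    dAct i (u j) = 0 :=
  dAct_eq_zero (by simp [bondVars]) (hu j)

lemma dAng_bond (hu : ∀ j, u j ∈ supported ℂ (bondVars j)) {i : Fin n} {j : Fin (n - 1)}
    (h1 : i ≠ lo j) (h2 : i ≠ hi j) :
    dAng i (u j) = 0 :=
  dAng_eq_zero (by simp [bondVars, h1, h2]) (by simp [bondVars, h1, h2]) (hu j)

lemma dAct_obsEnergy (hu : ∀ j, u j ∈ supported ℂ (bondVars j)) (i : Fin n) :
    dAct i (obsEnergy u) = X (Var.act i) := by
  rw [obsEnergy, map_add, map_sum, Finset.sum_eq_zero fun j _ => dAct_bond hu i j, add_zero,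
    Derivation.leibniz, derivation_C, map_sum, Finset.sum_eq_single i]
  · simp only [Derivation.leibniz_pow, dAct_act, if_true, smul_eq_mul]
    have : (C (1 / 2) * (2 : Obs n)) = 1 := by
      rw [show (2 : Obs n) = C 2 from (map_ofNat C 2).symm, ← C_mul]; norm_num
    simp only [nsmul_eq_mul, mul_one, Nat.add_one_sub_one, pow_one]
    rw [Nat.cast_ofNat, ← mul_assoc, this, one_mul, mul_zero, add_zero]
  · intro j _ hj
    simp [Derivation.leibniz_pow, hj]
  · simp

lemma dAng_obsEnergy (i : Fin n) : dAng i (obsEnergy u) = ∑ j, dAng i (u j) := by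
  rw [obsEnergy, map_add, map_sum, Derivation.leibniz, derivation_C, map_sum,
    Finset.sum_eq_zero, smul_zero, zero_add, smul_zero, zero_add]
  intro j _
  simp [Derivation.leibniz_pow]

lemma dAng_bond_mem_reach (hu : ∀ j, u j ∈ supported ℂ (bondVars j))
    {κ i : Fin n} {m : ℕ} (hi' : 2 * gap i κ ≤ m) (j : Fin (n - 1)) :
    dAng i (u j) ∈ supported ℂ (reach κ (m + 1)) := by
  by_cases h : i ≠ lo j ∧ i ≠ hi j
  · rw [dAng_bond hu h.1 h.2]; exact zero_mem _
  · refine supported_mono ?_ (dAng_mem_supported i (hu j))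
    have h' : (i : ℕ) = j ∨ (i : ℕ) = j + 1 := by
      by_contra hc
      push Not at hc
      exact h ⟨fun hh => hc.1 (congrArg Fin.val hh), fun hh => hc.2 (congrArg Fin.val hh)⟩
    rintro v (rfl | rfl | rfl | rfl) <;>
      simp only [reach, gap, lo, hi, Set.mem_ofPred_eq] at hi' ⊢ <;> omega

lemma lie_obsEnergy_mem (hu : ∀ j, u j ∈ supported ℂ (bondVars j))
    {κ : Fin n} {j : ℕ} {f : Obs n} (hf : f ∈ localSeries κ j) :
    ⁅eps * obsEnergy u, f⁆ ∈ localSeries κ (j + 1) := by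
  refine localSeries_induction
    (P := fun f => ⁅eps * obsEnergy u, f⁆ ∈ localSeries κ (j + 1)) (by simp)
    (fun f f' h h' => by rw [lie_add]; exact add_mem h h')
    (fun a f h => by rw [lie_smul]; exact Submodule.smul_mem _ _ h) ?_ hf
  intro m h1 hm v hv
  rw [show (eps : Obs n) * obsEnergy u = eps ^ 1 * obsEnergy u by rw [pow_one],
    eps_pow_mul_lie, lie_eps_pow_mul, ← mul_assoc, ← pow_add]
  rw [add_comm 1 m]
  refine mem_localSeries (by omega) (by omega) ?_
  have hv' := supported_mono (R := ℂ) (reach_mono κ (by omega : m ≤ m + 1)) hv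
  rw [lie_def]
  refine sum_mem fun i _ => sub_mem ?_ ?_
  · by_cases hi' : 2 * gap i κ ≤ m
    · rw [dAng_obsEnergy]
      exact mul_mem (sum_mem fun l _ => dAng_bond_mem_reach hu hi' l) (dAct_mem_supported i hv')
    · rw [dAct_eq_zero (by simp [reach, hi']) hv, mul_zero]
      exact zero_mem _
  · by_cases hi' : 2 * gap i κ ≤ m + 1
    · rw [dAct_obsEnergy hu]
      refine mul_mem (X_mem_supported.2 ?_) (dAng_mem_supported i hv')
      simp only [reach, Set.mem_ofPred_eq]
      omega
    · rw [dAng_eq_zero (by simp [reach, hi']) (by simp [reach, hi']) hv, mul_zero]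
      exact zero_mem _

end Energy

/-- The Lie ideal of the observables that are divisible by the `N`-th power of the small
parameter. -/
noncomputable def epsIdeal (n N : ℕ) : LieIdeal ℚ (Obs n) where
  __ := (Ideal.span {(eps : Obs n) ^ N}).restrictScalars ℚ
  lie_mem := by
    intro f g hg
    obtain ⟨h, rfl⟩ := Ideal.mem_span_singleton.1 hg
    show _ ∈ Ideal.span {(eps : Obs n) ^ N}
    rw [lie_eps_pow_mul]
    exact Ideal.mem_span_singleton.2 ⟨_, rfl⟩

lemma mem_epsIdeal {N : ℕ} {f : Obs n} : f ∈ epsIdeal n N ↔ ∃ r, f = eps ^ N * r :=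
  Ideal.mem_span_singleton

/-- **The adiabatic invariant of the fast rotator.** To any order in `1 / L` the chain without
damping has an approximate integral close to the action of the fast rotator; it is local in the
sense of `localSeries`. -/
theorem exists_adiabatic_invariant (κ : Fin n) {u : Fin (n - 1) → Obs n}
    (hu : ∀ j, u j ∈ supported ℂ (bondVars j)) (N : ℕ) :
    ∃ f ∈ localSeries κ 1, ∃ r : Obs n,
      ⁅X (Var.act κ) + f, X (Var.act κ) + eps * obsEnergy u⁆ = eps ^ N * r := by
  classical
  set p : Obs n := X (Var.act κ) with hp
  set I := epsIdeal n N with hI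
  let π : Obs n →ₗ[ℚ] (Obs n ⧸ I) := I.toSubmodule.mkQ
  have hπlie : ∀ f g, π ⁅f, g⁆ = ⁅π f, π g⁆ := fun f g => rfl
  have hπ0 : ∀ f, π f = 0 ↔ ∃ r, f = eps ^ N * r := fun f =>
    (Submodule.Quotient.mk_eq_zero _).trans mem_epsIdeal
  -- `near j`: the bond `j` ends at the fast rotator
  let near : Fin (n - 1) → Prop := fun j => κ = lo j ∨ κ = hi j
  let w : Obs n := ∑ j with near j, u j
  let h₀ : Obs n := C (1 / 2) * ∑ i, X (Var.act i) ^ 2 + ∑ j with ¬ near j, u j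
  have hsplit : obsEnergy u = h₀ + w := by
    simp only [obsEnergy, h₀, w]
    rw [add_assoc, add_comm (∑ j with ¬ near j, u j), Finset.sum_filter_add_sum_filter_not]
  have hw1 : w ∈ supported ℂ (reach κ 1) := by
    refine sum_mem fun j hj => supported_mono ?_ (hu j)
    have hj' : (κ : ℕ) = j ∨ (κ : ℕ) = j + 1 := by
      rcases (Finset.mem_filter.1 hj).2 with h | h
      · exact Or.inl (congrArg Fin.val h)
      · exact Or.inr (congrArg Fin.val h)
    rintro v (rfl | rfl | rfl | rfl) <;>
      simp only [reach, gap, lo, hi, Set.mem_ofPred_eq] <;> omega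
  have hw : eps * w ∈ localSeries κ 1 := by
    have := mem_localSeries (κ := κ) le_rfl le_rfl hw1
    rwa [pow_one] at this
  have hph : ⁅p, eps * h₀⁆ = 0 := by
    rw [act_lie, show (eps : Obs n) * h₀ = eps ^ 1 * h₀ by rw [pow_one], dAng_eps_pow_mul]
    simp only [h₀]
    rw [map_add, Derivation.leibniz, derivation_C, map_sum]
    rw [Finset.sum_eq_zero (s := Finset.univ) (f := fun i => dAng κ (X (Var.act i) ^ 2)),
      map_sum, Finset.sum_eq_zero (f := fun j => dAng κ (u j))]
    · simp
    · intro j hj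
      have := (Finset.mem_filter.1 hj).2
      simp only [near, not_or] at this
      exact dAng_bond hu this.1 this.2
    · intro i _
      simp [Derivation.leibniz_pow]
  have hz : ∀ i, ∀ x ∈ localSeries κ i, ⁅eps * h₀, x⁆ ∈ localSeries κ (i + 1) := by
    intro i x hx
    have h1 := lie_obsEnergy_mem hu hx
    have h2 := lie_mem_localSeries hw hx
    rw [hsplit, mul_add, add_lie] at h1
    rw [add_comm 1 i] at h2
    simpa using sub_mem h1 h2
  let F : ℕ → Submodule ℚ (Obs n ⧸ I) := fun j => (localSeries κ j).map π
  obtain ⟨J, hJ, hJ0⟩ := exists_integral_of_homological (F := F) (N := N) (p := π p)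
    (z₀ := π (eps * h₀)) (f := π (eps * w))
    (fun i j hij => Submodule.map_mono (localSeries_antitone κ hij))
    (by
      rintro i j _ ⟨x, hx, rfl⟩ _ ⟨y, hy, rfl⟩
      rw [← hπlie]
      exact ⟨_, lie_mem_localSeries hx hy, rfl⟩)
    (by
      rintro i _ ⟨x, hx, rfl⟩
      rw [← hπlie, act_lie]
      exact ⟨_, neg_mem (dAng_mem_localSeries hx), rfl⟩)
    (by
      rintro i _ ⟨x, hx, rfl⟩
      rw [← hπlie]
      exact ⟨_, hz i x hx, rfl⟩)
    (by
      rw [eq_bot_iff]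
      rintro _ ⟨x, hx, rfl⟩
      rw [Submodule.mem_bot, hπ0]
      refine localSeries_induction (P := fun f => ∃ r, f = eps ^ N * r) ⟨0, by simp⟩ ?_ ?_ ?_ hx
      · rintro f g ⟨r, rfl⟩ ⟨r', rfl⟩
        exact ⟨r + r', by ring⟩
      · rintro a f ⟨r, rfl⟩
        exact ⟨a • r, by simp⟩
      · intro m _ hm v _
        obtain ⟨l, rfl⟩ := Nat.exists_eq_add_of_le hm
        exact ⟨eps ^ l * v, by ring⟩)
    (by
      rintro _ ⟨g, hg, rfl⟩
      have hg1 : ∃ g', g = eps ^ 1 * g' := by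
        refine localSeries_induction (P := fun f => ∃ r, f = eps ^ 1 * r) ⟨0, by simp⟩ ?_ ?_ ?_ hg
        · rintro f g ⟨r, rfl⟩ ⟨r', rfl⟩
          exact ⟨r + r', by ring⟩
        · rintro a f ⟨r, rfl⟩
          exact ⟨a • r, by simp⟩
        · intro m _ hm v _
          obtain ⟨l, rfl⟩ := Nat.exists_eq_add_of_le hm
          exact ⟨eps ^ l * v, by ring⟩
      obtain ⟨g', rfl⟩ := hg1
      refine ⟨N, LinearMap.ext fun x => ?_⟩
      obtain ⟨x, rfl⟩ := Submodule.mkQ_surjective I.toSubmodule x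
      have hpow : ∀ m, ∃ r, ((LieDerivation.inner ℚ (Obs n ⧸ I) (Obs n ⧸ I)
          (π (eps ^ 1 * g'))).toLinearMap ^ m) (π x) = π (eps ^ m * r) := by
        intro m
        induction m with
        | zero => exact ⟨x, by simp⟩
        | succ m ih =>
          obtain ⟨r, hr⟩ := ih
          refine ⟨⁅r, g'⁆, ?_⟩
          rw [pow_succ', Module.End.mul_apply, hr]
          show ⁅π (eps ^ m * r), π (eps ^ 1 * g')⁆ = _
          rw [← hπlie, eps_pow_mul_lie, lie_eps_pow_mul, ← mul_assoc, ← pow_add]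
      obtain ⟨r, hr⟩ := hpow N
      exact hr.trans ((hπ0 _).2 ⟨r, rfl⟩))
    (by rw [← hπlie, hph, map_zero])
    (by
      rintro j _ ⟨x, hx, rfl⟩
      obtain ⟨g, hg, h⟩ := exists_primitive_localSeries hx
      refine ⟨π g, ⟨g, hg, rfl⟩, ?_⟩
      rw [← hπlie, ← map_add, ← hπlie, act_lie, act_lie, ← sub_eq_add_neg, h, neg_zero, map_zero])
    ⟨_, hw, rfl⟩
  obtain ⟨f, hf, hfJ⟩ := hJ
  refine ⟨f, hf, ?_⟩
  rw [← hπ0, hπlie, hsplit, map_add, hfJ, mul_add, ← add_assoc, map_add, map_add, ← hJ0]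
  congr 1
  abel

/-- The leading coefficient of a local series depends on angles only: actions enter at order 2. -/
lemma localSeries_eq_leading_add {κ : Fin n} {f : Obs n} (hf : f ∈ localSeries κ 1) :
    ∃ a ∈ supported ℂ (reach κ 1), ∃ b : Obs n, f = eps * a + eps ^ 2 * b := by
  refine localSeries_induction
    (P := fun f => ∃ a ∈ supported ℂ (reach κ 1), ∃ b : Obs n, f = eps * a + eps ^ 2 * b)
    ⟨0, zero_mem _, 0, by simp⟩ ?_ ?_ ?_ hf
  · rintro f g ⟨a, ha, b, rfl⟩ ⟨a', ha', b', rfl⟩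
    exact ⟨a + a', add_mem ha ha', b + b', by ring⟩
  · rintro t f ⟨a, ha, b, rfl⟩
    refine ⟨t • a, ?_, t • b, by simp [smul_add]⟩
    have h : t • a = C (t : ℂ) * a := by
      rw [← smul_eq_C_mul, Rat.cast_smul_eq_qsmul]
    rw [h]
    exact mul_mem (C_mem_supported _) ha
  · intro m h1 _ v hv
    obtain rfl | h2 := h1.eq_or_lt
    · exact ⟨v, hv, 0, by simp⟩
    · obtain ⟨l, rfl⟩ := Nat.exists_eq_add_of_le (Nat.succ_le_of_lt h2)
      exact ⟨0, zero_mem _, eps ^ l * v, by simp only [Nat.succ_eq_add_one]; ring⟩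

/-- By locality the action `i` enters a local series only at the order `2 * gap i κ`. -/
lemma dAct_localSeries {κ : Fin n} {f : Obs n} (hf : f ∈ localSeries κ 1) (i : Fin n) :
    ∃ q, dAct i f = eps ^ (2 * gap i κ) * q := by
  refine localSeries_induction
    (P := fun f => ∃ q, dAct i f = eps ^ (2 * gap i κ) * q) ⟨0, by simp⟩ ?_ ?_ ?_ hf
  · rintro f g ⟨q, h⟩ ⟨q', h'⟩
    exact ⟨q + q', by rw [map_add, h, h', mul_add]⟩
  · rintro t f ⟨q, h⟩
    exact ⟨t • q, by rw [map_rat_smul, h, mul_smul_comm]⟩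
  · intro m _ _ v hv
    rw [dAct_eps_pow_mul]
    by_cases hm : 2 * gap i κ ≤ m
    · obtain ⟨l, rfl⟩ := Nat.exists_eq_add_of_le hm
      exact ⟨eps ^ l * dAct i v, by ring⟩
    · exact ⟨0, by rw [dAct_eq_zero (by simp [reach, hm]) hv]; simp⟩

/-! ### Evaluation of observables along solutions -/

/-- The values of the variables at a small parameter `ε`, actions `a` and angles `φ`. -/
noncomputable def varValue (ε : ℝ) (a φ : Fin n → ℝ) : Var n → ℂ
  | Var.eps => ε
  | Var.act i => a i
  | Var.pos i => Complex.exp (Complex.I * φ i)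
  | Var.neg i => Complex.exp (-(Complex.I * φ i))

/-- The value of an observable. -/
noncomputable def ev (ε : ℝ) (a φ : Fin n → ℝ) : Obs n →ₐ[ℂ] ℂ := aeval (varValue ε a φ)

@[simp] lemma ev_eps (ε : ℝ) (a φ : Fin n → ℝ) : ev ε a φ (X Var.eps) = ε := by
  simp [ev, varValue]
@[simp] lemma ev_act (ε : ℝ) (a φ : Fin n → ℝ) (i : Fin n) :
    ev ε a φ (X (Var.act i)) = a i := by simp [ev, varValue]
@[simp] lemma ev_pos (ε : ℝ) (a φ : Fin n → ℝ) (i : Fin n) :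
    ev ε a φ (X (Var.pos i)) = Complex.exp (Complex.I * φ i) := by simp [ev, varValue]
@[simp] lemma ev_neg (ε : ℝ) (a φ : Fin n → ℝ) (i : Fin n) :
    ev ε a φ (X (Var.neg i)) = Complex.exp (-(Complex.I * φ i)) := by simp [ev, varValue]
@[simp] lemma ev_C (ε : ℝ) (a φ : Fin n → ℝ) (c : ℂ) : ev ε a φ (C c) = c := by
  simp [ev]

lemma exists_bound_aeval {σ : Type*} {s : Set σ} {F : MvPolynomial σ ℂ} (hF : F ∈ supported ℂ s)
    (R : ℝ) : ∃ B : ℝ, 0 < B ∧ ∀ x : σ → ℂ, (∀ v ∈ s, ‖x v‖ ≤ R) → ‖aeval x F‖ ≤ B := by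
  rw [supported_eq_adjoin_X] at hF
  induction hF using Algebra.adjoin_induction with
  | mem x hx =>
    obtain ⟨v, hv, rfl⟩ := hx
    exact ⟨|R| + 1, by positivity, fun x hx => by
      rw [aeval_X]; linarith [hx v hv, le_abs_self R]⟩
  | algebraMap r =>
    refine ⟨‖r‖ + 1, by positivity, fun x _ => ?_⟩
    rw [AlgHom.commutes]
    simp
  | add f g _ _ hf hg =>
    obtain ⟨B, hB, h⟩ := hf
    obtain ⟨B', hB', h'⟩ := hg
    refine ⟨B + B', by positivity, fun x hx => ?_⟩
    rw [map_add]
    exact (norm_add_le _ _).trans (add_le_add (h x hx) (h' x hx))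
  | mul f g _ _ hf hg =>
    obtain ⟨B, hB, h⟩ := hf
    obtain ⟨B', hB', h'⟩ := hg
    refine ⟨B * B', by positivity, fun x hx => ?_⟩
    rw [map_mul, norm_mul]
    exact mul_le_mul (h x hx) (h' x hx) (norm_nonneg _) hB.le

lemma norm_exp_I_mul (x : ℝ) : ‖Complex.exp (Complex.I * x)‖ = 1 := by
  rw [mul_comm]; exact Complex.norm_exp_ofReal_mul_I x

lemma norm_exp_neg_I_mul (x : ℝ) : ‖Complex.exp (-(Complex.I * x))‖ = 1 := by
  rw [Complex.exp_neg, norm_inv, norm_exp_I_mul, inv_one]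

lemma exists_bound_ev (F : Obs n) (R : ℝ) : ∃ B : ℝ, 0 < B ∧ ∀ (ε : ℝ) (a φ : Fin n → ℝ),
    |ε| ≤ 1 → (∀ i, |a i| ≤ R) → ‖ev ε a φ F‖ ≤ B := by
  obtain ⟨B, hB, h⟩ := exists_bound_aeval (s := Set.univ) (F := F)
    (by rw [supported_univ]; trivial) (max 1 R)
  refine ⟨B, hB, fun ε a φ hε ha => h _ fun v _ => ?_⟩
  rcases v with _ | i | i | i
  · simpa [varValue] using Or.inl hε
  · simpa [varValue] using Or.inr (ha i)
  · simp [varValue]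
  · simp [varValue, norm_exp_neg_I_mul]

/-- Observables that depend on angles only are bounded uniformly in the actions. -/
lemma exists_bound_ev_of_angles {s : Set (Var n)} (hs : ∀ i, Var.act i ∉ s) (hs' : Var.eps ∉ s)
    {F : Obs n} (hF : F ∈ supported ℂ s) : ∃ B : ℝ, 0 < B ∧ ∀ (ε : ℝ) (a φ : Fin n → ℝ),
    ‖ev ε a φ F‖ ≤ B := by
  obtain ⟨B, hB, h⟩ := exists_bound_aeval hF 1
  refine ⟨B, hB, fun ε a φ => h _ fun v hv => ?_⟩
  rcases v with _ | i | i | i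
  · exact absurd hv hs'
  · exact absurd hv (hs i)
  · simp [varValue]
  · simp [varValue, norm_exp_neg_I_mul]

/-- The chain rule: if the values of the variables evolve by the derivation `D`, so do those of all
polynomials. -/
lemma hasDerivWithinAt_aeval {σ : Type*}
    {D : Derivation ℂ (MvPolynomial σ ℂ) (MvPolynomial σ ℂ)} {x : ℝ → σ → ℂ} {S : Set ℝ} {t : ℝ}
    {c : ℂ} (hx : ∀ v, HasDerivWithinAt (fun s => x s v) (c * aeval (x t) (D (X v))) S t)
    (F : MvPolynomial σ ℂ) :
    HasDerivWithinAt (fun s => aeval (x s) F) (c * aeval (x t) (D F)) S t := by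
  induction F using MvPolynomial.induction_on with
  | C a => simpa using hasDerivWithinAt_const t S a
  | add f g hf hg =>
    simp only [map_add, mul_add]
    exact hf.add hg
  | mul_X f v hf =>
    simp only [map_mul, aeval_X, Derivation.leibniz, smul_eq_mul, map_add]
    exact (hf.fun_mul (hx v)).congr_deriv (by ring)

/-! ### Trigonometric bond potentials as observables -/

/-- The `m`-th Fourier mode of the bond `j`. -/
noncomputable def mode (j : Fin (n - 1)) (m : ℤ) : Obs n :=
  (X (Var.pos (hi j)) * X (Var.neg (lo j))) ^ m.toNat *
    (X (Var.neg (hi j)) * X (Var.pos (lo j))) ^ (-m).toNat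

lemma lo_ne_hi (j : Fin (n - 1)) : lo j ≠ hi j := by
  intro h
  have := congrArg Fin.val h
  simp [lo, hi] at this

lemma derivation_mul_of_eigen {R A : Type*} [CommRing R] [CommRing A] [Algebra R A]
    {D : Derivation R A A} {a b c d : A} (ha : D a = c * a) (hb : D b = d * b) :
    D (a * b) = (c + d) * (a * b) := by
  rw [Derivation.leibniz, ha, hb, smul_eq_mul, smul_eq_mul]; ring

lemma derivation_pow_of_eigen {R A : Type*} [CommRing R] [CommRing A] [Algebra R A]
    {D : Derivation R A A} {a c : A} (ha : D a = c * a) (m : ℕ) :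
    D (a ^ m) = (m * c) * a ^ m := by
  induction m with
  | zero => simp
  | succ m ih =>
    rw [pow_succ, derivation_mul_of_eigen ih ha]; push_cast; ring

lemma toNat_sub_toNat_neg_cast (m : ℤ) : ((m.toNat : ℂ) - ((-m).toNat : ℂ)) = m := by
  have : ((m.toNat : ℤ) - ((-m).toNat : ℤ)) = m := by omega
  exact_mod_cast this

lemma dAng_hi_mode (j : Fin (n - 1)) (m : ℤ) :
    dAng (hi j) (mode j m) = C (m * Complex.I) * mode j m := by
  have h1 : dAng (hi j) (X (Var.pos (hi j)) * X (Var.neg (lo j))) =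
      (C Complex.I + 0) * (X (Var.pos (hi j)) * X (Var.neg (lo j))) :=
    derivation_mul_of_eigen (by simp) (by simp [lo_ne_hi])
  have h2 : dAng (hi j) (X (Var.neg (hi j)) * X (Var.pos (lo j))) =
      (-C Complex.I + 0) * (X (Var.neg (hi j)) * X (Var.pos (lo j))) :=
    derivation_mul_of_eigen (by simp) (by simp [lo_ne_hi])
  rw [mode, derivation_mul_of_eigen (derivation_pow_of_eigen h1 _) (derivation_pow_of_eigen h2 _),
    ← toNat_sub_toNat_neg_cast m]
  simp only [C_mul, C_sub, map_natCast]
  ring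

lemma dAng_lo_mode (j : Fin (n - 1)) (m : ℤ) :
    dAng (lo j) (mode j m) = -(C (m * Complex.I) * mode j m) := by
  have h1 : dAng (lo j) (X (Var.pos (hi j)) * X (Var.neg (lo j))) =
      (0 + -C Complex.I) * (X (Var.pos (hi j)) * X (Var.neg (lo j))) :=
    derivation_mul_of_eigen (by simp [(lo_ne_hi j).symm]) (by simp)
  have h2 : dAng (lo j) (X (Var.neg (hi j)) * X (Var.pos (lo j))) =
      (0 + C Complex.I) * (X (Var.neg (hi j)) * X (Var.pos (lo j))) :=
    derivation_mul_of_eigen (by simp [(lo_ne_hi j).symm]) (by simp)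
  rw [mode, derivation_mul_of_eigen (derivation_pow_of_eigen h1 _) (derivation_pow_of_eigen h2 _),
    ← toNat_sub_toNat_neg_cast m]
  simp only [C_mul, C_sub, map_natCast]
  ring

lemma mode_mem_supported (j : Fin (n - 1)) (m : ℤ) : mode j m ∈ supported ℂ (bondVars j) := by
  refine mul_mem (pow_mem (mul_mem ?_ ?_) _) (pow_mem (mul_mem ?_ ?_) _) <;>
    exact X_mem_supported.2 (by simp [bondVars])

lemma ev_mode (ε : ℝ) (a φ : Fin n → ℝ) (j : Fin (n - 1)) (m : ℤ) :
    ev ε a φ (mode j m) =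
      Complex.exp (m * Complex.I * ((φ (hi j) - φ (lo j) : ℝ) : ℂ)) := by
  rw [mode, map_mul, map_pow, map_pow, map_mul, map_mul, ev_pos, ev_neg, ev_pos, ev_neg,
    ← Complex.exp_add, ← Complex.exp_add, ← Complex.exp_nat_mul, ← Complex.exp_nat_mul,
    ← Complex.exp_add, ← toNat_sub_toNat_neg_cast m]
  congr 1
  push_cast
  ring

/-- The observable of a trigonometric polynomial of the phase difference across the bond `j`. -/
noncomputable def bondObs (j : Fin (n - 1)) (S : Finset ℤ) (c : ℤ → ℂ) : Obs n :=
  ∑ m ∈ S, C (c m) * mode j m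

lemma bondObs_mem_supported (j : Fin (n - 1)) (S : Finset ℤ) (c : ℤ → ℂ) :
    bondObs j S c ∈ supported ℂ (bondVars j) :=
  sum_mem fun m _ => mul_mem (C_mem_supported _) (mode_mem_supported j m)

lemma dAng_hi_bondObs (j : Fin (n - 1)) (S : Finset ℤ) (c : ℤ → ℂ) :
    dAng (hi j) (bondObs j S c) = bondObs j S (fun m => c m * (m * Complex.I)) := by
  simp only [bondObs, map_sum]
  refine Finset.sum_congr rfl fun m _ => ?_
  rw [Derivation.leibniz, derivation_C, dAng_hi_mode, smul_zero, add_zero, smul_eq_mul]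
  simp only [C_mul]
  ring

lemma dAng_lo_bondObs (j : Fin (n - 1)) (S : Finset ℤ) (c : ℤ → ℂ) :
    dAng (lo j) (bondObs j S c) = -bondObs j S (fun m => c m * (m * Complex.I)) := by
  simp only [bondObs, map_sum, ← Finset.sum_neg_distrib]
  refine Finset.sum_congr rfl fun m _ => ?_
  rw [Derivation.leibniz, derivation_C, dAng_lo_mode, smul_zero, add_zero, smul_eq_mul]
  simp only [C_mul]
  ring

/-- `u`, `u'` and `u''` are the observables of the function `V` of the phase difference across the
bond `j` and of its first two derivatives. -/
structure IsBond (j : Fin (n - 1)) (V : ℝ → ℝ) (u u' u'' : Obs n) : Prop where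
  mem : u ∈ supported ℂ (bondVars j)
  mem' : u' ∈ supported ℂ (bondVars j)
  dAng_hi : dAng (hi j) u = u'
  dAng_lo : dAng (lo j) u = -u'
  dAng_hi' : dAng (hi j) u' = u''
  dAng_lo' : dAng (lo j) u' = -u''
  ev_eq : ∀ (ε : ℝ) (a φ : Fin n → ℝ), ev ε a φ u = (V (φ (hi j) - φ (lo j)) : ℂ)
  ev_eq' : ∀ (ε : ℝ) (a φ : Fin n → ℝ), ev ε a φ u' = ((deriv V (φ (hi j) - φ (lo j)) : ℝ) : ℂ)
  ev_eq'' : ∀ (ε : ℝ) (a φ : Fin n → ℝ),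
    ev ε a φ u'' = ((deriv (deriv V) (φ (hi j) - φ (lo j)) : ℝ) : ℂ)

lemma deriv_eq_trig_sum {V : ℝ → ℝ} (hV : Differentiable ℝ V) {S : Finset ℤ} {c : ℤ → ℂ}
    (h : ∀ s : ℝ, (V s : ℂ) = ∑ m ∈ S, c m * Complex.exp (m * Complex.I * s)) (s : ℝ) :
    ((deriv V s : ℝ) : ℂ) = ∑ m ∈ S, c m * (m * Complex.I) * Complex.exp (m * Complex.I * s) := by
  have h1 : HasDerivAt (fun s : ℝ => (V s : ℂ)) ((deriv V s : ℝ) : ℂ) s :=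
    (hV s).hasDerivAt.ofReal_comp
  have h2 : HasDerivAt (fun s : ℝ => (V s : ℂ))
      (∑ m ∈ S, c m * (m * Complex.I) * Complex.exp (m * Complex.I * s)) s := by
    simp only [h]
    refine HasDerivAt.fun_sum fun m _ => ?_
    have h3 : HasDerivAt (fun s : ℝ => (m * Complex.I * s : ℂ)) (m * Complex.I) s := by
      simpa using (Complex.ofRealCLM.hasDerivAt (x := s)).const_mul (m * Complex.I : ℂ)
    exact (h3.cexp.const_mul (c m)).congr_deriv (by ring)
  exact h1.unique h2

lemma exists_isBond {V : Torus → ℝ} (hV : IsSmooth V) (hm : HasFinitelyManyModes V)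
    (j : Fin (n - 1)) : ∃ u u' u'', IsBond j (lift V) u u' u'' := by
  have : Fact (0 < 2 * Real.pi) := ⟨Real.two_pi_pos⟩
  have hcont : Continuous V := by
    have : Continuous (lift V) := hV.continuous
    exact (QuotientAddGroup.isOpenQuotientMap_mk
      (N := AddSubgroup.zmultiples (2 * Real.pi))).isQuotientMap.continuous_iff.2 this
  let g : C(Torus, ℂ) := ⟨fun φ => (V φ : ℂ), Complex.continuous_ofReal.comp hcont⟩
  set S : Finset ℤ := hm.toFinset with hS
  have hzero : ∀ m ∉ S, fourierCoeff g m = 0 := by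
    intro m hmS
    by_contra hne
    exact hmS (hm.mem_toFinset.2 hne)
  have hsum : Summable (fourierCoeff g) := summable_of_ne_finset_zero hzero
  have hexp : ∀ s : ℝ, (lift V s : ℂ) =
      ∑ m ∈ S, fourierCoeff g m * Complex.exp (m * Complex.I * s) := by
    intro s
    have h1 := has_pointwise_sum_fourier_series_of_summable hsum (s : Torus)
    have h2 := h1.unique (hasSum_sum_of_ne_finset_zero (s := S) fun m hmS => by
      rw [hzero m hmS, zero_smul])
    refine Eq.trans (show _ = g (s : Torus) from rfl) (h2.trans (Finset.sum_congr rfl ?_))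
    intro m _
    rw [fourier_coe_apply, smul_eq_mul]
    congr 2
    push_cast
    have hpi : (Real.pi : ℂ) ≠ 0 := by exact_mod_cast Real.pi_ne_zero
    field_simp
  have hd : Differentiable ℝ (lift V) := hV.differentiable (by simp)
  have hd' : Differentiable ℝ (deriv (lift V)) := by
    have := hV.iterate_deriv 1
    exact this.differentiable (by simp)
  have hexp' := deriv_eq_trig_sum hd hexp
  have hexp'' := deriv_eq_trig_sum hd' hexp'
  refine ⟨bondObs j S (fourierCoeff g), bondObs j S _, bondObs j S _, bondObs_mem_supported _ _ _,
    bondObs_mem_supported _ _ _, dAng_hi_bondObs _ _ _,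
    dAng_lo_bondObs _ _ _, dAng_hi_bondObs _ _ _, dAng_lo_bondObs _ _ _, ?_, ?_, ?_⟩
  · intro ε a φ
    simp only [bondObs, map_sum, map_mul, ev_C, ev_mode, hexp]
  · intro ε a φ
    simp only [bondObs, map_sum, map_mul, ev_C, ev_mode, hexp']
  · intro ε a φ
    simp only [bondObs, map_sum, map_mul, ev_C, ev_mode, hexp'']

/-! ### The evolution of observables -/

/-- The force on the rotator `i`, without damping, in the chain with the bond potentials `V`. -/
noncomputable def force (V : Fin (n - 1) → ℝ → ℝ) (φ : Fin n → ℝ) (i : Fin n) : ℝ :=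
  ∑ j, ((if lo j = i then deriv (V j) (φ (hi j) - φ (lo j)) else 0) -
    (if hi j = i then deriv (V j) (φ (hi j) - φ (lo j)) else 0))

/-- The energy of the chain in terms of lifted angles. -/
noncomputable def chainEnergy (V : Fin (n - 1) → ℝ → ℝ) (I φ : Fin n → ℝ) : ℝ :=
  1 / 2 * ∑ i, I i ^ 2 + ∑ j, V j (φ (hi j) - φ (lo j))

/-- `(I, θ)` solves the equations of motion on `[0, T]`, with lifted angles `θ` and damping at the
rotator `ι`. -/
structure IsTraj (V : Fin (n - 1) → ℝ → ℝ) (ι : Fin n) (γ T : ℝ) (I θ : ℝ → Fin n → ℝ) : Prop where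
  act : ∀ t ∈ Set.Icc 0 T, ∀ i, HasDerivWithinAt (fun s => I s i)
    (force V (θ t) i - if i = ι then γ * I t i else 0) (Set.Icc 0 T) t
  ang : ∀ t ∈ Set.Icc 0 T, ∀ i, HasDerivWithinAt (fun s => θ s i) (I t i) (Set.Icc 0 T) t

/-- Actions relative to the point where the rotator `κ` has action `L` and all others rest. -/
def shiftAct (κ : Fin n) (L : ℝ) (I : Fin n → ℝ) (i : Fin n) : ℝ := I i - if i = κ then L else 0

/-- The Hamiltonian after the shift of the fast action, up to a constant, divided by `L`. -/
noncomputable def scaledHam (κ : Fin n) (u : Fin (n - 1) → Obs n) : Obs n :=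
  X (Var.act κ) + eps * obsEnergy u

/-- The derivation of the observables that corresponds to the vector field of the equations of
motion divided by `L`. -/
noncomputable def evo (κ ι : Fin n) (γ : ℝ) (u : Fin (n - 1) → Obs n) :
    Derivation ℂ (Obs n) (Obs n) :=
  ∑ i, (dAct i (scaledHam κ u) • dAng i - dAng i (scaledHam κ u) • dAct i) -
    (C (γ : ℂ) * eps * X (Var.act ι)) • dAct ι

lemma derivation_sum_apply {R A M ι : Type*} [CommSemiring R] [CommSemiring A] [AddCommMonoid M]
    [Algebra R A] [Module A M] [Module R M] (s : Finset ι) (D : ι → Derivation R A M) (a : A) :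
    (∑ i ∈ s, D i) a = ∑ i ∈ s, D i a := by
  classical
  induction s using Finset.induction_on with
  | empty => simp
  | insert i s hi ih => rw [Finset.sum_insert hi, Finset.sum_insert hi, Derivation.add_apply, ih]

lemma evo_apply (κ ι : Fin n) (γ : ℝ) (u : Fin (n - 1) → Obs n) (F : Obs n) :
    evo κ ι γ u F = ⁅F, scaledHam κ u⁆ - C (γ : ℂ) * eps * X (Var.act ι) * dAct ι F := by
  have h : ∀ i, (dAct i (scaledHam κ u) • dAng i - dAng i (scaledHam κ u) • dAct i) F =
      dAng i F * dAct i (scaledHam κ u) - dAct i F * dAng i (scaledHam κ u) := by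
    intro i
    rw [Derivation.sub_apply, Derivation.smul_apply, Derivation.smul_apply, smul_eq_mul,
      smul_eq_mul]
    ring
  rw [evo, Derivation.sub_apply, derivation_sum_apply, lie_def, Derivation.smul_apply, smul_eq_mul]
  simp only [h]

@[simp] lemma dAct_eps_mul (i : Fin n) (f : Obs n) : dAct i (eps * f) = eps * dAct i f := by
  simp [Derivation.leibniz]

@[simp] lemma dAng_eps_mul (i : Fin n) (f : Obs n) : dAng i (eps * f) = eps * dAng i f := by
  simp [Derivation.leibniz]

section Dynamics

variable {V : Fin (n - 1) → ℝ → ℝ} {u u' u'' : Fin (n - 1) → Obs n} {κ ι : Fin n} {γ L T : ℝ}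
  {I θ : ℝ → Fin n → ℝ}

lemma dAct_scaledHam (hb : ∀ j, IsBond j (V j) (u j) (u' j) (u'' j)) (i : Fin n) :
    dAct i (scaledHam κ u) = (if κ = i then 1 else 0) + eps * X (Var.act i) := by
  rw [scaledHam, map_add, dAct_act, dAct_eps_mul, dAct_obsEnergy fun j => (hb j).mem]

lemma dAng_bond_eq (hb : ∀ j, IsBond j (V j) (u j) (u' j) (u'' j)) (i : Fin n) (j : Fin (n - 1)) :
    dAng i (u j) = (if hi j = i then u' j else 0) - (if lo j = i then u' j else 0) := by
  by_cases h1 : hi j = i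
  · subst h1
    simp [(hb j).dAng_hi, lo_ne_hi]
  · by_cases h2 : lo j = i
    · subst h2
      simp [(hb j).dAng_lo, (lo_ne_hi j).symm]
    · rw [dAng_bond (fun j => (hb j).mem) (Ne.symm h2) (Ne.symm h1)]
      simp [h1, h2]

lemma dAng_scaledHam (i : Fin n) :
    dAng i (scaledHam κ u) = eps * ∑ j, dAng i (u j) := by
  rw [scaledHam, map_add, dAng_act, zero_add, dAng_eps_mul, dAng_obsEnergy]

lemma ev_dAng_scaledHam (hb : ∀ j, IsBond j (V j) (u j) (u' j) (u'' j)) (i : Fin n)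
    (ε : ℝ) (a φ : Fin n → ℝ) :
    ev ε a φ (dAng i (scaledHam κ u)) = -(ε * force V φ i : ℝ) := by
  rw [dAng_scaledHam, map_mul, ev_eps, map_sum, force]
  push_cast
  rw [← mul_neg, ← Finset.sum_neg_distrib]
  congr 1
  refine Finset.sum_congr rfl fun j _ => ?_
  rw [dAng_bond_eq hb, map_sub, apply_ite (ev ε a φ), apply_ite (ev ε a φ), (hb j).ev_eq', map_zero,
    neg_sub, apply_ite (Complex.ofReal), apply_ite (Complex.ofReal), Complex.ofReal_zero]

lemma evo_act (i : Fin n) : evo κ ι γ u (X (Var.act i)) =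
    - dAng i (scaledHam κ u) - if i = ι then C (γ : ℂ) * eps * X (Var.act ι) else 0 := by
  rw [evo_apply, act_lie, dAct_act, mul_ite, mul_one, mul_zero]

lemma evo_eps : evo κ ι γ u (X Var.eps) = 0 := by
  rw [evo_apply, lie_def]; simp

lemma evo_pos (i : Fin n) : evo κ ι γ u (X (Var.pos i)) =
    dAct i (scaledHam κ u) * (C Complex.I * X (Var.pos i)) := by
  rw [evo_apply, lie_def, Finset.sum_eq_single i]
  · simp; ring
  · intro b _ hb
    simp [hb.symm]
  · simp

lemma evo_neg (i : Fin n) : evo κ ι γ u (X (Var.neg i)) =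
    dAct i (scaledHam κ u) * -(C Complex.I * X (Var.neg i)) := by
  rw [evo_apply, lie_def, Finset.sum_eq_single i]
  · simp; ring
  · intro b _ hb
    simp [hb.symm]
  · simp

lemma IsTraj.hasDerivWithinAt_ev (h : IsTraj V ι γ T I θ)
    (hb : ∀ j, IsBond j (V j) (u j) (u' j) (u'' j)) (hκ : ι ≠ κ) (hL : 0 < L) (F : Obs n)
    {t : ℝ} (ht : t ∈ Set.Icc 0 T) :
    HasDerivWithinAt (fun s => ev L⁻¹ (shiftAct κ L (I s)) (θ s) F)
      (L * ev L⁻¹ (shiftAct κ L (I t)) (θ t) (evo κ ι γ u F)) (Set.Icc 0 T) t := by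
  have hL' : (L : ℂ) ≠ 0 := by exact_mod_cast hL.ne'
  refine hasDerivWithinAt_aeval (x := fun s => varValue L⁻¹ (shiftAct κ L (I s)) (θ s)) ?_ F
  have hang : ∀ i, (L : ℂ) * ev L⁻¹ (shiftAct κ L (I t)) (θ t) (dAct i (scaledHam κ u)) = I t i := by
    intro i
    rw [dAct_scaledHam hb, map_add, map_mul, ev_eps, ev_act, apply_ite (ev _ _ _), map_one,
      map_zero, shiftAct]
    by_cases hi : i = κ
    · subst hi; simp; field_simp; ring
    · simp [hi, Ne.symm hi]; field_simp
  have hθ : ∀ i, HasDerivWithinAt (fun s => Complex.I * (θ s i : ℂ)) (Complex.I * (I t i : ℂ))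
      (Set.Icc 0 T) t := fun i =>
    ((h.ang t ht i).ofReal_comp).const_mul Complex.I
  intro v
  change HasDerivWithinAt _ (L * ev L⁻¹ (shiftAct κ L (I t)) (θ t) _) _ _
  rcases v with _ | i | i | i
  · rw [evo_eps, map_zero, mul_zero]
    exact hasDerivWithinAt_const _ _ _
  · have h1 : HasDerivWithinAt (fun s => ((I s i - (if i = κ then L else 0) : ℝ) : ℂ)) _
        (Set.Icc 0 T) t := ((h.act t ht i).sub_const _).ofReal_comp
    refine h1.congr_deriv ?_
    rw [evo_act, map_sub, map_neg, ev_dAng_scaledHam hb]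
    by_cases hi : i = ι
    · subst hi
      simp [shiftAct, hκ]
      field_simp
    · simp [hi]
      field_simp
  · have h1 := (hθ i).cexp
    refine h1.congr_deriv ?_
    rw [evo_pos, map_mul, ← mul_assoc (L : ℂ), hang, map_mul, ev_C, ev_pos]
    ring
  · have h1 := (hθ i).fun_neg.cexp
    refine h1.congr_deriv ?_
    rw [evo_neg, map_mul, ← mul_assoc (L : ℂ), hang, map_neg, map_mul, ev_C, ev_neg]
    ring

lemma IsTraj.hasDerivWithinAt_re_ev (h : IsTraj V ι γ T I θ)
    (hb : ∀ j, IsBond j (V j) (u j) (u' j) (u'' j)) (hκ : ι ≠ κ) (hL : 0 < L) (F : Obs n)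
    {t : ℝ} (ht : t ∈ Set.Icc 0 T) :
    HasDerivWithinAt (fun s => (ev L⁻¹ (shiftAct κ L (I s)) (θ s) F).re)
      (L * (ev L⁻¹ (shiftAct κ L (I t)) (θ t) (evo κ ι γ u F)).re) (Set.Icc 0 T) t := by
  have h1 := Complex.reCLM.hasFDerivAt.comp_hasDerivWithinAt t
    (h.hasDerivWithinAt_ev hb hκ hL F ht)
  exact h1.congr_deriv (by simp)

lemma ev_obsEnergy (hb : ∀ j, IsBond j (V j) (u j) (u' j) (u'' j)) (ε : ℝ) (a φ : Fin n → ℝ) :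
    ev ε a φ (obsEnergy u) = (chainEnergy V a φ : ℝ) := by
  rw [obsEnergy, chainEnergy, map_add, map_mul, map_sum, map_sum, ev_C]
  push_cast
  congr 1
  · congr 1
    exact Finset.sum_congr rfl fun i _ => by rw [map_pow, ev_act]
  · exact Finset.sum_congr rfl fun j _ => by rw [(hb j).ev_eq]

lemma evo_scaledHam (hb : ∀ j, IsBond j (V j) (u j) (u' j) (u'' j)) (hκ : ι ≠ κ) :
    evo κ ι γ u (scaledHam κ u) = -(C (γ : ℂ) * (eps * X (Var.act ι)) ^ 2) := by
  rw [evo_apply, lie_self, dAct_scaledHam hb, if_neg hκ.symm]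
  ring

/-- The balance of energy: it is lost through the damping only. -/
lemma IsTraj.hasDerivWithinAt_chainEnergy (h : IsTraj V ι γ T I θ)
    (hb : ∀ j, IsBond j (V j) (u j) (u' j) (u'' j)) (hκ : ι ≠ κ) {t : ℝ} (ht : t ∈ Set.Icc 0 T) :
    HasDerivWithinAt (fun s => chainEnergy V (I s) (θ s)) (-(γ * I t ι ^ 2)) (Set.Icc 0 T) t := by
  -- With `L = 1`, the observable `scaledHam` is the energy up to the constant `1 / 2`.
  have h1 := (h.hasDerivWithinAt_re_ev hb hκ one_pos (scaledHam κ u) ht).add_const (1 / 2)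
  rw [evo_scaledHam hb hκ] at h1
  have hval : ∀ s, (ev (1 : ℝ)⁻¹ (shiftAct κ 1 (I s)) (θ s) (scaledHam κ u)).re + 1 / 2 =
      chainEnergy V (I s) (θ s) := by
    intro s
    rw [scaledHam, map_add, map_mul, ev_eps, ev_act, ev_obsEnergy hb]
    have hsum : ∑ i, shiftAct κ 1 (I s) i ^ 2 = ∑ i, I s i ^ 2 - 2 * I s κ + 1 := by
      have : ∀ i, shiftAct κ 1 (I s) i ^ 2 = I s i ^ 2 - if i = κ then 2 * I s κ - 1 else 0 := by
        intro i
        by_cases hi : i = κ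
        · subst hi; simp [shiftAct]; ring
        · simp [shiftAct, hi]
      simp only [this, Finset.sum_sub_distrib, Finset.sum_ite_eq', Finset.mem_univ, if_true]
      ring
    simp only [chainEnergy, hsum]
    simp [shiftAct, -Complex.ofReal_pow, pow_two]
    ring
  refine (h1.congr (fun s _ => (hval s).symm) (hval t).symm).congr_deriv ?_
  simp [shiftAct, hκ, ← Complex.ofReal_pow]

end Dynamics

/-! ### Stability over long times -/

lemma sub_le_mul_of_hasDerivWithinAt {f f' : ℝ → ℝ} {a b c d C : ℝ} (hca : c ≤ a) (hbd : b ≤ d)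
    (hab : a ≤ b) (hf : ∀ t ∈ Set.Icc c d, HasDerivWithinAt f (f' t) (Set.Icc c d) t)
    (hle : ∀ t ∈ Set.Ioo a b, f' t ≤ C) : f b - f a ≤ C * (b - a) := by
  have hsub : Set.Icc a b ⊆ Set.Icc c d := Set.Icc_subset_Icc hca hbd
  have hder : ∀ t ∈ Set.Ioo a b, HasDerivAt f (f' t) t := fun t ht =>
    (hf t (hsub (Set.Ioo_subset_Icc_self ht))).hasDerivAt
      (Icc_mem_nhds (by linarith [ht.1]) (by linarith [ht.2]))
  refine (convex_Icc a b).image_sub_le_mul_sub_of_deriv_le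
    (fun t ht => (hf t (hsub ht)).continuousWithinAt.mono hsub) ?_ ?_ a ⟨le_rfl, hab⟩ b
    ⟨hab, le_rfl⟩ hab
  · rw [interior_Icc]
    exact fun t ht => (hder t ht).differentiableAt.differentiableWithinAt
  · rw [interior_Icc]
    intro t ht
    rw [(hder t ht).deriv]
    exact hle t ht

/-- A bound that is strictly improved whenever it holds before holds for all times. -/
lemma forall_lt_of_bootstrap {g : ℝ → ℝ} {T R : ℝ} (hg : ContinuousOn g (Set.Icc 0 T))
    (h : ∀ t ∈ Set.Icc 0 T, (∀ s ∈ Set.Ico 0 t, g s < R) → g t < R) :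
    ∀ t ∈ Set.Icc 0 T, g t < R := by
  by_contra! hcon
  obtain ⟨t₁, ht₁, hge⟩ := hcon
  have hne : (Set.Icc 0 T ∩ g ⁻¹' Set.Ici R).Nonempty := ⟨t₁, ht₁, hge⟩
  have hcl : IsClosed (Set.Icc 0 T ∩ g ⁻¹' Set.Ici R) :=
    hg.preimage_isClosed_of_isClosed isClosed_Icc isClosed_Ici
  have hcomp : IsCompact (Set.Icc 0 T ∩ g ⁻¹' Set.Ici R) :=
    isCompact_Icc.of_isClosed_subset hcl Set.inter_subset_left
  obtain ⟨m, ⟨hm, hmR⟩, hmin⟩ := hcomp.exists_isLeast hne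
  refine absurd (h m hm fun s hs => ?_) (not_lt.2 hmR)
  by_contra hs'
  exact absurd (hmin ⟨⟨hs.1, hs.2.le.trans hm.2⟩, not_lt.1 hs'⟩) (not_le.2 hs.2)

section Stability

variable {V : Fin (n - 1) → ℝ → ℝ} {u u' u'' : Fin (n - 1) → Obs n} {κ ι : Fin n} {γ : ℝ}

lemma exists_bound_potential (hb : ∀ j, IsBond j (V j) (u j) (u' j) (u'' j)) :
    ∃ M : ℝ, 0 < M ∧ ∀ φ : Fin n → ℝ, |∑ j, V j (φ (hi j) - φ (lo j))| ≤ M := by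
  obtain ⟨M, hM, h⟩ := exists_bound_ev_of_angles (F := ∑ j, u j)
    (s := {v : Var n | ∃ i, v = Var.pos i ∨ v = Var.neg i}) (by simp) (by simp)
    (sum_mem fun j _ => supported_mono (by
      rintro v (rfl | rfl | rfl | rfl) <;> simp) (hb j).mem)
  refine ⟨M, hM, fun φ => ?_⟩
  have h1 := h 0 0 φ
  rw [map_sum] at h1
  simp only [(hb _).ev_eq] at h1
  rwa [← Complex.ofReal_sum, Complex.norm_real] at h1

/-- The completed square, with `ε = 1 / L`, for the terms in the derivative of the slow energy: `z` is
the damped action, `x` and `y` are the values of the remainder and of the derivative of the adiabatic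
invariant. -/
lemma le_of_completed_square {L ε γ x y z Br Bq : ℝ} {g : ℕ} (hLε : L * ε = 1) (hε0 : 0 < ε)
    (hε1 : ε ≤ 1) (hγ : 0 < γ) (hg1 : 1 ≤ g) (h1 : |x| ≤ Br) (h2 : |y| ≤ Bq) :
    L ^ 2 * (-(ε ^ (2 * g + 2) * x) - γ * ε * z * (ε * z - ε ^ (2 * g) * y)) ≤
      ε ^ (2 * g) * (Br + γ * Bq ^ 2 / 4) := by
  have hy2 : y ^ 2 ≤ Bq ^ 2 := sq_le_sq' (abs_le.1 h2).1 (abs_le.1 h2).2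
  set e := ε ^ (2 * g) with he
  have he0 : 0 < e := by positivity
  have hLε2 : L ^ 2 * ε ^ 2 = 1 := by rw [← mul_pow, hLε, one_pow]
  -- `L² e² ≤ e` because `2 ≤ 2 g`
  have hLe : L ^ 2 * e ^ 2 ≤ e := by
    obtain ⟨l, hl⟩ : ∃ l, 2 * g = l + 2 := ⟨2 * g - 2, by omega⟩
    have h : e = ε ^ l * ε ^ 2 := by rw [he, hl, pow_add]
    calc L ^ 2 * e ^ 2 = L ^ 2 * e * e := by ring
      _ = L ^ 2 * (ε ^ l * ε ^ 2) * e := by rw [← h]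
      _ = (L ^ 2 * ε ^ 2) * (ε ^ l * e) := by ring
      _ = ε ^ l * e := by rw [hLε2, one_mul]
      _ ≤ 1 * e := mul_le_mul_of_nonneg_right (pow_le_one₀ hε0.le hε1) he0.le
      _ = e := one_mul e
  have h3 : L ^ 2 * (-(ε ^ (2 * g + 2) * x) - γ * ε * z * (ε * z - e * y)) =
      (L ^ 2 * ε ^ 2) * (-(e * x)) - γ * (L ^ 2 * ε ^ 2) * z ^ 2 +
        γ * L * (L * ε) * z * (e * y) := by
    rw [pow_add, ← he]; ring
  rw [h3, hLε2, hLε]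
  have h4 : e * (-x) ≤ e * Br := mul_le_mul_of_nonneg_left (by linarith [(abs_le.1 h1).1]) he0.le
  have h5 : 0 ≤ γ * (z - L * e * y / 2) ^ 2 := by positivity
  have h6 : L ^ 2 * e ^ 2 * y ^ 2 ≤ e * Bq ^ 2 := mul_le_mul hLe hy2 (sq_nonneg _) he0.le
  have h7 := mul_le_mul_of_nonneg_left h6 hγ.le
  linarith

/-- **Stability.** In the energy of the slow rotators, corrected by the adiabatic invariant, the
damping produces the terms `-γ I² + γ L ε^(2g) I q` (with `ε = 1 / L` and `g` the distance of the
damped and the fast rotator). Completing the square shows that their sum is at most of order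
`L ^ (2 - 4 g)`, which is negligible over times of order `L ^ (2 g - 1)`. -/
theorem exists_stability (hb : ∀ j, IsBond j (V j) (u j) (u' j) (u'' j)) (hκ : ι ≠ κ) (hγ : 0 < γ)
    {α ρ : ℝ} (hα : 0 < α) (hρ : 0 < ρ) :
    ∃ L₀ ρs : ℝ, 1 ≤ L₀ ∧ 0 < ρs ∧ ∀ L T : ℝ, L₀ ≤ L → T = α * L ^ (2 * gap ι κ - 1) →
      ∀ I θ : ℝ → Fin n → ℝ, IsTraj V ι γ T I θ → (∀ i, |shiftAct κ L (I 0) i| < ρ) →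
        ∀ t ∈ Set.Icc 0 T, ∀ i, |shiftAct κ L (I t) i| < ρs := by
  set g := gap ι κ with hg
  have hg1 : 1 ≤ g := by
    have : (ι : ℕ) ≠ κ := fun h => hκ (Fin.ext h)
    simp only [hg, gap]; omega
  obtain ⟨f, hf, r, hJ⟩ := exists_adiabatic_invariant κ (fun j => (hb j).mem) (2 * g + 2)
  obtain ⟨fa, hfa, fb, hfab⟩ := localSeries_eq_leading_add hf
  obtain ⟨q, hq⟩ := dAct_localSeries hf ι
  obtain ⟨M, hM, hMV⟩ := exists_bound_potential hb
  obtain ⟨A, hA, hAa⟩ := exists_bound_ev_of_angles (s := reach κ 1) (by simp [reach])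
    (by simp [reach]) hfa
  -- `K` bounds the slow energy initially; the box `ρs` is chosen such that a slow energy of at most
  -- `K + 1` confines the actions to it
  set K : ℝ := 1 / 2 * (n * ρ ^ 2) + M + A + 1 with hK
  have hK0 : 0 < K := by positivity
  set ρs : ℝ := 2 * (K + 1 + M + A + 1) + ρ + 1 with hρs
  have hρs0 : 0 < ρs := by positivity
  obtain ⟨Br, hBr, hBr'⟩ := exists_bound_ev r ρs
  obtain ⟨Bq, hBq, hBq'⟩ := exists_bound_ev q ρs
  obtain ⟨Bb, hBb, hBb'⟩ := exists_bound_ev fb ρs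
  set Cd : ℝ := Br + γ * Bq ^ 2 / 4 with hCd
  have hCd0 : 0 < Cd := by positivity
  refine ⟨1 + Bb + α * Cd, ρs, by nlinarith [mul_pos hα hCd0], hρs0, ?_⟩
  intro L T hL hT I θ htraj hinit
  have hL1 : 1 ≤ L := by nlinarith [mul_pos hα hCd0]
  have hL0 : 0 < L := by linarith
  have hLBb : Bb ≤ L := by nlinarith [mul_pos hα hCd0]
  have hLC : α * Cd ≤ L := by linarith
  set ε := L⁻¹ with hε
  have hε0 : 0 < ε := inv_pos.2 hL0
  have hε1 : ε ≤ 1 := inv_le_one_of_one_le₀ hL1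
  have hLε : L * ε = 1 := mul_inv_cancel₀ hL0.ne'
  -- the energy of the slow motion
  let G : Obs n := scaledHam κ u - (X (Var.act κ) + f)
  let E : ℝ → ℝ := fun t => L * (ev ε (shiftAct κ L (I t)) (θ t) G).re
  have hGevo : evo κ ι γ u G = -(eps ^ (2 * g + 2) * r) -
      C (γ : ℂ) * eps * X (Var.act ι) * (eps * X (Var.act ι) - eps ^ (2 * g) * q) := by
    have h1 : ⁅G, scaledHam κ u⁆ = -(eps ^ (2 * g + 2) * r) := by
      rw [sub_lie, lie_self, zero_sub]
      exact congrArg Neg.neg hJ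
    have h2 : dAct ι G = eps * X (Var.act ι) - eps ^ (2 * g) * q := by
      simp only [G]
      rw [map_sub, dAct_scaledHam hb, map_add, dAct_act, if_neg hκ.symm, hq]
      ring
    rw [evo_apply, h1, h2]
  have hEder : ∀ t ∈ Set.Icc 0 T, HasDerivWithinAt E
      (L ^ 2 * (-(ε ^ (2 * g + 2) * (ev ε (shiftAct κ L (I t)) (θ t) r).re) -
        γ * ε * I t ι * (ε * I t ι - ε ^ (2 * g) * (ev ε (shiftAct κ L (I t)) (θ t) q).re)))
      (Set.Icc 0 T) t := by
    intro t ht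
    refine ((htraj.hasDerivWithinAt_re_ev hb hκ hL0 G ht).const_mul L).congr_deriv ?_
    rw [hGevo, ← hε]
    have hι : shiftAct κ L (I t) ι = I t ι := by simp [shiftAct, hκ]
    simp only [map_sub, map_neg, map_mul, map_pow, ev_eps, ev_act, ev_C, hι]
    simp only [← Complex.ofReal_mul, ← Complex.ofReal_pow, Complex.sub_re, Complex.neg_re,
      Complex.re_ofReal_mul, Complex.ofReal_re]
    ring
  have hEval : ∀ t, E t = chainEnergy V (shiftAct κ L (I t)) (θ t) -
      (ev ε (shiftAct κ L (I t)) (θ t) fa).re -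
      ε * (ev ε (shiftAct κ L (I t)) (θ t) fb).re := by
    intro t
    have hGe : G = eps * (obsEnergy u - fa - eps * fb) := by
      simp only [G, scaledHam]; rw [hfab]; ring
    simp only [E]
    rw [hGe]
    simp only [map_sub, map_mul, ev_eps, ev_obsEnergy hb, Complex.sub_re, Complex.re_ofReal_mul,
      Complex.ofReal_re]
    rw [← mul_assoc, hLε, one_mul]
  have hεb : ∀ t, (∀ i, |shiftAct κ L (I t) i| ≤ ρs) →
      |ε * (ev ε (shiftAct κ L (I t)) (θ t) fb).re| ≤ 1 := by
    intro t ht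
    rw [abs_mul, abs_of_pos hε0]
    calc ε * |(ev ε (shiftAct κ L (I t)) (θ t) fb).re| ≤ ε * L := by
          refine mul_le_mul_of_nonneg_left ?_ hε0.le
          exact (Complex.abs_re_le_norm _).trans
            ((hBb' ε _ _ (by rwa [abs_of_pos hε0]) ht).trans hLBb)
      _ = 1 := by rw [mul_comm, hLε]
  have hab : ∀ t, |(ev ε (shiftAct κ L (I t)) (θ t) fa).re| ≤ A := fun t =>
    (Complex.abs_re_le_norm _).trans (hAa _ _ _)
  have hE0 : E 0 ≤ K := by
    rw [hEval 0, chainEnergy]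
    have h1 := abs_le.1 (hεb 0 fun i => (hinit i).le.trans (by rw [hρs]; linarith))
    have h2 := abs_le.1 (hab 0)
    have h3 := abs_le.1 (hMV (θ 0))
    have h4 : ∑ i, shiftAct κ L (I 0) i ^ 2 ≤ n * ρ ^ 2 := by
      have : ∀ i ∈ Finset.univ, shiftAct κ L (I 0) i ^ 2 ≤ ρ ^ 2 := fun i _ =>
        sq_le_sq' (by linarith [(abs_lt.1 (hinit i)).1]) (abs_lt.1 (hinit i)).2.le
      simpa using Finset.sum_le_card_nsmul _ _ _ this
    rw [hK]
    linarith [h1.1, h2.1, h3.2]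
  have hT0 : T * ε ^ (2 * g) * Cd ≤ 1 := by
    have h1 : L ^ (2 * g - 1) * ε ^ (2 * g) = ε := by
      obtain ⟨l, hl⟩ : ∃ l, 2 * g = l + 1 := ⟨2 * g - 1, by omega⟩
      rw [hl, Nat.add_sub_cancel, pow_succ, ← mul_assoc, ← mul_pow, hLε, one_pow, one_mul]
    calc T * ε ^ (2 * g) * Cd = α * Cd * (L ^ (2 * g - 1) * ε ^ (2 * g)) := by rw [hT]; ring
      _ = α * Cd * ε := by rw [h1]
      _ ≤ L * ε := mul_le_mul_of_nonneg_right hLC hε0.le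
      _ = 1 := hLε
  have hdle : ∀ t, (∀ i, |shiftAct κ L (I t) i| ≤ ρs) →
      L ^ 2 * (-(ε ^ (2 * g + 2) * (ev ε (shiftAct κ L (I t)) (θ t) r).re) -
        γ * ε * I t ι * (ε * I t ι - ε ^ (2 * g) * (ev ε (shiftAct κ L (I t)) (θ t) q).re)) ≤
      ε ^ (2 * g) * Cd := by
    intro t ht
    have h1 : |(ev ε (shiftAct κ L (I t)) (θ t) r).re| ≤ Br :=
      (Complex.abs_re_le_norm _).trans (hBr' ε _ _ (by rwa [abs_of_pos hε0]) ht)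
    have h2 : |(ev ε (shiftAct κ L (I t)) (θ t) q).re| ≤ Bq :=
      (Complex.abs_re_le_norm _).trans (hBq' ε _ _ (by rwa [abs_of_pos hε0]) ht)
    exact le_of_completed_square hLε hε0 hε1 hγ hg1 h1 h2
  have hcont : ∀ i, ContinuousOn (fun t => |shiftAct κ L (I t) i|) (Set.Icc 0 T) := by
    intro i t ht
    exact ((htraj.act t ht i).continuousWithinAt.sub continuousWithinAt_const).abs
  by_cases hn : Nonempty (Fin n)
  swap
  · exact fun t _ i => absurd ⟨i⟩ hn
  have key := forall_lt_of_bootstrap (R := ρs) (T := T)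
    (g := fun t => Finset.univ.sup' Finset.univ_nonempty fun i => |shiftAct κ L (I t) i|)
    (ContinuousOn.finset_sup'_apply _ fun i _ => hcont i) ?_
  · intro t ht i
    exact (Finset.le_sup' (fun i => |shiftAct κ L (I t) i|) (Finset.mem_univ i)).trans_lt (key t ht)
  intro t ht hbef
  have hbef' : ∀ s ∈ Set.Ico 0 t, ∀ i, |shiftAct κ L (I s) i| ≤ ρs := fun s hs i =>
    (Finset.le_sup' (fun i => |shiftAct κ L (I s) i|) (Finset.mem_univ i)).trans (hbef s hs).le
  have hcl : ∀ i, |shiftAct κ L (I t) i| ≤ ρs := by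
    intro i
    rcases ht.1.eq_or_lt with h0 | h0
    · rw [← h0]
      exact (hinit i).le.trans (by rw [hρs]; linarith)
    · have hc : ContinuousWithinAt (fun t => |shiftAct κ L (I t) i|) (Set.Ico 0 t) t :=
        (hcont i t ht).mono fun s hs => ⟨hs.1, hs.2.le.trans ht.2⟩
      have hne : (nhdsWithin t (Set.Ico 0 t)).NeBot := by
        rw [← mem_closure_iff_nhdsWithin_neBot, closure_Ico h0.ne]
        exact ⟨ht.1, le_rfl⟩
      exact le_of_tendsto hc (eventually_nhdsWithin_of_forall fun s hs => hbef' s hs i)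
  have hinc : E t - E 0 ≤ 1 := by
    have h1 := sub_le_mul_of_hasDerivWithinAt le_rfl ht.2 ht.1 hEder
      (C := ε ^ (2 * g) * Cd) fun s hs => hdle s (hbef' s ⟨hs.1.le, hs.2⟩)
    refine h1.trans (le_trans ?_ hT0)
    rw [sub_zero]
    have : 0 ≤ ε ^ (2 * g) * Cd := by positivity
    nlinarith [ht.2]
  have hEt : E t ≤ K + 1 := by linarith
  rw [hEval t, chainEnergy] at hEt
  have h1 := abs_le.1 (hεb t hcl)
  have h2 := abs_le.1 (hab t)
  have h3 := abs_le.1 (hMV (θ t))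
  have h4 : ∑ i, shiftAct κ L (I t) i ^ 2 ≤ 2 * (K + 1 + M + A + 1) := by linarith [h1.2, h2.2, h3.1]
  refine (Finset.sup'_lt_iff _).2 fun i _ => ?_
  have h5 : shiftAct κ L (I t) i ^ 2 ≤ ∑ i, shiftAct κ L (I t) i ^ 2 :=
    Finset.single_le_sum (f := fun i => shiftAct κ L (I t) i ^ 2) (fun i _ => sq_nonneg _)
      (Finset.mem_univ i)
  refine abs_lt_of_sq_lt_sq ?_ hρs0.le
  rw [hρs]
  nlinarith [hρ, hK0, hM, hA]

end Stability

open scoped NNReal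

/-! ### Existence of solutions -/

section GlobalExistence

variable {E : Type*} [NormedAddCommGroup E] [NormedSpace ℝ E] {v : E → E} {K : ℝ≥0}

/-- For a globally Lipschitz vector field the time of existence given by the theorem of Picard and
Lindelöf does not depend on the initial condition. -/
lemma exists_local_solution_of_lipschitz [CompleteSpace E] (hv : LipschitzWith K v) (x₀ : E) :
    ∃ x : ℝ → E, x 0 = x₀ ∧ ∀ t ∈ Set.Icc (0 : ℝ) (1 / (2 * (K + 1))),
      HasDerivWithinAt x (v (x t)) (Set.Icc 0 (1 / (2 * (K + 1)))) t := by
  have hδ : (0 : ℝ) ≤ 1 / (2 * (K + 1)) := by positivity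
  let t₀ : Set.Icc (0 : ℝ) (1 / (2 * (K + 1))) := ⟨0, le_rfl, hδ⟩
  have hPL : IsPicardLindelof (fun _ => v) t₀ x₀ ‖v x₀‖₊ 0 (‖v x₀‖₊ + K * ‖v x₀‖₊) K := by
    refine ⟨fun t _ => hv.lipschitzOnWith, fun x _ => continuousOn_const, fun t _ x hx => ?_, ?_⟩
    · have h1 := hv.dist_le_mul x x₀
      rw [dist_eq_norm] at h1
      have h2 : dist x x₀ ≤ ‖v x₀‖ := by simpa using hx
      have h3 : ‖v x‖ ≤ ‖v x₀‖ + ‖v x - v x₀‖ := by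
        simpa using norm_add_le (v x₀) (v x - v x₀)
      have h4 : (K : ℝ) * dist x x₀ ≤ K * ‖v x₀‖ := mul_le_mul_of_nonneg_left h2 K.2
      push_cast
      linarith
    · have h0 : max (1 / (2 * ((K : ℝ) + 1)) - (t₀ : ℝ)) ((t₀ : ℝ) - 0) = 1 / (2 * (K + 1)) := by
        simp only [t₀, sub_zero]
        exact max_eq_left hδ
      rw [h0]
      push_cast
      have hK : (0 : ℝ) ≤ K := K.2
      rw [mul_one_div, div_le_iff₀ (by positivity)]
      nlinarith [norm_nonneg (v x₀), mul_nonneg hK (norm_nonneg (v x₀))]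
  exact hPL.exists_eq_forall_mem_Icc_hasDerivWithinAt₀

lemma exists_glued_solution {x y : ℝ → E} {c δ : ℝ} (hc : 0 ≤ c) (hδ : 0 ≤ δ)
    (hx : ∀ t ∈ Set.Icc 0 c, HasDerivWithinAt x (v (x t)) (Set.Icc 0 c) t)
    (hy : ∀ t ∈ Set.Icc 0 δ, HasDerivWithinAt y (v (y t)) (Set.Icc 0 δ) t) (hxy : y 0 = x c) :
    ∃ z : ℝ → E, z 0 = x 0 ∧
      ∀ t ∈ Set.Icc 0 (c + δ), HasDerivWithinAt z (v (z t)) (Set.Icc 0 (c + δ)) t := by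
  classical
  let z : ℝ → E := fun t => if t ≤ c then x t else y (t - c)
  have hz1 : ∀ t ∈ Set.Icc 0 c, z t = x t := fun t ht => if_pos ht.2
  have hz2 : ∀ t ∈ Set.Icc c (c + δ), z t = y (t - c) := by
    intro t ht
    rcases ht.1.eq_or_lt with h | h
    · subst h; simp [z, hxy]
    · exact if_neg (not_le.2 h)
  refine ⟨z, hz1 0 ⟨le_rfl, hc⟩, fun t ht => ?_⟩
  rw [← Set.Icc_union_Icc_eq_Icc hc (by linarith : c ≤ c + δ)]
  -- at a point outside one of the two intervals the derivative within it may be any vector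
  refine HasDerivWithinAt.union ?_ ?_
  · by_cases h : t ∈ Set.Icc 0 c
    · rw [hz1 t h]
      exact (hx t h).congr hz1 (hz1 t h)
    · exact HasFDerivWithinAt.hasDerivWithinAt
        (HasFDerivWithinAt.of_notMem_closure (f' := ContinuousLinearMap.toSpanSingleton ℝ (v (z t)))
          (by rwa [isClosed_Icc.closure_eq])) |>.congr_deriv (by simp)
  · by_cases h : t ∈ Set.Icc c (c + δ)
    · rw [hz2 t h]
      have h1 := hy (t - c) ⟨by linarith [h.1], by linarith [h.2]⟩
      have h2 : HasDerivWithinAt (fun s => y (s - c)) (v (y (t - c))) (Set.Icc c (c + δ)) t := by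
        have h3 := h1.scomp (h := fun s => s - c) t
          ((hasDerivWithinAt_id t (Set.Icc c (c + δ))).sub_const c)
          (fun s hs => Set.mem_Icc.2 ⟨by linarith [hs.1], by linarith [hs.2]⟩)
        rw [one_smul] at h3
        exact h3
      exact h2.congr hz2 (hz2 t h)
    · exact HasFDerivWithinAt.hasDerivWithinAt
        (HasFDerivWithinAt.of_notMem_closure (f' := ContinuousLinearMap.toSpanSingleton ℝ (v (z t)))
          (by rwa [isClosed_Icc.closure_eq])) |>.congr_deriv (by simp)

theorem exists_global_solution_of_lipschitz [CompleteSpace E] (hv : LipschitzWith K v) (x₀ : E)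
    (T : ℝ) :
    ∃ x : ℝ → E, x 0 = x₀ ∧
      ∀ t ∈ Set.Icc 0 T, HasDerivWithinAt x (v (x t)) (Set.Icc 0 T) t := by
  set δ : ℝ := 1 / (2 * (K + 1)) with hδ
  have hδ0 : 0 < δ := by positivity
  have key : ∀ m : ℕ, ∃ x : ℝ → E, x 0 = x₀ ∧
      ∀ t ∈ Set.Icc 0 (m * δ), HasDerivWithinAt x (v (x t)) (Set.Icc 0 (m * δ)) t := by
    intro m
    induction m with
    | zero =>
      refine ⟨fun _ => x₀, rfl, fun t _ => ?_⟩
      simp only [Nat.cast_zero, zero_mul, Set.Icc_self]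
      exact (HasFDerivWithinAt.hasDerivWithinAt (HasFDerivWithinAt.of_subsingleton
        (f' := ContinuousLinearMap.toSpanSingleton ℝ (v x₀)) Set.subsingleton_singleton)).congr_deriv
        (by simp)
    | succ m ih =>
      obtain ⟨x, hx0, hx⟩ := ih
      obtain ⟨y, hy0, hy⟩ := exists_local_solution_of_lipschitz hv (x (m * δ))
      obtain ⟨z, hz0, hz⟩ := exists_glued_solution (by positivity) hδ0.le hx hy hy0
      refine ⟨z, hz0.trans hx0, ?_⟩
      rwa [Nat.cast_succ, add_mul, one_mul]
  obtain ⟨m, hm⟩ := exists_nat_ge (T / δ)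
  obtain ⟨x, hx0, hx⟩ := key m
  have hTm : T ≤ m * δ := (div_le_iff₀ hδ0).1 hm
  exact ⟨x, hx0, fun t ht => (hx t ⟨ht.1, ht.2.trans hTm⟩).mono (Set.Icc_subset_Icc_right hTm)⟩

end GlobalExistence

lemma exists_bound_of_periodic {f : ℝ → ℝ} (hf : Continuous f) {p : ℝ} (hp : 0 < p)
    (hper : Function.Periodic f p) : ∃ M : ℝ, 0 < M ∧ ∀ s, |f s| ≤ M := by
  obtain ⟨M, hM⟩ := isCompact_Icc.exists_bound_of_continuousOn (s := Set.Icc 0 p) hf.continuousOn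
  refine ⟨|M| + 1, by positivity, fun s => ?_⟩
  obtain ⟨y, hy, hys⟩ := hper.exists_mem_Ico₀ hp s
  rw [hys, ← Real.norm_eq_abs]
  linarith [hM y ⟨hy.1, hy.2.le⟩, le_abs_self M]

lemma periodic_deriv {f : ℝ → ℝ} {p : ℝ} (h : Function.Periodic f p) :
    Function.Periodic (deriv f) p := by
  intro s
  rw [← deriv_comp_add_const]
  exact congrArg (fun g => deriv g s) (funext h)

lemma periodic_lift (V : Torus → ℝ) : Function.Periodic (lift V) (2 * Real.pi) := by
  intro s
  simp only [lift]
  rw [AddCircle.coe_add_period]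

lemma IsSmooth.iterate_deriv {V : Torus → ℝ} (hV : IsSmooth V) (m : ℕ) :
    ContDiff ℝ 1 (deriv^[m] (lift V)) :=
  (ContDiff.iterate_deriv m hV).of_le (by exact_mod_cast le_top)

/-- Each derivative of a smooth potential is bounded. -/
lemma IsSmooth.exists_bound {V : Torus → ℝ} (hV : IsSmooth V) (m : ℕ) :
    ∃ M : ℝ, 0 < M ∧ ∀ s, |deriv^[m] (lift V) s| ≤ M := by
  refine exists_bound_of_periodic (hV.iterate_deriv m).continuous Real.two_pi_pos ?_
  induction m with
  | zero => exact periodic_lift V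
  | succ m ih =>
    rw [Function.iterate_succ_apply']
    exact periodic_deriv ih

lemma IsSmooth.exists_lipschitz {V : Torus → ℝ} (hV : IsSmooth V) (m : ℕ) :
    ∃ M : ℝ, 0 < M ∧ ∀ s t, |deriv^[m] (lift V) s - deriv^[m] (lift V) t| ≤ M * |s - t| := by
  obtain ⟨M, hM, h⟩ := hV.exists_bound (m + 1)
  refine ⟨M, hM, fun s t => ?_⟩
  rw [Function.iterate_succ'] at h
  exact Convex.norm_image_sub_le_of_norm_deriv_le (s := Set.univ)
    (fun x _ => ((hV.iterate_deriv m).differentiable one_ne_zero) x) (fun x _ => h x) convex_univ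
    trivial trivial

/-- A uniform version of `IsSmooth.exists_lipschitz` for finitely many potentials. -/
lemma exists_lipschitz_family {ι : Type*} [Fintype ι] {U : ι → Torus → ℝ}
    (hU : ∀ i, IsSmooth (U i)) (m : ℕ) : ∃ M : ℝ, 0 < M ∧
      ∀ i s t, |deriv^[m] (lift (U i)) s - deriv^[m] (lift (U i)) t| ≤ M * |s - t| := by
  choose M hM h using fun i => (hU i).exists_lipschitz m
  refine ⟨∑ i, M i + 1, by
    have := Finset.sum_nonneg fun i (_ : i ∈ Finset.univ) => (hM i).le
    linarith, fun i s t => (h i s t).trans ?_⟩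
  have := Finset.single_le_sum (fun i _ => (hM i).le) (Finset.mem_univ i)
  exact mul_le_mul_of_nonneg_right (by linarith) (abs_nonneg _)

lemma exists_bound_family {ι : Type*} [Fintype ι] {U : ι → Torus → ℝ}
    (hU : ∀ i, IsSmooth (U i)) (m : ℕ) : ∃ M : ℝ, 0 < M ∧
      ∀ i s, |deriv^[m] (lift (U i)) s| ≤ M := by
  choose M hM h using fun i => (hU i).exists_bound m
  refine ⟨∑ i, M i + 1, by
    have := Finset.sum_nonneg fun i (_ : i ∈ Finset.univ) => (hM i).le
    linarith, fun i s => (h i s).trans ?_⟩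
  have := Finset.single_le_sum (fun i _ => (hM i).le) (Finset.mem_univ i)
  linarith

theorem exists_traj {U : Fin (n - 1) → Torus → ℝ} (hU : ∀ j, IsSmooth (U j)) (ι : Fin n)
    {γ T : ℝ} (hγ : 0 < γ) (I₀ θ₀ : Fin n → ℝ) :
    ∃ I θ : ℝ → Fin n → ℝ, I 0 = I₀ ∧ θ 0 = θ₀ ∧ IsTraj (fun j => lift (U j)) ι γ T I θ := by
  obtain ⟨M, hM, hlip⟩ := exists_lipschitz_family hU 1
  simp only [Function.iterate_one] at hlip
  set v : (Fin n → ℝ) × (Fin n → ℝ) → (Fin n → ℝ) × (Fin n → ℝ) := fun x =>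
    (fun i => force (fun j => lift (U j)) x.2 i - if i = ι then γ * x.1 i else 0, x.1) with hvdef
  set K : ℝ := (∑ _j : Fin (n - 1), 4 * M) + γ + 1 with hK
  have hS0 : 0 ≤ ∑ _j : Fin (n - 1), 4 * M := Finset.sum_nonneg fun _ _ => by positivity
  have hK0 : 0 ≤ K := by positivity
  have hv : LipschitzWith ⟨K, hK0⟩ v := by
    refine LipschitzWith.of_dist_le_mul fun x y => ?_
    set d := dist x y with hd
    have hd0 : 0 ≤ d := dist_nonneg
    have h1 : ∀ i, |x.1 i - y.1 i| ≤ d := fun i =>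
      (dist_le_pi_dist x.1 y.1 i).trans (le_max_left _ _)
    have h2 : ∀ i, |x.2 i - y.2 i| ≤ d := fun i =>
      (dist_le_pi_dist x.2 y.2 i).trans (le_max_right _ _)
    show max (dist (v x).1 (v y).1) (dist (v x).2 (v y).2) ≤ K * d
    refine max_le ((dist_pi_le_iff (by positivity)).2 fun i => ?_) ?_
    · have hF : |force (fun j => lift (U j)) x.2 i - force (fun j => lift (U j)) y.2 i| ≤
          (∑ _j : Fin (n - 1), 4 * M) * d := by
        rw [force, force, ← Finset.sum_sub_distrib, Finset.sum_mul]
        refine (Finset.abs_sum_le_sum_abs _ _).trans (Finset.sum_le_sum fun j _ => ?_)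
        have h3 := hlip j (x.2 (hi j) - x.2 (lo j)) (y.2 (hi j) - y.2 (lo j))
        have h4 : |x.2 (hi j) - x.2 (lo j) - (y.2 (hi j) - y.2 (lo j))| ≤ 2 * d := by
          have := abs_sub (x.2 (hi j) - y.2 (hi j)) (x.2 (lo j) - y.2 (lo j))
          rw [show x.2 (hi j) - x.2 (lo j) - (y.2 (hi j) - y.2 (lo j)) =
            (x.2 (hi j) - y.2 (hi j)) - (x.2 (lo j) - y.2 (lo j)) by ring]
          linarith [h2 (hi j), h2 (lo j)]
        have h5 := h3.trans (mul_le_mul_of_nonneg_left h4 hM.le)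
        have h6 : 0 ≤ M * d := by positivity
        split_ifs <;> simp only [sub_zero, zero_sub, sub_self, abs_zero, neg_sub_neg]
        all_goals first | linarith | (rw [abs_sub_comm]; linarith)
      have hD : |(if i = ι then γ * x.1 i else 0) - (if i = ι then γ * y.1 i else 0)| ≤ γ * d := by
        split_ifs
        · rw [← mul_sub, abs_mul, abs_of_pos hγ]
          exact mul_le_mul_of_nonneg_left (h1 i) hγ.le
        · simp only [sub_zero, abs_zero]; positivity
      rw [Real.dist_eq, hvdef]
      simp only
      rw [sub_sub_sub_comm, hK]
      have := abs_sub (force (fun j => lift (U j)) x.2 i - force (fun j => lift (U j)) y.2 i)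
        ((if i = ι then γ * x.1 i else 0) - (if i = ι then γ * y.1 i else 0))
      nlinarith
    · show dist x.1 y.1 ≤ K * d
      have h3 : dist x.1 y.1 ≤ d := le_max_left _ _
      rw [hK]
      nlinarith
  obtain ⟨x, hx0, hx⟩ := exists_global_solution_of_lipschitz hv (I₀, θ₀) T
  refine ⟨fun t => (x t).1, fun t => (x t).2, by simp [hx0], by simp [hx0], ?_, ?_⟩
  · intro t ht
    have h1 : HasDerivWithinAt (fun s => (x s).1) (v (x t)).1 (Set.Icc 0 T) t :=
      (ContinuousLinearMap.fst ℝ (Fin n → ℝ) (Fin n → ℝ)).hasFDerivAt.comp_hasDerivWithinAt t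
        (hx t ht)
    exact hasDerivWithinAt_pi.1 h1
  · intro t ht
    have h1 : HasDerivWithinAt (fun s => (x s).2) (v (x t)).2 (Set.Icc 0 T) t :=
      (ContinuousLinearMap.snd ℝ (Fin n → ℝ) (Fin n → ℝ)).hasFDerivAt.comp_hasDerivWithinAt t
        (hx t ht)
    exact hasDerivWithinAt_pi.1 h1

/-! ### Recovering the fast force from the damped action -/

section DerivationIdeals

variable {R A : Type*} [CommRing R] [CommRing A] [Algebra R A] (D : Derivation R A A) (x : A)

/-- The ideal that is generated by the derivatives `D^j x` with `j ≤ d`. -/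
def derIdeal : ℕ → Ideal A
  | 0 => Ideal.span {x}
  | d + 1 => derIdeal d ⊔ Ideal.span (D '' derIdeal d)

variable {D x}

lemma derIdeal_mono : Monotone (derIdeal D x) :=
  monotone_nat_of_le_succ fun _ => le_sup_left

lemma apply_mem_derIdeal {d : ℕ} {f : A} (hf : f ∈ derIdeal D x d) : D f ∈ derIdeal D x (d + 1) :=
  (le_sup_right : _ ≤ derIdeal D x (d + 1)) (Ideal.subset_span ⟨f, hf, rfl⟩)

lemma exists_eq_add_apply {d : ℕ} {f : A} (hf : f ∈ derIdeal D x (d + 1)) :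
    ∃ g ∈ derIdeal D x d, ∃ h ∈ derIdeal D x d, f = g + D h := by
  obtain ⟨g, hg, h, hh, rfl⟩ := Submodule.mem_sup.1 hf
  suffices ∃ g ∈ derIdeal D x d, ∃ h' ∈ derIdeal D x d, h = g + D h' by
    obtain ⟨g', hg', h', hh', rfl⟩ := this
    exact ⟨g + g', add_mem hg hg', h', hh', by ring⟩
  refine Submodule.span_induction ?_ ⟨0, zero_mem _, 0, zero_mem _, by simp⟩ ?_ ?_ hh
  · rintro _ ⟨f, hf, rfl⟩
    exact ⟨0, zero_mem _, f, hf, by simp⟩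
  · rintro _ _ _ _ ⟨g, hg, h, hh, rfl⟩ ⟨g', hg', h', hh', rfl⟩
    exact ⟨g + g', add_mem hg hg', h + h', add_mem hh hh', by rw [map_add]; ring⟩
  · -- `c D h = D (c h) - h D c`
    rintro c _ _ ⟨g, hg, h, hh, rfl⟩
    refine ⟨c * g - h * D c, sub_mem (Ideal.mul_mem_left _ _ hg) (Ideal.mul_mem_right _ _ hh),
      c * h, Ideal.mul_mem_left _ _ hh, ?_⟩
    rw [Derivation.leibniz, smul_eq_mul, smul_eq_mul, smul_eq_mul]
    ring

lemma sq_mul_apply_mem_derIdeal {d : ℕ} {a f : A} (h : a * f ∈ derIdeal D x d) :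
    a ^ 2 * D f ∈ derIdeal D x (d + 1) := by
  have h1 : D (a * (a * f)) ∈ derIdeal D x (d + 1) :=
    apply_mem_derIdeal (Ideal.mul_mem_left _ _ h)
  have h2 : (a * f) * (2 * D a) ∈ derIdeal D x (d + 1) :=
    derIdeal_mono d.le_succ (Ideal.mul_mem_right _ _ h)
  have h3 : a ^ 2 * D f = D (a * (a * f)) - (a * f) * (2 * D a) := by
    simp only [Derivation.leibniz, smul_eq_mul]; ring
  rw [h3]
  exact sub_mem h1 h2

end DerivationIdeals

section ForceRecovery

variable {V : Fin (n - 1) → ℝ → ℝ} {u u' u'' : Fin (n - 1) → Obs n} {κ ι : Fin n} {γ : ℝ}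

lemma evo_eps_pow_mul (m : ℕ) (f : Obs n) : evo κ ι γ u (eps ^ m * f) = eps ^ m * evo κ ι γ u f := by
  rw [evo_apply, evo_apply, eps_pow_mul_lie, dAct_eps_pow_mul]; ring

lemma evo_bond' (hb : ∀ j, IsBond j (V j) (u j) (u' j) (u'' j)) {j : Fin (n - 1)}
    (h1 : hi j ≠ κ) (h2 : lo j ≠ κ) :
    evo κ ι γ u (u' j) = u'' j * (eps * X (Var.act (hi j)) - eps * X (Var.act (lo j))) := by
  have hA : ∀ i, dAct i (u' j) = 0 := fun i => dAct_eq_zero (by simp [bondVars]) (hb j).mem'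
  rw [evo_apply, hA, mul_zero, sub_zero, lie_def]
  simp only [hA, zero_mul, sub_zero]
  rw [Finset.sum_eq_add (lo j) (hi j) (lo_ne_hi j)]
  · rw [(hb j).dAng_lo', (hb j).dAng_hi', dAct_scaledHam hb, dAct_scaledHam hb, if_neg h1.symm,
      if_neg h2.symm]
    ring
  · rintro i _ ⟨h3, h4⟩
    rw [dAng_eq_zero (by simp [bondVars, h3, h4]) (by simp [bondVars, h3, h4]) (hb j).mem', zero_mul]
  · simp
  · simp

/-- `a` takes real values, which are bounded below by a power of a common lower bound of the
second derivatives of the first `m` bond potentials. -/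
def IsBoundedBelow (V : Fin (n - 1) → ℝ → ℝ) (m : ℕ) (a : Obs n) : Prop :=
  ∃ e : ℕ, ∀ (ε : ℝ) (b φ : Fin n → ℝ), ∃ w : ℝ, ev ε b φ a = w ∧ ∀ η : ℝ, 0 < η →
    (∀ j : Fin (n - 1), (j : ℕ) < m → η ≤ |deriv (deriv (V j)) (φ (hi j) - φ (lo j))|) →
    η ^ e ≤ |w|

lemma IsBoundedBelow.succ (hb : ∀ j, IsBond j (V j) (u j) (u' j) (u'' j)) {m : ℕ} {a : Obs n}
    (ha : IsBoundedBelow V m a) (hm : m < n - 1) :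
    IsBoundedBelow V (m + 1) (a ^ 4 * u'' ⟨m, hm⟩) := by
  obtain ⟨e, he⟩ := ha
  refine ⟨e * 4 + 1, fun ε b φ => ?_⟩
  obtain ⟨w, hw, hwη⟩ := he ε b φ
  refine ⟨w ^ 4 * deriv (deriv (V ⟨m, hm⟩)) (φ (hi ⟨m, hm⟩) - φ (lo ⟨m, hm⟩)), ?_, ?_⟩
  · rw [map_mul, map_pow, hw, (hb _).ev_eq'']
    push_cast
    rfl
  · intro η hη h
    have h1 := hwη η hη fun j hj => h j (by omega)
    have h2 := h ⟨m, hm⟩ (Nat.lt_succ_self m)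
    rw [abs_mul, abs_pow, pow_succ, pow_mul]
    exact mul_le_mul (pow_le_pow_left₀ (by positivity) h1 4) h2 hη.le (by positivity)

/-- Where the second derivatives of the bond potentials do not vanish, the action of the rotator `m`
and the force across the bond `m` are combinations of the first `2 m` resp. `2 m + 1` derivatives of
the action of the first rotator, for each rotator `m` to the left of the fast one. Each equation of
motion is solved for the variable of the next rotator. -/
theorem exists_mem_derIdeal (hb : ∀ j, IsBond j (V j) (u j) (u' j) (u'' j)) (hι : (ι : ℕ) = 0)
    (m : ℕ) (hm : m < κ) : ∃ a : Obs n, IsBoundedBelow V m a ∧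
      a * (eps ^ (2 * m) * X (Var.act ⟨m, hm.trans κ.2⟩)) ∈
        derIdeal (evo κ ι γ u) (X (Var.act ι)) (2 * m) ∧
      a ^ 2 * (eps ^ (2 * m + 1) * u' ⟨m, by omega⟩) ∈
        derIdeal (evo κ ι γ u) (X (Var.act ι)) (2 * m + 1) := by
  induction m with
  | zero =>
    have hι' : (⟨0, hm.trans κ.2⟩ : Fin n) = ι := Fin.ext hι.symm
    refine ⟨1, ⟨0, fun _ _ _ => ⟨1, by simp, by simp⟩⟩, ?_, ?_⟩
    · rw [hι', pow_zero, one_mul, one_mul]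
      exact Ideal.subset_span rfl
    · have h0 : X (Var.act ι) ∈ derIdeal (evo κ ι γ u) (X (Var.act ι) : Obs n) 0 :=
        Ideal.subset_span rfl
      have h1 := apply_mem_derIdeal h0
      have h2 : evo κ ι γ u (X (Var.act ι)) =
          eps * u' ⟨0, by omega⟩ - C (γ : ℂ) * eps * X (Var.act ι) := by
        rw [evo_act, if_pos rfl, dAng_scaledHam, Finset.sum_eq_single ⟨0, by omega⟩, dAng_bond_eq hb,
          if_neg, if_pos, zero_sub, mul_neg, neg_neg]
        · exact Fin.ext hι.symm
        · intro h; have := congrArg Fin.val h; simp [hi, hι] at this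
        · intro j _ hj
          rw [dAng_bond_eq hb, if_neg, if_neg, sub_zero]
          · intro h; have := congrArg Fin.val h; simp [lo, hι] at this; exact hj (Fin.ext this)
          · intro h; have := congrArg Fin.val h; simp [hi, hι] at this
        · simp
      have h3 := add_mem h1 (derIdeal_mono (Nat.le_succ 0)
        (Ideal.mul_mem_left _ (C (γ : ℂ) * eps) h0))
      rw [h2, sub_add_cancel] at h3
      simpa using h3
  | succ m ih =>
    obtain ⟨a, ha, hact, hbond⟩ := ih (by omega)
    have hmn : m < n - 1 := by omega
    set j : Fin (n - 1) := ⟨m, hmn⟩ with hj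
    set i : Fin n := ⟨m + 1, hm.trans κ.2⟩ with hi'
    have hhi : hi j = i := rfl
    have hlo : lo j = ⟨m, by omega⟩ := rfl
    have hiκ : hi j ≠ κ := fun h => by have := congrArg Fin.val h; simp [hi, hj] at this; omega
    have hlκ : lo j ≠ κ := fun h => by have := congrArg Fin.val h; simp [lo, hj] at this; omega
    have hA : a ^ 4 * u'' j * (eps ^ (2 * (m + 1)) * X (Var.act i)) ∈
        derIdeal (evo κ ι γ u) (X (Var.act ι)) (2 * (m + 1)) := by
      have h1 := sq_mul_apply_mem_derIdeal hbond
      rw [evo_eps_pow_mul, evo_bond' hb hiκ hlκ, hhi, hlo] at h1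
      have h2 := derIdeal_mono (by omega : 2 * m ≤ 2 * m + 1 + 1)
        (Ideal.mul_mem_left _ (a ^ 3 * u'' j * eps ^ 2) hact)
      have h3 := add_mem h1 h2
      rw [show 2 * (m + 1) = 2 * m + 1 + 1 by ring]
      convert h3 using 1
      ring
    refine ⟨a ^ 4 * u'' j, ha.succ hb hmn, hA, ?_⟩
    have hmn' : m + 1 < n - 1 := by omega
    set j' : Fin (n - 1) := ⟨m + 1, hmn'⟩ with hj'
    have hlo' : lo j' = i := rfl
    have h1 := sq_mul_apply_mem_derIdeal hA
    have h2 : evo κ ι γ u (X (Var.act i)) = eps * u' j' - eps * u' j := by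
      have hne : j ≠ j' := fun h => by have := congrArg Fin.val h; simp [hj, hj'] at this
      rw [evo_act, if_neg, sub_zero, dAng_scaledHam, Finset.sum_eq_add j j' hne, dAng_bond_eq hb,
        dAng_bond_eq hb, if_pos hhi, if_neg, if_neg, if_pos hlo']
      · ring
      · intro h; have := congrArg Fin.val h; simp [hi, hj', hi'] at this
      · intro h; have := congrArg Fin.val h; simp [lo, hj, hi'] at this
      · rintro l _ ⟨hl1, hl2⟩
        rw [dAng_bond_eq hb, if_neg, if_neg, sub_zero]
        · intro h; have := congrArg Fin.val h; simp [lo, hi'] at this; exact hl2 (Fin.ext this)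
        · intro h; have := congrArg Fin.val h; simp [hi, hi'] at this; exact hl1 (Fin.ext this)
      · simp
      · simp
      · intro h; have := congrArg Fin.val h; simp [hi', hι] at this
    rw [evo_eps_pow_mul, h2] at h1
    have h3 := derIdeal_mono (by omega : 2 * m + 1 ≤ 2 * (m + 1) + 1)
      (Ideal.mul_mem_left _ (a ^ 6 * u'' j ^ 2 * eps ^ 2) hbond)
    have h4 := add_mem h1 h3
    convert h4 using 1
    ring

/-! ### Testing against cut-off functions -/

section Testing

variable {L T : ℝ} {I θ : ℝ → Fin n → ℝ}

lemma IsTraj.continuousOn_ev (h : IsTraj V ι γ T I θ)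
    (hb : ∀ j, IsBond j (V j) (u j) (u' j) (u'' j)) (hκ : ι ≠ κ) (hL : 0 < L) (F : Obs n) :
    ContinuousOn (fun s => ev L⁻¹ (shiftAct κ L (I s)) (θ s) F) (Set.Icc 0 T) := fun _ ht =>
  (h.hasDerivWithinAt_ev hb hκ hL F ht).continuousWithinAt

lemma IsTraj.continuousOn_act (h : IsTraj V ι γ T I θ) (i : Fin n) :
    ContinuousOn (fun s => I s i) (Set.Icc 0 T) := fun t ht => (h.act t ht i).continuousWithinAt

/-- An element of the ideal generated by the first `d` rescaled derivatives of the damped action is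
small in the weak sense if the damped action is small: integration by parts moves the derivatives to
the cut-off function. -/
theorem exists_bound_integral_derIdeal (hb : ∀ j, IsBond j (V j) (u j) (u' j) (u'' j)) (hκ : ι ≠ κ)
    (R : ℝ) (d : ℕ) (F : Obs n) (hF : F ∈ derIdeal (evo κ ι γ u) (X (Var.act ι)) d)
    (χ : Polynomial ℝ) (hχ : (Polynomial.X * (1 - Polynomial.X)) ^ d ∣ χ) :
    ∃ B : ℝ, 0 < B ∧ ∀ (L T : ℝ) (I θ : ℝ → Fin n → ℝ), 1 ≤ L → IsTraj V ι γ T I θ →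
      (∀ t ∈ Set.Icc 0 T, ∀ i, |shiftAct κ L (I t) i| ≤ R) →
      ∀ a, 0 ≤ a → a + 1 ≤ T →
        ‖∫ t in a..(a + 1), ((χ.eval (t - a) : ℝ) : ℂ) * ev L⁻¹ (shiftAct κ L (I t)) (θ t) F‖ ≤
          B * ∫ t in a..(a + 1), |I t ι| := by
  induction d generalizing F χ with
  | zero =>
    obtain ⟨c, rfl⟩ := Ideal.mem_span_singleton'.1 hF
    obtain ⟨B, hB, hBc⟩ := exists_bound_ev c R
    obtain ⟨M, hM⟩ := isCompact_Icc.exists_bound_of_continuousOn (s := Set.Icc (0 : ℝ) 1)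
      χ.continuous.continuousOn
    refine ⟨(|M| + 1) * B, by positivity, fun L T I θ hL h hR a ha haT => ?_⟩
    have hab : a ≤ a + 1 := by linarith
    have hsub : Set.Icc a (a + 1) ⊆ Set.Icc 0 T := Set.Icc_subset_Icc ha haT
    rw [← intervalIntegral.integral_const_mul]
    refine intervalIntegral.norm_integral_le_of_norm_le hab ?_ ?_
    · refine Filter.Eventually.of_forall fun t ht => ?_
      have ht' : t ∈ Set.Icc a (a + 1) := Set.Ioc_subset_Icc_self ht
      have hε : |L⁻¹| ≤ 1 := by
        rw [abs_of_pos (by positivity)]; exact inv_le_one_of_one_le₀ hL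
      have h1 := hBc L⁻¹ _ (θ t) hε (hR t (hsub ht'))
      have h2 := hM (t - a) ⟨by linarith [ht'.1], by linarith [ht'.2]⟩
      rw [map_mul, ev_act, norm_mul, norm_mul, Complex.norm_real, Complex.norm_real]
      have h3 : shiftAct κ L (I t) ι = I t ι := by simp [shiftAct, hκ]
      rw [h3, Real.norm_eq_abs (I t ι), ← mul_assoc]
      refine mul_le_mul_of_nonneg_right ?_ (abs_nonneg _)
      exact mul_le_mul (by linarith [le_abs_self M]) h1 (norm_nonneg _) (by positivity)
    · refine (ContinuousOn.intervalIntegrable ?_)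
      rw [Set.uIcc_of_le hab]
      exact (continuousOn_const.mul ((h.continuousOn_act ι).mono hsub).abs)
  | succ d ih =>
    obtain ⟨g, hg, f, hf, rfl⟩ := exists_eq_add_apply hF
    obtain ⟨ψ, rfl⟩ := hχ
    set p : Polynomial ℝ := Polynomial.X * (1 - Polynomial.X) with hp
    set χ := p ^ (d + 1) * ψ with hχ
    obtain ⟨B₁, hB₁, h₁⟩ := ih g hg χ ⟨p * ψ, by rw [hχ]; ring⟩
    obtain ⟨B₂, hB₂, h₂⟩ := ih f hf χ.derivative ⟨((d : Polynomial ℝ) + 1) * p.derivative * ψ +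
      p * ψ.derivative, by
        rw [hχ, Polynomial.derivative_mul, Polynomial.derivative_pow_succ]
        simp only [map_add, map_natCast, map_one]
        ring⟩
    refine ⟨B₁ + B₂, by positivity, fun L T I θ hL h hR a ha haT => ?_⟩
    have hL0 : 0 < L := by linarith
    have hab : a ≤ a + 1 := by linarith
    have hsub : Set.Icc a (a + 1) ⊆ Set.Icc 0 T := Set.Icc_subset_Icc ha haT
    have hpoly : ∀ q : Polynomial ℝ, ContinuousOn (fun t : ℝ => ((q.eval (t - a) : ℝ) : ℂ))
        (Set.Icc a (a + 1)) := fun q =>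
      (Complex.continuous_ofReal.comp
        (q.continuous.comp (continuous_id.sub continuous_const))).continuousOn
    have hint : ∀ (q : Polynomial ℝ) (G : Obs n), IntervalIntegrable
        (fun t => ((q.eval (t - a) : ℝ) : ℂ) * ev L⁻¹ (shiftAct κ L (I t)) (θ t) G)
        MeasureTheory.volume a (a + 1) := by
      intro q G
      refine ContinuousOn.intervalIntegrable ?_
      rw [Set.uIcc_of_le hab]
      exact (hpoly q).mul ((h.continuousOn_ev hb hκ hL0 G).mono hsub)
    have hparts : ∫ t in a..(a + 1), (((χ.derivative.eval (t - a) : ℝ) : ℂ) *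
          ev L⁻¹ (shiftAct κ L (I t)) (θ t) f +
        L * (((χ.eval (t - a) : ℝ) : ℂ) * ev L⁻¹ (shiftAct κ L (I t)) (θ t) (evo κ ι γ u f))) = 0 := by
      rw [intervalIntegral.integral_eq_sub_of_hasDerivAt_of_le hab
        (f := fun t => ((χ.eval (t - a) : ℝ) : ℂ) * ev L⁻¹ (shiftAct κ L (I t)) (θ t) f)
        ((hpoly χ).mul ((h.continuousOn_ev hb hκ hL0 f).mono hsub))]
      · have e0 : χ.eval (a - a) = 0 := by simp [hχ, hp]
        have e1 : χ.eval (a + 1 - a) = 0 := by simp [hχ, hp]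
        simp only [e0, e1]
        simp
      · intro t ht
        have ht' := hsub (Set.Ioo_subset_Icc_self ht)
        have hev := (h.hasDerivWithinAt_ev hb hκ hL0 f ht').hasDerivAt
          (Icc_mem_nhds (by linarith [ht.1]) (by linarith [ht.2]))
        have hpd : HasDerivAt (fun t : ℝ => ((χ.eval (t - a) : ℝ) : ℂ))
            ((χ.derivative.eval (t - a) : ℝ) : ℂ) t := by
          have := ((χ.hasDerivAt (t - a)).comp t ((hasDerivAt_id t).sub_const a)).ofReal_comp
          simpa using this
        exact (hpd.fun_mul hev).congr_deriv (by ring)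
      · exact (hint _ _).add ((hint _ _).const_mul _)
    rw [intervalIntegral.integral_add (hint _ _) ((hint _ _).const_mul _),
      intervalIntegral.integral_const_mul] at hparts
    simp only [map_add, mul_add]
    rw [intervalIntegral.integral_add (hint _ _) (hint _ _)]
    have h3 := h₁ L T I θ hL h hR a ha haT
    have h4 := h₂ L T I θ hL h hR a ha haT
    set Z := ∫ t in a..(a + 1), ((χ.eval (t - a) : ℝ) : ℂ) *
      ev L⁻¹ (shiftAct κ L (I t)) (θ t) (evo κ ι γ u f)
    have h5 : ‖(L : ℂ) * Z‖ ≤ B₂ * ∫ t in a..(a + 1), |I t ι| := by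
      rw [eq_neg_of_add_eq_zero_right hparts, norm_neg]
      exact h4
    rw [norm_mul, Complex.norm_real, Real.norm_eq_abs, abs_of_pos hL0] at h5
    have h6 : ‖Z‖ ≤ L * ‖Z‖ := le_mul_of_one_le_left (norm_nonneg _) hL
    refine (norm_add_le _ _).trans ?_
    linarith

end Testing

end ForceRecovery

/-! ### Slow windows: where the damped action is small, the left part of the chain is at rest -/

/-- Interpolation: a function that is small, with a Lipschitz derivative, has a small derivative. -/
lemma exists_small_deriv {K δ : ℝ} (hK : 0 < K) (hδ : 0 < δ) : ∃ ε : ℝ, 0 < ε ∧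
    ∀ (f f' : ℝ → ℝ) (a : ℝ),
      (∀ t ∈ Set.Icc a (a + 1), HasDerivWithinAt f (f' t) (Set.Icc a (a + 1)) t) →
      (∀ s ∈ Set.Icc a (a + 1), ∀ t ∈ Set.Icc a (a + 1), |f' s - f' t| ≤ K * |s - t|) →
      (∀ t ∈ Set.Icc a (a + 1), |f t| ≤ ε) → ∀ t ∈ Set.Icc a (a + 1), |f' t| ≤ δ := by
  set h : ℝ := min (1 / 2) (δ / (2 * K)) with hh
  have hh0 : 0 < h := lt_min (by norm_num) (by positivity)
  have hh1 : h ≤ 1 / 2 := min_le_left _ _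
  have hhK : K * h ≤ δ / 2 := by
    have : h ≤ δ / (2 * K) := min_le_right _ _
    rw [le_div_iff₀ (by positivity)] at this
    linarith
  refine ⟨δ * h / 4, by positivity, fun f f' a hf hlip hsmall t ht => ?_⟩
  -- an interval of length `h` with `t` as one end
  obtain ⟨b, hb, htb, hbt⟩ : ∃ b, Set.Icc b (b + h) ⊆ Set.Icc a (a + 1) ∧ b ≤ t ∧ t ≤ b + h := by
    by_cases hc : t ≤ a + 1 / 2
    · exact ⟨t, Set.Icc_subset_Icc ht.1 (by linarith), le_rfl, by linarith⟩
    · push Not at hc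
      exact ⟨t - h, Set.Icc_subset_Icc (by linarith) (by linarith [ht.2]), by linarith, by linarith⟩
  obtain ⟨ξ, hξ, hξd⟩ := exists_hasDerivAt_eq_slope f f' (by linarith : b < b + h)
    (fun s hs => (hf s (hb hs)).continuousWithinAt.mono hb) (fun s hs =>
      ((hf s (hb (Set.Ioo_subset_Icc_self hs))).mono hb).hasDerivAt (Icc_mem_nhds hs.1 hs.2))
  have h1 : |f' ξ| ≤ δ / 2 := by
    rw [hξd, abs_div, add_sub_cancel_left, abs_of_pos hh0, div_le_iff₀ hh0]
    have h2 := hsmall (b + h) (hb ⟨by linarith, le_rfl⟩)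
    have h3 := hsmall b (hb ⟨le_rfl, by linarith⟩)
    have h4 := abs_sub (f (b + h)) (f b)
    linarith
  have h2 := hlip t ht ξ (hb (Set.Ioo_subset_Icc_self hξ))
  have h3 : |t - ξ| ≤ h := by rw [abs_le]; constructor <;> linarith [hξ.1, hξ.2]
  have h4 := mul_le_mul_of_nonneg_left h3 hK.le
  have h5 : |f' t| ≤ |f' ξ| + |f' t - f' ξ| := by
    simpa using abs_add_le (f' ξ) (f' t - f' ξ)
  linarith

lemma lipschitz_of_hasDerivWithinAt {f f' : ℝ → ℝ} {T K : ℝ}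
    (hf : ∀ t ∈ Set.Icc 0 T, HasDerivWithinAt f (f' t) (Set.Icc 0 T) t)
    (hK : ∀ t ∈ Set.Icc 0 T, |f' t| ≤ K) {s t : ℝ} (hs : s ∈ Set.Icc 0 T) (ht : t ∈ Set.Icc 0 T) :
    |f s - f t| ≤ K * |s - t| :=
  Convex.norm_image_sub_le_of_norm_hasDerivWithin_le (s := Set.Icc 0 T) hf hK (convex_Icc _ _) ht hs

lemma IsNondegenerate.exists_lower_bound {V : Torus → ℝ} (hV : IsSmooth V)
    (hnd : IsNondegenerate V) : ∃ η : ℝ, 0 < η ∧ ∀ s, |deriv (lift V) s| ≤ η →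
      η ≤ |deriv (deriv (lift V)) s| := by
  have hc1 : Continuous (deriv (lift V)) := (hV.iterate_deriv 1).continuous
  have hc2 : Continuous (deriv (deriv (lift V))) := (hV.iterate_deriv 2).continuous
  have hp1 := periodic_deriv (periodic_lift V)
  have hp2 := periodic_deriv hp1
  obtain ⟨x, -, hx⟩ := (isCompact_Icc (a := (0 : ℝ)) (b := 2 * Real.pi)).exists_isMinOn
    ⟨0, le_rfl, by positivity⟩ ((hc1.abs.add hc2.abs).continuousOn)
  set m := |deriv (lift V) x| + |deriv (deriv (lift V)) x| with hm
  have hx1 := abs_nonneg (deriv (lift V) x)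
  have hx2 := abs_nonneg (deriv (deriv (lift V)) x)
  have hm0 : 0 < m := by
    refine lt_of_le_of_ne (by positivity) fun h0 => hnd ⟨x, ?_, ?_⟩
    · exact abs_eq_zero.1 (by linarith)
    · exact abs_eq_zero.1 (by linarith)
  refine ⟨m / 2, by positivity, fun s hs => ?_⟩
  have hp : Function.Periodic (fun s => |deriv (lift V) s| + |deriv (deriv (lift V)) s|)
      (2 * Real.pi) := fun s => by simp only [hp1 s, hp2 s]
  obtain ⟨y, hy, hys⟩ := hp.exists_mem_Ico₀ Real.two_pi_pos s
  have h1 : m ≤ |deriv (lift V) y| + |deriv (deriv (lift V)) y| := hx ⟨hy.1, hy.2.le⟩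
  linarith

section SlowChain

variable {V : Fin (n - 1) → ℝ → ℝ} {κ ι : Fin n} {γ T R M : ℝ} {I θ : ℝ → Fin n → ℝ}

lemma abs_force_le (hM : ∀ j s, |deriv (V j) s| ≤ M) (φ : Fin n → ℝ) (i : Fin n) :
    |force V φ i| ≤ ∑ _j : Fin (n - 1), 2 * M := by
  refine (Finset.abs_sum_le_sum_abs _ _).trans (Finset.sum_le_sum fun j _ => ?_)
  have h := hM j (φ (hi j) - φ (lo j))
  have h0 := abs_nonneg (deriv (V j) (φ (hi j) - φ (lo j)))
  split_ifs <;> simp only [sub_self, sub_zero, zero_sub, abs_neg, abs_zero] <;> linarith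

lemma IsTraj.lipschitz_act (h : IsTraj V ι γ T I θ) (hγ : 0 < γ)
    (hM : ∀ j s, |deriv (V j) s| ≤ M) (hR : ∀ t ∈ Set.Icc 0 T, ∀ i, i ≠ κ → |I t i| ≤ R)
    {s t : ℝ} (hs : s ∈ Set.Icc 0 T) (ht : t ∈ Set.Icc 0 T) (i : Fin n) (hi' : i ≠ κ) :
    |I s i - I t i| ≤ ((∑ _j : Fin (n - 1), 2 * M) + γ * R) * |s - t| := by
  refine lipschitz_of_hasDerivWithinAt (fun t ht => h.act t ht i) (fun r hr => ?_) hs ht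
  refine (abs_sub _ _).trans (add_le_add (abs_force_le hM _ _) ?_)
  have h1 := hR r hr i hi'
  have h2 := abs_nonneg (I r i)
  split_ifs
  · rw [abs_mul, abs_of_pos hγ]
    exact mul_le_mul_of_nonneg_left h1 hγ.le
  · rw [abs_zero]
    exact mul_nonneg hγ.le (h2.trans h1)

lemma IsTraj.hasDerivWithinAt_phase (h : IsTraj V ι γ T I θ) (j : Fin (n - 1)) {t : ℝ}
    (ht : t ∈ Set.Icc 0 T) : HasDerivWithinAt (fun s => θ s (hi j) - θ s (lo j))
      (I t (hi j) - I t (lo j)) (Set.Icc 0 T) t :=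
  (h.ang t ht (hi j)).fun_sub (h.ang t ht (lo j))

lemma IsTraj.lipschitz_phase (h : IsTraj V ι γ T I θ)
    (hR : ∀ t ∈ Set.Icc 0 T, ∀ i, i ≠ κ → |I t i| ≤ R)
    {s t : ℝ} (hs : s ∈ Set.Icc 0 T) (ht : t ∈ Set.Icc 0 T) (j : Fin (n - 1)) (h1 : hi j ≠ κ)
    (h2 : lo j ≠ κ) :
    |(θ s (hi j) - θ s (lo j)) - (θ t (hi j) - θ t (lo j))| ≤ 2 * R * |s - t| := by
  refine lipschitz_of_hasDerivWithinAt (fun t ht => h.hasDerivWithinAt_phase j ht)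
    (fun r hr => ?_) hs ht
  have := abs_sub (I r (hi j)) (I r (lo j))
  linarith [hR r hr _ h1, hR r hr _ h2]

/-- The force on a rotator is Lipschitz in time, provided that neither it nor its right neighbour is
the fast rotator and the fast rotator is further to the right. -/
lemma IsTraj.lipschitz_force (h : IsTraj V ι γ T I θ)
    (hR : ∀ t ∈ Set.Icc 0 T, ∀ i, i ≠ κ → |I t i| ≤ R) (hM0 : 0 ≤ M) (hR0 : 0 ≤ R)
    (hM : ∀ j s t, |deriv (V j) s - deriv (V j) t| ≤ M * |s - t|)
    {s t : ℝ} (hs : s ∈ Set.Icc 0 T) (ht : t ∈ Set.Icc 0 T) (i : Fin n) (hi' : (i : ℕ) + 1 < κ) :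
    |force V (θ s) i - force V (θ t) i| ≤ (∑ _j : Fin (n - 1), 2 * (M * (2 * R))) * |s - t| := by
  rw [force, force, ← Finset.sum_sub_distrib, Finset.sum_mul]
  refine (Finset.abs_sum_le_sum_abs _ _).trans (Finset.sum_le_sum fun j _ => ?_)
  have h0 : 0 ≤ 2 * (M * (2 * R)) * |s - t| := by positivity
  by_cases hj : lo j = i ∨ hi j = i
  · have h1 : hi j ≠ κ := by
      rintro rfl
      rcases hj with rfl | rfl <;> simp [hi, lo] at hi'
    have h2 : lo j ≠ κ := by
      rintro rfl
      rcases hj with rfl | rfl <;> simp [hi, lo] at hi'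
      omega
    have h3 := (hM j (θ s (hi j) - θ s (lo j)) (θ t (hi j) - θ t (lo j))).trans
      (mul_le_mul_of_nonneg_left (h.lipschitz_phase hR hs ht j h1 h2) hM0)
    have h4 := h3
    rw [abs_sub_comm] at h4
    split_ifs <;> simp only [sub_self, sub_zero, zero_sub, abs_zero, neg_sub_neg] <;>
      first | exact h0 | linarith
  · rw [not_or] at hj
    rw [if_neg hj.1, if_neg hj.2, if_neg hj.1, if_neg hj.2]
    simpa using h0

lemma force_eq_sub (V : Fin (n - 1) → ℝ → ℝ) (φ : Fin n → ℝ) (j : Fin (n - 1)) :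
    force V φ (lo j) = deriv (V j) (φ (hi j) - φ (lo j)) -
      ∑ l, if hi l = lo j then deriv (V l) (φ (hi l) - φ (lo l)) else 0 := by
  rw [force, Finset.sum_sub_distrib]
  congr 1
  rw [Finset.sum_eq_single j]
  · rw [if_pos rfl]
  · intro l _ hl
    rw [if_neg]
    intro h
    exact hl (Fin.ext (by simpa [lo] using congrArg Fin.val h))
  · simp

/-- If the damped action is small on a unit time interval, then so are all actions to the left of
the fast rotator and the forces between them. The smallness propagates along the chain: by
interpolation from an action to the force that drives it, and from that force to the difference of
the actions at its two ends, since the second derivative of the potential does not vanish where the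
force is small. -/
theorem exists_small_chain {U : Fin (n - 1) → Torus → ℝ} (hU : ∀ j, IsSmooth (U j))
    (hnd : ∀ j, IsNondegenerate (U j)) (hι : (ι : ℕ) = 0) (hγ : 0 < γ) (hR0 : 0 < R)
    (m : ℕ) (hm : m < κ) (δ : ℝ) (hδ : 0 < δ) : ∃ ε : ℝ, 0 < ε ∧ ∀ (T : ℝ) (I θ : ℝ → Fin n → ℝ),
      IsTraj (fun j => lift (U j)) ι γ T I θ →
      (∀ t ∈ Set.Icc 0 T, ∀ i, i ≠ κ → |I t i| ≤ R) → ∀ a, 0 ≤ a → a + 1 ≤ T →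
      (∀ t ∈ Set.Icc a (a + 1), |I t ι| ≤ ε) → ∀ t ∈ Set.Icc a (a + 1),
        |I t ⟨m, hm.trans κ.2⟩| ≤ δ ∧ ∀ j : Fin (n - 1), (j : ℕ) < m →
          |deriv (lift (U j)) (θ t (hi j) - θ t (lo j))| ≤ δ := by
  induction m generalizing δ with
  | zero =>
    refine ⟨δ, hδ, fun T I θ _ _ a _ _ hsmall t ht => ⟨?_, fun j hj => absurd hj (Nat.not_lt_zero _)⟩⟩
    have : (⟨0, hm.trans κ.2⟩ : Fin n) = ι := Fin.ext hι.symm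
    rw [this]
    exact hsmall t ht
  | succ m ih =>
    have hmn : m < n - 1 := by omega
    set j₀ : Fin (n - 1) := ⟨m, hmn⟩ with hj₀
    have hloκ : lo j₀ ≠ κ := fun h => by have := congrArg Fin.val h; simp [lo, hj₀] at this; omega
    have hhiκ : hi j₀ ≠ κ := fun h => by have := congrArg Fin.val h; simp [hi, hj₀] at this; omega
    obtain ⟨η, hη, hηV⟩ := (hnd j₀).exists_lower_bound (hU j₀)
    obtain ⟨M₁, hM₁, hb₁⟩ := exists_bound_family hU 1
    obtain ⟨M₂, hM₂, hb₂⟩ := exists_bound_family hU 2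
    obtain ⟨N₁, hN₁, hl₁⟩ := exists_lipschitz_family hU 1
    obtain ⟨N₂, hN₂, hl₂⟩ := exists_lipschitz_family hU 2
    simp only [Function.iterate_succ, Function.iterate_zero, Function.comp_def, id] at hb₁ hb₂ hl₁ hl₂
    set K₁ : ℝ := (∑ _j : Fin (n - 1), 2 * M₁) + γ * R with hK₁
    have hK₁0 : 0 < K₁ := by
      have : 0 ≤ ∑ _j : Fin (n - 1), 2 * M₁ := Finset.sum_nonneg fun _ _ => by positivity
      positivity
    set K₂ : ℝ := (∑ _j : Fin (n - 1), 2 * (N₁ * (2 * R))) + γ * K₁ with hK₂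
    have hK₂0 : 0 < K₂ := by
      have : 0 ≤ ∑ _j : Fin (n - 1), 2 * (N₁ * (2 * R)) := Finset.sum_nonneg fun _ _ => by positivity
      positivity
    set K₃ : ℝ := N₂ * (2 * R) * (2 * R) + M₂ * (2 * K₁) with hK₃
    obtain ⟨ε₂, hε₂, hint₂⟩ := exists_small_deriv (K := K₃) (δ := η * (δ / 2)) (by positivity)
      (by positivity)
    set τ : ℝ := min (min δ η) ε₂ with hτ
    have hτ0 : 0 < τ := lt_min (lt_min hδ hη) hε₂
    set δ₁ : ℝ := min (δ / 2) (τ / (1 + n + γ)) with hδ₁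
    have hn0 : (0 : ℝ) ≤ n := Nat.cast_nonneg n
    have hδ₁0 : 0 < δ₁ := lt_min (by positivity) (by positivity)
    have hδ₁τ : (1 + n + γ) * δ₁ ≤ τ := by
      have : δ₁ ≤ τ / (1 + n + γ) := min_le_right _ _
      rwa [le_div_iff₀ (by positivity), mul_comm] at this
    have hδ₁δ : δ₁ ≤ δ / 2 := min_le_left _ _
    obtain ⟨ε₁, hε₁, hint₁⟩ := exists_small_deriv (K := K₂) (δ := δ₁) hK₂0 hδ₁0
    obtain ⟨ε, hε, hchain⟩ := ih (by omega) (min δ₁ ε₁) (lt_min hδ₁0 hε₁)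
    refine ⟨ε, hε, fun T I θ h hR a ha haT hsmall => ?_⟩
    have hsub : Set.Icc a (a + 1) ⊆ Set.Icc 0 T := Set.Icc_subset_Icc ha haT
    have hch := hchain T I θ h hR a ha haT hsmall
    have hlo : (⟨m, (Nat.lt_of_succ_lt hm).trans κ.2⟩ : Fin n) = lo j₀ := rfl
    rw [hlo] at hch
    have hact : ∀ t ∈ Set.Icc a (a + 1), |I t (lo j₀)| ≤ δ₁ := fun t ht =>
      (hch t ht).1.trans (min_le_left _ _)
    -- the derivative of the action at the left end of the bond is small
    have hd₁ := hint₁ (fun t => I t (lo j₀)) (fun t => force (fun j => lift (U j)) (θ t) (lo j₀) -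
        if lo j₀ = ι then γ * I t (lo j₀) else 0) a
      (fun t ht => (h.act t (hsub ht) (lo j₀)).mono hsub)
      (fun s hs t ht => by
        have h1 := h.lipschitz_force hR hN₁.le hR0.le hl₁ (hsub hs) (hsub ht) (lo j₀) hm
        have h2 := h.lipschitz_act hγ hb₁ hR (hsub hs) (hsub ht) (lo j₀) hloκ
        have h3 : |(if lo j₀ = ι then γ * I s (lo j₀) else 0) -
            (if lo j₀ = ι then γ * I t (lo j₀) else 0)| ≤ γ * (K₁ * |s - t|) := by
          split_ifs
          · rw [← mul_sub, abs_mul, abs_of_pos hγ]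
            exact mul_le_mul_of_nonneg_left h2 hγ.le
          · rw [sub_zero, abs_zero]; positivity
        rw [sub_sub_sub_comm, hK₂, add_mul, mul_assoc γ]
        exact (abs_sub _ _).trans (add_le_add h1 h3))
      (fun t ht => (hch t ht).1.trans (min_le_right _ _))
    -- hence so is the force of the bond
    have hforce : ∀ t ∈ Set.Icc a (a + 1),
        |deriv (lift (U j₀)) (θ t (hi j₀) - θ t (lo j₀))| ≤ τ := by
      intro t ht
      have h1 := hd₁ t ht
      rw [force_eq_sub] at h1
      have h2 : |∑ l, if hi l = lo j₀ then
          deriv (lift (U l)) (θ t (hi l) - θ t (lo l)) else 0| ≤ n * δ₁ := by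
        refine (Finset.abs_sum_le_sum_abs _ _).trans ?_
        have h3 : ∀ l ∈ (Finset.univ : Finset (Fin (n - 1))), |if hi l = lo j₀ then
            deriv (lift (U l)) (θ t (hi l) - θ t (lo l)) else 0| ≤ δ₁ := by
          intro l _
          split_ifs with hl
          · refine ((hch t ht).2 l ?_).trans (min_le_left _ _)
            have := congrArg Fin.val hl
            simp [hi, lo, hj₀] at this
            omega
          · simpa using hδ₁0.le
        refine (Finset.sum_le_card_nsmul _ _ _ h3).trans ?_
        rw [Finset.card_univ, Fintype.card_fin, nsmul_eq_mul]
        refine mul_le_mul_of_nonneg_right ?_ hδ₁0.le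
        exact_mod_cast Nat.sub_le n 1
      have h4 : |if lo j₀ = ι then γ * I t (lo j₀) else 0| ≤ γ * δ₁ := by
        split_ifs
        · rw [abs_mul, abs_of_pos hγ]
          exact mul_le_mul_of_nonneg_left (hact t ht) hγ.le
        · simpa using (by positivity : 0 ≤ γ * δ₁)
      refine le_trans ?_ hδ₁τ
      rw [abs_le] at h1 h2 h4 ⊢
      constructor <;> linarith [h1.1, h1.2, h2.1, h2.2, h4.1, h4.2]
    -- and the derivative of the force
    have hd₂ := hint₂ (fun t => deriv (lift (U j₀)) (θ t (hi j₀) - θ t (lo j₀)))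
      (fun t => deriv (deriv (lift (U j₀))) (θ t (hi j₀) - θ t (lo j₀)) *
        (I t (hi j₀) - I t (lo j₀))) a
      (fun t ht => by
        have h1 := (((hU j₀).iterate_deriv 1).differentiable one_ne_zero
          (θ t (hi j₀) - θ t (lo j₀))).hasDerivAt
        exact h1.comp_hasDerivWithinAt t ((h.hasDerivWithinAt_phase j₀ (hsub ht)).mono hsub))
      (fun s hs t ht => by
        have h1 := (hl₂ j₀ (θ s (hi j₀) - θ s (lo j₀)) (θ t (hi j₀) - θ t (lo j₀))).trans
          (mul_le_mul_of_nonneg_left (h.lipschitz_phase hR (hsub hs) (hsub ht) j₀ hhiκ hloκ) hN₂.le)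
        have h2 := hb₂ j₀ (θ t (hi j₀) - θ t (lo j₀))
        have h3 := h.lipschitz_act hγ hb₁ hR (hsub hs) (hsub ht) (lo j₀) hloκ
        have h4 := h.lipschitz_act hγ hb₁ hR (hsub hs) (hsub ht) (hi j₀) hhiκ
        set A := deriv (deriv (lift (U j₀))) (θ s (hi j₀) - θ s (lo j₀))
        set B := deriv (deriv (lift (U j₀))) (θ t (hi j₀) - θ t (lo j₀))
        have h5 : |I s (hi j₀) - I s (lo j₀)| ≤ 2 * R := by
          have := abs_sub (I s (hi j₀)) (I s (lo j₀))
          linarith [hR s (hsub hs) _ hhiκ, hR s (hsub hs) _ hloκ]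
        have h6 : |(I s (hi j₀) - I s (lo j₀)) - (I t (hi j₀) - I t (lo j₀))| ≤
            2 * K₁ * |s - t| := by
          rw [sub_sub_sub_comm]
          have := abs_sub (I s (hi j₀) - I t (hi j₀)) (I s (lo j₀) - I t (lo j₀))
          linarith
        have h7 : A * (I s (hi j₀) - I s (lo j₀)) - B * (I t (hi j₀) - I t (lo j₀)) =
            (A - B) * (I s (hi j₀) - I s (lo j₀)) +
              B * ((I s (hi j₀) - I s (lo j₀)) - (I t (hi j₀) - I t (lo j₀))) := by ring
        have h8 := mul_le_mul h1 h5 (abs_nonneg _) (by positivity)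
        have h9 := mul_le_mul h2 h6 (abs_nonneg _) hM₂.le
        rw [h7]
        refine (abs_add_le _ _).trans ?_
        rw [abs_mul, abs_mul, hK₃]
        linarith)
      (fun t ht => (hforce t ht).trans (min_le_right _ _))
    intro t ht
    have hf := hforce t ht
    refine ⟨?_, fun j hj => ?_⟩
    · have h1 := hηV _ (hf.trans ((min_le_left _ _).trans (min_le_right _ _)))
      have h2 := hd₂ t ht
      rw [abs_mul] at h2
      have h3 : |I t (hi j₀) - I t (lo j₀)| ≤ δ / 2 := by
        by_contra hc
        push Not at hc
        have h4 := mul_lt_mul_of_pos_left hc hη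
        have h5 := mul_le_mul_of_nonneg_right h1 (abs_nonneg (I t (hi j₀) - I t (lo j₀)))
        linarith
      have h4 : |I t (hi j₀)| ≤ |I t (lo j₀)| + |I t (hi j₀) - I t (lo j₀)| := by
        simpa using abs_add_le (I t (lo j₀)) (I t (hi j₀) - I t (lo j₀))
      have h5 := hact t ht
      show |I t (hi j₀)| ≤ δ
      linarith
    · rcases Nat.lt_succ_iff_lt_or_eq.1 hj with hj | hj
      · refine ((hch t ht).2 j hj).trans ((min_le_left _ _).trans ?_)
        linarith
      · have : j = j₀ := Fin.ext hj
        rw [this]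
        exact hf.trans ((min_le_left _ _).trans (min_le_left _ _))

/-- If the damped action is small on a unit time interval, then the second derivatives of the
potentials to the left of the fast rotator are bounded below there. -/
theorem exists_nondegenerate_window {U : Fin (n - 1) → Torus → ℝ} (hU : ∀ j, IsSmooth (U j))
    (hnd : ∀ j, IsNondegenerate (U j)) (hι : (ι : ℕ) = 0) (hγ : 0 < γ) (hR0 : 0 < R)
    (m : ℕ) (hm : m < κ) : ∃ ε η : ℝ, 0 < ε ∧ 0 < η ∧ ∀ (T : ℝ) (I θ : ℝ → Fin n → ℝ),
      IsTraj (fun j => lift (U j)) ι γ T I θ →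
      (∀ t ∈ Set.Icc 0 T, ∀ i, i ≠ κ → |I t i| ≤ R) → ∀ a, 0 ≤ a → a + 1 ≤ T →
      (∀ t ∈ Set.Icc a (a + 1), |I t ι| ≤ ε) → ∀ t ∈ Set.Icc a (a + 1),
        ∀ j : Fin (n - 1), (j : ℕ) < m →
          η ≤ |deriv (deriv (lift (U j))) (θ t (hi j) - θ t (lo j))| := by
  choose η hη hηV using fun j => (hnd j).exists_lower_bound (hU j)
  -- a common lower bound of the `η j` that makes sense also without bonds
  set η₀ : ℝ := (∑ j, (η j)⁻¹ + 1)⁻¹ with hη₀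
  have hsum : 0 ≤ ∑ j, (η j)⁻¹ := Finset.sum_nonneg fun j _ => (inv_pos.2 (hη j)).le
  have hη₀0 : 0 < η₀ := by positivity
  have hle : ∀ j, η₀ ≤ η j := by
    intro j
    have := Finset.single_le_sum (f := fun j => (η j)⁻¹) (fun j _ => (inv_pos.2 (hη j)).le)
      (Finset.mem_univ j)
    exact inv_le_of_inv_le₀ (hη j) (by linarith)
  obtain ⟨ε, hε, h⟩ := exists_small_chain hU hnd hι hγ hR0 m hm η₀ hη₀0
  refine ⟨ε, η₀, hε, hη₀0, fun T I θ htraj hR a ha haT hsmall t ht j hj => ?_⟩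
  exact (hle j).trans (hηV j _ (((h T I θ htraj hR a ha haT hsmall t ht).2 j hj).trans (hle j)))

end SlowChain

/-! ### The fast force does work -/

/-- The integral of a nonnegative periodic function that is not identically zero grows linearly. -/
lemma exists_linear_growth {G : ℝ → ℝ} (hG : Continuous G) {p : ℝ} (hp : 0 < p)
    (hper : Function.Periodic G p) (h0 : ∀ s, 0 ≤ G s) {s₀ : ℝ} (hs₀ : 0 < G s₀) :
    ∃ (Φ : ℝ → ℝ) (μ B : ℝ), 0 < μ ∧ 0 < B ∧ (∀ s, HasDerivAt Φ (G s) s) ∧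
      ∀ s t, μ * (t - s) - B ≤ Φ t - Φ s := by
  set Φ : ℝ → ℝ := fun s => ∫ x in (0 : ℝ)..s, G x with hΦ
  have hder : ∀ s, HasDerivAt Φ (G s) s := fun s =>
    intervalIntegral.integral_hasDerivAt_right (hG.intervalIntegrable _ _)
      (hG.stronglyMeasurableAtFilter _ _) hG.continuousAt
  have hP : 0 < Φ p := by
    obtain ⟨y, hy, hys⟩ := hper.exists_mem_Ico₀ hp s₀
    exact intervalIntegral.integral_pos hp hG.continuousOn (fun x _ => h0 x)
      ⟨y, ⟨hy.1, hy.2.le⟩, by rwa [← hys]⟩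
  -- the primitive is a linear function plus a periodic one
  have hW : Function.Periodic (fun s => Φ s - Φ p / p * s) p := by
    intro s
    have h1 : Φ (s + p) = Φ s + Φ p := by
      have h2 := intervalIntegral.integral_add_adjacent_intervals
        (hG.intervalIntegrable (μ := MeasureTheory.volume) 0 s) (hG.intervalIntegrable s (s + p))
      have h3 := hper.intervalIntegral_add_eq s 0
      rw [zero_add] at h3
      simp only [hΦ]
      rw [← h2, h3]
    simp only [h1]
    field_simp
    ring
  have hΦc : Continuous Φ := continuous_iff_continuousAt.2 fun s => (hder s).continuousAt
  obtain ⟨B, hB, hBW⟩ := exists_bound_of_periodic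
    (f := fun s => Φ s - Φ p / p * s) (by fun_prop) hp hW
  refine ⟨Φ, Φ p / p, 2 * B, by positivity, by positivity, hder, fun s t => ?_⟩
  have h1 := abs_le.1 (hBW s)
  have h2 := abs_le.1 (hBW t)
  linarith [h1.2, h2.1]

section Dissipation

variable {U : Fin (n - 1) → Torus → ℝ} {u u' u'' : Fin (n - 1) → Obs n} {κ ι : Fin n}
  {γ R : ℝ}

/-- The phase across the bond to the left of the fast rotator turns so fast that the square of the
force of this bond has an average that is bounded below. -/
theorem exists_fast_force_lower_bound (hU : ∀ j, IsSmooth (U j)) (hnd : ∀ j, IsNondegenerate (U j))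
    (j : Fin (n - 1)) (hj : hi j = κ) (hR : 0 < R) : ∃ c L₁ : ℝ, 0 < c ∧
      ∀ (L T : ℝ) (I θ : ℝ → Fin n → ℝ), L₁ ≤ L → IsTraj (fun j => lift (U j)) ι γ T I θ →
      (∀ t ∈ Set.Icc 0 T, ∀ i, |shiftAct κ L (I t) i| ≤ R) → ∀ a, 0 ≤ a → a + 1 / 2 ≤ T →
        c ≤ ∫ t in a..(a + 1 / 2), deriv (lift (U j)) (θ t (hi j) - θ t (lo j)) ^ 2 := by
  have hc1 : Continuous (deriv (lift (U j))) := ((hU j).iterate_deriv 1).continuous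
  have hp1 := periodic_deriv (periodic_lift (U j))
  -- a potential without force would be degenerate everywhere
  obtain ⟨s₀, hs₀⟩ : ∃ s, deriv (lift (U j)) s ≠ 0 := by
    by_contra! hc
    have h0 : deriv (lift (U j)) = fun _ => 0 := funext hc
    exact hnd j ⟨0, hc 0, by rw [h0]; simp⟩
  obtain ⟨Φ, μ, B, hμ, hB, hΦ, hgrow⟩ := exists_linear_growth
    (G := fun s => deriv (lift (U j)) s ^ 2) (by fun_prop) Real.two_pi_pos
    (fun s => by simp only [hp1 s]) (fun s => sq_nonneg _) (s₀ := s₀) (by positivity)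
  refine ⟨μ / 16, max (4 * R) (8 * B / μ), by positivity, fun L T I θ hL h hI a ha haT => ?_⟩
  have hL1 : 4 * R ≤ L := (le_max_left _ _).trans hL
  have hL2 : 8 * B ≤ L * μ := by
    have := (le_max_right _ _).trans hL
    rwa [div_le_iff₀ hμ] at this
  have hL0 : 0 < L := by linarith
  have hab : a ≤ a + 1 / 2 := by linarith
  have hsub : Set.Icc a (a + 1 / 2) ⊆ Set.Icc 0 T := Set.Icc_subset_Icc ha haT
  have hspeed : ∀ t ∈ Set.Icc a (a + 1 / 2),
      L / 2 ≤ I t (hi j) - I t (lo j) ∧ I t (hi j) - I t (lo j) ≤ 2 * L := by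
    intro t ht
    have h1 := abs_le.1 (hI t (hsub ht) (hi j))
    have h2 := abs_le.1 (hI t (hsub ht) (lo j))
    have h3 : lo j ≠ κ := hj ▸ lo_ne_hi j
    simp only [shiftAct, if_pos hj, if_neg h3] at h1 h2
    constructor <;> linarith [h1.1, h1.2, h2.1, h2.2]
  set ψ : ℝ → ℝ := fun t => θ t (hi j) - θ t (lo j) with hψ
  have hψd : ∀ t ∈ Set.Icc a (a + 1 / 2),
      HasDerivWithinAt ψ (I t (hi j) - I t (lo j)) (Set.Icc a (a + 1 / 2)) t := fun t ht =>
    (h.hasDerivWithinAt_phase j (hsub ht)).mono hsub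
  have hψc : ContinuousOn ψ (Set.Icc a (a + 1 / 2)) := fun t ht => (hψd t ht).continuousWithinAt
  have hIc : ContinuousOn (fun t => I t (hi j) - I t (lo j)) (Set.Icc a (a + 1 / 2)) :=
    ((h.continuousOn_act _).sub (h.continuousOn_act _)).mono hsub
  have hGc : ContinuousOn (fun t => deriv (lift (U j)) (ψ t) ^ 2) (Set.Icc a (a + 1 / 2)) :=
    (hc1.comp_continuousOn hψc).pow 2
  have hturn : L / 4 ≤ ψ (a + 1 / 2) - ψ a := by
    have h1 := intervalIntegral.integral_eq_sub_of_hasDerivAt_of_le hab hψc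
      (fun t ht => (hψd t (Set.Ioo_subset_Icc_self ht)).hasDerivAt (Icc_mem_nhds ht.1 ht.2))
      (hIc.intervalIntegrable_of_Icc hab)
    have h2 := intervalIntegral.integral_mono_on hab
      (intervalIntegrable_const (μ := MeasureTheory.volume) (c := L / 2))
      (hIc.intervalIntegrable_of_Icc hab) fun t ht => (hspeed t ht).1
    rw [h1, intervalIntegral.integral_const, smul_eq_mul] at h2
    linarith
  have hwork : Φ (ψ (a + 1 / 2)) - Φ (ψ a) ≤
      2 * L * ∫ t in a..(a + 1 / 2), deriv (lift (U j)) (ψ t) ^ 2 := by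
    have hΦc : Continuous Φ := continuous_iff_continuousAt.2 fun s => (hΦ s).continuousAt
    have hint : IntervalIntegrable
        (fun t => deriv (lift (U j)) (ψ t) ^ 2 * (I t (hi j) - I t (lo j)))
        MeasureTheory.volume a (a + 1 / 2) := (hGc.mul hIc).intervalIntegrable_of_Icc hab
    have hftc : ∫ t in a..(a + 1 / 2), deriv (lift (U j)) (ψ t) ^ 2 * (I t (hi j) - I t (lo j)) =
        Φ (ψ (a + 1 / 2)) - Φ (ψ a) :=
      intervalIntegral.integral_eq_sub_of_hasDerivAt_of_le hab (hΦc.comp_continuousOn hψc)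
        (fun t ht => (hΦ (ψ t)).comp t
          ((hψd t (Set.Ioo_subset_Icc_self ht)).hasDerivAt (Icc_mem_nhds ht.1 ht.2))) hint
    rw [← hftc, ← intervalIntegral.integral_const_mul]
    refine intervalIntegral.integral_mono_on hab hint
      ((hGc.intervalIntegrable_of_Icc hab).const_mul _) fun t ht => ?_
    rw [mul_comm]
    exact mul_le_mul_of_nonneg_right (hspeed t ht).2 (sq_nonneg _)
  have h1 := hgrow (ψ a) (ψ (a + 1 / 2))
  have h2 := mul_le_mul_of_nonneg_left hturn hμ.le
  have h3 : L * (μ / 16) ≤ L * ∫ t in a..(a + 1 / 2), deriv (lift (U j)) (ψ t) ^ 2 := by linarith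
  exact le_of_mul_le_mul_left h3 hL0

/-! ### The rate of dissipation -/

/-- A Lipschitz function that is large somewhere on a unit interval has a large integral. -/
lemma exists_lower_bound_integral_abs {K ε : ℝ} (hK : 0 < K) (hε : 0 < ε) : ∃ c : ℝ, 0 < c ∧
    ∀ (f : ℝ → ℝ) (a t₀ : ℝ), ContinuousOn f (Set.Icc a (a + 1)) → t₀ ∈ Set.Icc a (a + 1) →
      (∀ s ∈ Set.Icc a (a + 1), ∀ t ∈ Set.Icc a (a + 1), |f s - f t| ≤ K * |s - t|) →
      ε ≤ |f t₀| → c ≤ ∫ t in a..(a + 1), |f t| := by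
  set h : ℝ := min (1 / 2) (ε / (2 * K)) with hh
  have hh0 : 0 < h := lt_min (by norm_num) (by positivity)
  have hh1 : h ≤ 1 / 2 := min_le_left _ _
  have hhK : K * h ≤ ε / 2 := by
    have : h ≤ ε / (2 * K) := min_le_right _ _
    rw [le_div_iff₀ (by positivity)] at this
    linarith
  refine ⟨h * (ε / 2), by positivity, fun f a t hf ht hlip hlarge => ?_⟩
  obtain ⟨b, hb, htb, hbt⟩ : ∃ b, Set.Icc b (b + h) ⊆ Set.Icc a (a + 1) ∧ b ≤ t ∧ t ≤ b + h := by
    by_cases hc : t ≤ a + 1 / 2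
    · exact ⟨t, Set.Icc_subset_Icc ht.1 (by linarith), le_rfl, by linarith⟩
    · push Not at hc
      exact ⟨t - h, Set.Icc_subset_Icc (by linarith) (by linarith [ht.2]), by linarith, by linarith⟩
  have hbh : b ≤ b + h := by linarith
  have hab : a ≤ a + 1 := by linarith
  have h1 : ∫ t in b..(b + h), |f t| ≤ ∫ t in a..(a + 1), |f t| :=
    intervalIntegral.integral_mono_interval (hb ⟨le_rfl, hbh⟩).1 hbh (hb ⟨hbh, le_rfl⟩).2
      (Filter.Eventually.of_forall fun t => abs_nonneg (f t)) (hf.abs.intervalIntegrable_of_Icc hab)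
  have h2 := intervalIntegral.integral_mono_on hbh
    (intervalIntegrable_const (μ := MeasureTheory.volume) (c := ε / 2))
    ((hf.abs.mono hb).intervalIntegrable_of_Icc hbh) fun s hs => by
      have h3 := hlip t ht s (hb hs)
      have h4 : |t - s| ≤ h := by rw [abs_le]; constructor <;> linarith [hs.1, hs.2]
      have h5 := mul_le_mul_of_nonneg_left h4 hK.le
      have h6 : |f t| ≤ |f s| + |f t - f s| := by simpa using abs_add_le (f s) (f t - f s)
      linarith
  rw [intervalIntegral.integral_const, smul_eq_mul, add_sub_cancel_left] at h2
  exact h2.trans h1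

/-- On each unit time interval the integral of the damped action is at least of the order
`L ^ -(2 m + 1)`, where `m + 1` is the position of the fast rotator. -/
theorem exists_lower_bound_damped_action (hU : ∀ j, IsSmooth (U j))
    (hnd : ∀ j, IsNondegenerate (U j)) (hb : ∀ j, IsBond j (lift (U j)) (u j) (u' j) (u'' j))
    (hι : (ι : ℕ) = 0) {m : ℕ} (hm : (κ : ℕ) = m + 1) (hγ : 0 < γ) (hR : 0 < R) :
    ∃ c L₁ : ℝ, 0 < c ∧ 1 ≤ L₁ ∧ ∀ (L T : ℝ) (I θ : ℝ → Fin n → ℝ), L₁ ≤ L →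
      IsTraj (fun j => lift (U j)) ι γ T I θ →
      (∀ t ∈ Set.Icc 0 T, ∀ i, |shiftAct κ L (I t) i| ≤ R) → ∀ a, 0 ≤ a → a + 1 ≤ T →
        c / L ^ (2 * m + 1) ≤ ∫ t in a..(a + 1), |I t ι| := by
  have hκ : ι ≠ κ := fun h => by have := congrArg Fin.val h; omega
  have hmκ : m < κ := by omega
  have hmn : m < n - 1 := by omega
  set j : Fin (n - 1) := ⟨m, hmn⟩ with hj
  have hhi : hi j = κ := Fin.ext hm.symm
  obtain ⟨x, ⟨e, he⟩, -, hx⟩ := exists_mem_derIdeal (γ := γ) hb hι m hmκ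
  obtain ⟨ε₀, η, hε₀, hη, hslow⟩ := exists_nondegenerate_window hU hnd hι hγ hR m hmκ
  obtain ⟨M, hM, hbM⟩ := exists_bound_family hU 1
  simp only [Function.iterate_one] at hbM
  have hK : 0 < (∑ _j : Fin (n - 1), 2 * M) + γ * R := by
    have : 0 ≤ ∑ _j : Fin (n - 1), 2 * M := Finset.sum_nonneg fun _ _ => by positivity
    positivity
  obtain ⟨c₁, hc₁, hlarge⟩ := exists_lower_bound_integral_abs hK hε₀
  obtain ⟨c₂, L₂, hc₂, hforce⟩ := exists_fast_force_lower_bound (ι := ι) (γ := γ) hU hnd j hhi hR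
  set d := 2 * m + 1 with hd
  set F : Obs n := x ^ 2 * (eps ^ d * u' j) * u' j with hF
  set χ : Polynomial ℝ := (Polynomial.X * (1 - Polynomial.X)) ^ d with hχ
  obtain ⟨B, hB, hweak⟩ := exists_bound_integral_derIdeal hb hκ R d F
    (Ideal.mul_mem_right _ _ hx) χ dvd_rfl
  set c₃ : ℝ := (3 / 16) ^ d * (η ^ e) ^ 2 with hc₃
  have hc₃0 : 0 < c₃ := by positivity
  refine ⟨min c₁ (c₃ * c₂ / B), max 1 L₂, by positivity, le_max_left _ _,
    fun L T I θ hL h hI a ha haT => ?_⟩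
  have hL1 : 1 ≤ L := (le_max_left _ _).trans hL
  have hL0 : 0 < L := by linarith
  have hab : a ≤ a + 1 := by linarith
  have hsub : Set.Icc a (a + 1) ⊆ Set.Icc 0 T := Set.Icc_subset_Icc ha haT
  have hR' : ∀ t ∈ Set.Icc 0 T, ∀ i, i ≠ κ → |I t i| ≤ R := by
    intro t ht i hiκ
    have := hI t ht i
    rwa [shiftAct, if_neg hiκ, sub_zero] at this
  rw [div_le_iff₀ (by positivity)]
  have hJ : 0 ≤ ∫ t in a..(a + 1), |I t ι| :=
    intervalIntegral.integral_nonneg hab fun t _ => abs_nonneg _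
  by_cases hsmall : ∀ t ∈ Set.Icc a (a + 1), |I t ι| ≤ ε₀
  · -- the left part of the chain is at rest, and the fast force shows up in the damped action
    refine (min_le_right _ _).trans ?_
    have hsl := hslow T I θ h hR' a ha haT hsmall
    have hval : ∀ t, ∃ w : ℝ, (((χ.eval (t - a) : ℝ) : ℂ) *
          ev L⁻¹ (shiftAct κ L (I t)) (θ t) F).re = ((t - a) * (1 - (t - a))) ^ d * (w ^ 2 *
            (L⁻¹ ^ d * deriv (lift (U j)) (θ t (hi j) - θ t (lo j)) ^ 2)) ∧
        (t ∈ Set.Icc a (a + 1) → (η ^ e) ^ 2 ≤ w ^ 2) := by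
      intro t
      obtain ⟨w, hw, hwη⟩ := he L⁻¹ (shiftAct κ L (I t)) (θ t)
      refine ⟨w, ?_, fun ht => ?_⟩
      · have h1 : ((χ.eval (t - a) : ℝ) : ℂ) * ev L⁻¹ (shiftAct κ L (I t)) (θ t) F =
            (((((t - a) * (1 - (t - a))) ^ d * (w ^ 2 *
              (L⁻¹ ^ d * deriv (lift (U j)) (θ t (hi j) - θ t (lo j)) ^ 2)) : ℝ)) : ℂ) := by
          rw [hF, map_mul, map_mul, map_mul, map_pow, map_pow, hw, ev_eps, (hb j).ev_eq', hχ]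
          simp only [Polynomial.eval_pow, Polynomial.eval_mul, Polynomial.eval_sub,
            Polynomial.eval_X, Polynomial.eval_one]
          push_cast
          ring
        rw [h1, Complex.ofReal_re]
      · rw [← sq_abs w]
        exact pow_le_pow_left₀ (by positivity) (hwη η hη (hsl t ht)) 2
    set g : ℝ → ℂ := fun t => ((χ.eval (t - a) : ℝ) : ℂ) * ev L⁻¹ (shiftAct κ L (I t)) (θ t) F with hg
    have hgc : ContinuousOn g (Set.Icc a (a + 1)) := by
      refine ContinuousOn.mul (Continuous.continuousOn ?_) ((h.continuousOn_ev hb hκ hL0 F).mono hsub)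
      exact Complex.continuous_ofReal.comp (χ.continuous.comp (continuous_id.sub continuous_const))
    have hgre : ContinuousOn (fun t => (g t).re) (Set.Icc a (a + 1)) :=
      Complex.continuous_re.comp_continuousOn hgc
    have hpos : ∀ t ∈ Set.Icc a (a + 1), 0 ≤ (g t).re := by
      intro t ht
      obtain ⟨w, hw, -⟩ := hval t
      rw [hw]
      have : 0 ≤ (t - a) * (1 - (t - a)) :=
        mul_nonneg (by linarith [ht.1]) (by linarith [ht.2])
      positivity
    have hsub' : Set.Icc (a + 1 / 4) (a + 1 / 4 + 1 / 2) ⊆ Set.Icc a (a + 1) :=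
      Set.Icc_subset_Icc (by linarith) (by linarith)
    have hab' : a + 1 / 4 ≤ a + 1 / 4 + 1 / 2 := by linarith
    have h1 := hforce L T I θ ((le_max_right _ _).trans hL) h hI (a + 1 / 4) (by linarith)
      (by linarith)
    have hψc : ContinuousOn (fun t => deriv (lift (U j)) (θ t (hi j) - θ t (lo j)) ^ 2)
        (Set.Icc (a + 1 / 4) (a + 1 / 4 + 1 / 2)) := by
      have hc1 : Continuous (deriv (lift (U j))) := ((hU j).iterate_deriv 1).continuous
      refine (hc1.comp_continuousOn fun t ht => ?_).pow 2
      exact ((h.hasDerivWithinAt_phase j (hsub (hsub' ht))).continuousWithinAt).mono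
        (hsub'.trans hsub)
    have h2 : ∫ t in (a + 1 / 4)..(a + 1 / 4 + 1 / 2), c₃ * L⁻¹ ^ d *
        deriv (lift (U j)) (θ t (hi j) - θ t (lo j)) ^ 2 ≤
          ∫ t in (a + 1 / 4)..(a + 1 / 4 + 1 / 2), (g t).re := by
      refine intervalIntegral.integral_mono_on hab'
        ((hψc.intervalIntegrable_of_Icc hab').const_mul _)
        ((hgre.mono hsub').intervalIntegrable_of_Icc hab') fun t ht => ?_
      obtain ⟨w, hw, hwη⟩ := hval t
      rw [hw, hc₃, mul_assoc ((3 / 16 : ℝ) ^ d * _), mul_assoc ((3 / 16 : ℝ) ^ d)]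
      have h3 : 3 / 16 ≤ (t - a) * (1 - (t - a)) := by
        nlinarith [mul_nonneg (sub_nonneg.2 ht.1) (sub_nonneg.2 ht.2)]
      refine mul_le_mul (pow_le_pow_left₀ (by norm_num) h3 d) ?_ (by positivity)
        (pow_nonneg (by linarith) d)
      exact mul_le_mul_of_nonneg_right (hwη (hsub' ht)) (by positivity)
    have h3 : ∫ t in (a + 1 / 4)..(a + 1 / 4 + 1 / 2), (g t).re ≤ ∫ t in a..(a + 1), (g t).re := by
      refine intervalIntegral.integral_mono_interval (by linarith) hab' (by linarith) ?_
        (hgre.intervalIntegrable_of_Icc hab)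
      filter_upwards [MeasureTheory.ae_restrict_mem measurableSet_Ioc] with t ht
      exact hpos t (Set.Ioc_subset_Icc_self ht)
    have h4 : ∫ t in a..(a + 1), (g t).re ≤ ‖∫ t in a..(a + 1), g t‖ := by
      have h5 := Complex.reCLM.intervalIntegral_comp_comm
        (hgc.intervalIntegrable_of_Icc (μ := MeasureTheory.volume) hab)
      simp only [Complex.reCLM_apply] at h5
      rw [h5]
      exact Complex.re_le_norm _
    have h5 := hweak L T I θ hL1 h hI a ha haT
    rw [intervalIntegral.integral_const_mul] at h2
    have h6 : c₃ * L⁻¹ ^ d * c₂ ≤ B * ∫ t in a..(a + 1), |I t ι| :=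
      (mul_le_mul_of_nonneg_left h1 (by positivity)).trans (h2.trans (h3.trans (h4.trans h5)))
    rw [div_le_iff₀ hB]
    have h7 := mul_le_mul_of_nonneg_right h6 (by positivity : 0 ≤ L ^ d)
    have h8 : c₃ * L⁻¹ ^ d * c₂ * L ^ d = c₃ * c₂ := by
      rw [inv_pow]; field_simp
    rw [h8] at h7
    linarith
  · push Not at hsmall
    obtain ⟨t₀, ht₀, hbig⟩ := hsmall
    have h1 := hlarge (fun t => I t ι) a t₀ ((h.continuousOn_act ι).mono hsub) ht₀
      (fun s hs t ht => h.lipschitz_act hγ hbM hR' (hsub hs) (hsub ht) ι hκ) hbig.le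
    exact ((min_le_left _ _).trans h1).trans (le_mul_of_one_le_right hJ (one_le_pow₀ hL1))

lemma sq_integral_abs_le {f : ℝ → ℝ} {a : ℝ} (hf : ContinuousOn f (Set.Icc a (a + 1))) :
    (∫ t in a..(a + 1), |f t|) ^ 2 ≤ ∫ t in a..(a + 1), f t ^ 2 := by
  have hab : a ≤ a + 1 := by linarith
  set c := ∫ t in a..(a + 1), |f t| with hc
  have h1 := hf.abs.intervalIntegrable_of_Icc (μ := MeasureTheory.volume) hab
  have h2 : ∫ t in a..(a + 1), (2 * c * |f t| - c ^ 2) ≤ ∫ t in a..(a + 1), f t ^ 2 := by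
    refine intervalIntegral.integral_mono_on hab ((h1.const_mul _).sub intervalIntegrable_const)
      ((hf.pow 2).intervalIntegrable_of_Icc hab) fun t _ => ?_
    rw [← sq_abs (f t)]
    nlinarith [sq_nonneg (|f t| - c)]
  rw [intervalIntegral.integral_sub (h1.const_mul _) intervalIntegrable_const,
    intervalIntegral.integral_const_mul, intervalIntegral.integral_const, smul_eq_mul, ← hc] at h2
  nlinarith

/-- The energy decreases at least at the rate `L ^ -(2 (2 m + 1))`. -/
theorem exists_dissipation (hU : ∀ j, IsSmooth (U j))
    (hnd : ∀ j, IsNondegenerate (U j)) (hb : ∀ j, IsBond j (lift (U j)) (u j) (u' j) (u'' j))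
    (hι : (ι : ℕ) = 0) {m : ℕ} (hm : (κ : ℕ) = m + 1) (hγ : 0 < γ) (hR : 0 < R) :
    ∃ C L₁ : ℝ, 0 < C ∧ 1 ≤ L₁ ∧ ∀ (L T : ℝ) (I θ : ℝ → Fin n → ℝ), L₁ ≤ L → 1 ≤ T →
      IsTraj (fun j => lift (U j)) ι γ T I θ →
      (∀ t ∈ Set.Icc 0 T, ∀ i, |shiftAct κ L (I t) i| ≤ R) →
        chainEnergy (fun j => lift (U j)) (I T) (θ T) - chainEnergy (fun j => lift (U j)) (I 0) (θ 0)
          ≤ -C * (T / L ^ (2 * (2 * m + 1))) := by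
  obtain ⟨c, L₁, hc, hL₁, hwin⟩ := exists_lower_bound_damped_action hU hnd hb hι hm hγ hR
  refine ⟨γ * c ^ 2 / 2, L₁, by positivity, hL₁, fun L T I θ hL hT h hI => ?_⟩
  have hκ : ι ≠ κ := fun h => by have := congrArg Fin.val h; omega
  have hL0 : 0 < L := by linarith
  set E : ℝ → ℝ := fun t => chainEnergy (fun j => lift (U j)) (I t) (θ t) with hE
  have hEd : ∀ t ∈ Set.Icc 0 T, HasDerivWithinAt E (-(γ * I t ι ^ 2)) (Set.Icc 0 T) t := fun t ht =>
    h.hasDerivWithinAt_chainEnergy hb hκ ht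
  have hdrop : ∀ a b, 0 ≤ a → a ≤ b → b ≤ T → E b - E a = -(γ * ∫ t in a..b, I t ι ^ 2) := by
    intro a b ha hab hbT
    have hsub : Set.Icc a b ⊆ Set.Icc 0 T := Set.Icc_subset_Icc ha hbT
    rw [← intervalIntegral.integral_const_mul, ← intervalIntegral.integral_neg]
    refine (intervalIntegral.integral_eq_sub_of_hasDerivAt_of_le hab
      (fun t ht => (hEd t (hsub ht)).continuousWithinAt.mono hsub) (fun t ht =>
        ((hEd t (hsub (Set.Ioo_subset_Icc_self ht))).mono hsub).hasDerivAt
          (Icc_mem_nhds ht.1 ht.2)) ?_).symm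
    refine ContinuousOn.intervalIntegrable_of_Icc hab (ContinuousOn.neg ?_)
    exact continuousOn_const.mul (((h.continuousOn_act ι).mono hsub).pow 2)
  -- the least loss of energy during a unit time interval
  set δ : ℝ := γ * (c / L ^ (2 * m + 1)) ^ 2 with hδ
  have hδ0 : 0 ≤ δ := by positivity
  have hsteps : ∀ N : ℕ, (N : ℝ) ≤ T → E N - E 0 ≤ -(N * δ) := by
    intro N
    induction N with
    | zero => intro _; simp
    | succ N ih =>
      intro hN
      push_cast at hN ⊢
      have h0 : (0 : ℝ) ≤ N := Nat.cast_nonneg N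
      have h1 := ih (by linarith)
      have h2 := hdrop N (N + 1) h0 (by linarith) hN
      have h3 := hwin L T I θ hL h hI N h0 hN
      have h4 := sq_integral_abs_le ((h.continuousOn_act ι).mono (Set.Icc_subset_Icc h0 hN))
      have h5 := pow_le_pow_left₀ (by positivity) h3 2
      have h6 := mul_le_mul_of_nonneg_left (h5.trans h4) hγ.le
      linarith
  have hfloor : (⌊T⌋₊ : ℝ) ≤ T := Nat.floor_le (by linarith)
  have hhalf : T / 2 ≤ ⌊T⌋₊ := by
    have h1 := Nat.lt_floor_add_one T
    have h2 : (1 : ℝ) ≤ ⌊T⌋₊ := by exact_mod_cast Nat.le_floor (by simpa using hT)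
    linarith
  have h1 := hsteps _ hfloor
  have h2 := hdrop ⌊T⌋₊ T (Nat.cast_nonneg _) hfloor le_rfl
  have h3 : 0 ≤ γ * ∫ t in (⌊T⌋₊ : ℝ)..T, I t ι ^ 2 :=
    mul_nonneg hγ.le (intervalIntegral.integral_nonneg hfloor fun t _ => sq_nonneg _)
  have h4 := mul_le_mul_of_nonneg_right hhalf hδ0
  have h5 : T / 2 * δ = γ * c ^ 2 / 2 * (T / L ^ (2 * (2 * m + 1))) := by
    rw [hδ, div_pow, ← pow_mul, mul_comm (2 * m + 1) 2]
    ring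
  change E T - E 0 ≤ _
  linarith

end Dissipation

/-! ### Lifting the angles -/

lemma hamiltonian_eq_chainEnergy (U : Fin (n - 1) → Torus → ℝ) {x : Phase n} {θ : Fin n → ℝ}
    (h : ∀ i, (θ i : Torus) = x.2 i) :
    hamiltonian U x = chainEnergy (fun j => lift (U j)) x.1 θ := by
  rw [hamiltonian, chainEnergy]
  congr 1
  refine Finset.sum_congr rfl fun j _ => ?_
  rw [lift, AddCircle.coe_sub, h, h]
  rfl

lemma hasDerivAt_update (a : Fin n → ℝ) (i l : Fin n) :
    HasDerivAt (fun s => Function.update a i (a i + s) l) (if l = i then 1 else 0) 0 := by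
  by_cases hl : l = i
  · subst hl
    simpa using (hasDerivAt_id (0 : ℝ)).const_add (a l)
  · simpa [hl] using hasDerivAt_const (0 : ℝ) (a l)

lemma partialAction_hamiltonian (U : Fin (n - 1) → Torus → ℝ) (i : Fin n) (x : Phase n) :
    partialAction (hamiltonian U) i x = x.1 i := by
  have h : HasDerivAt (fun s => ∑ l, Function.update x.1 i (x.1 i + s) l ^ 2)
      (∑ l, 2 * x.1 l * if l = i then 1 else 0) 0 :=
    HasDerivAt.fun_sum fun l _ => ((hasDerivAt_update x.1 i l).fun_pow 2).congr_deriv (by simp)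
  have h' := (h.const_mul (1 / 2)).add_const (∑ j : Fin (n - 1),
    U j (x.2 ⟨(j : ℕ) + 1, by omega⟩ - x.2 ⟨(j : ℕ), by omega⟩))
  refine h'.deriv.trans ?_
  simp

lemma partialAngle_hamiltonian {U : Fin (n - 1) → Torus → ℝ} (hU : ∀ j, IsSmooth (U j)) (i : Fin n)
    {x : Phase n} {θ : Fin n → ℝ} (hθ : ∀ i, (θ i : Torus) = x.2 i) :
    partialAngle (hamiltonian U) i x = -force (fun j => lift (U j)) θ i := by
  have hlift : ∀ s : ℝ, hamiltonian U (x.1, Function.update x.2 i (x.2 i + (s : Torus))) =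
      chainEnergy (fun j => lift (U j)) x.1 (Function.update θ i (θ i + s)) := by
    intro s
    refine hamiltonian_eq_chainEnergy U fun l => ?_
    by_cases hl : l = i
    · subst hl
      simp [hθ]
    · simp [hl, hθ]
  have h : HasDerivAt (fun s => ∑ j, lift (U j) (Function.update θ i (θ i + s) (hi j) -
      Function.update θ i (θ i + s) (lo j)))
      (∑ j, deriv (lift (U j)) (θ (hi j) - θ (lo j)) *
        ((if hi j = i then 1 else 0) - if lo j = i then 1 else 0)) 0 := by
    refine HasDerivAt.fun_sum fun j _ => ?_
    have h1 := (hasDerivAt_update θ i (hi j)).fun_sub (hasDerivAt_update θ i (lo j))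
    have h2 := (((hU j).iterate_deriv 0).differentiable one_ne_zero (θ (hi j) - θ (lo j))).hasDerivAt
    exact HasDerivAt.comp (h₂ := lift (U j)) (0 : ℝ) (by simpa using h2) h1
  have h' := h.const_add (1 / 2 * ∑ l, x.1 l ^ 2)
  rw [partialAngle]
  simp only [hlift]
  refine h'.deriv.trans ?_
  rw [force, ← Finset.sum_neg_distrib]
  refine Finset.sum_congr rfl fun j _ => ?_
  split_ifs <;> simp

/-- Solutions on phase space are the projections of the solutions with lifted angles. -/
theorem isSolutionOn_iff {U : Fin (n - 1) → Torus → ℝ} (hU : ∀ j, IsSmooth (U j)) {ι : Fin n}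
    (hι : (ι : ℕ) = 0) {γ T : ℝ} {x : ℝ → Phase n} :
    IsSolutionOn U γ T x ↔ ∃ θ : ℝ → Fin n → ℝ,
      (∀ t ∈ Set.Icc 0 T, ∀ i, ((θ t i : ℝ) : Torus) = (x t).2 i) ∧
      IsTraj (fun j => lift (U j)) ι γ T (fun t => (x t).1) θ := by
  have hfirst : ∀ i : Fin n, (i : ℕ) + 1 = 1 ↔ i = ι := fun i => by rw [Fin.ext_iff]; omega
  refine exists_congr fun θ => ⟨fun h => ⟨fun t ht i => (h t ht i).1, ⟨fun t ht i => ?_,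
    fun t ht i => ?_⟩⟩, fun ⟨hθ, h⟩ t ht i => ⟨hθ t ht i, ?_, ?_⟩⟩
  · have h1 := (h t ht i).2.1
    rw [partialAngle_hamiltonian hU i fun l => (h t ht l).1, neg_neg] at h1
    simpa only [hfirst] using h1
  · have h1 := (h t ht i).2.2
    rwa [partialAction_hamiltonian] at h1
  · rw [partialAngle_hamiltonian hU i (hθ t ht), neg_neg]
    simpa only [hfirst] using h.act t ht i
  · rw [partialAction_hamiltonian]
    exact h.ang t ht i

lemma mem_box_iff {k : ℕ} {κ : Fin n} (hκ : (κ : ℕ) + 1 = k) {L ρ : ℝ} {x : Phase n} :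
    x ∈ box n k L ρ ↔ ∀ i, |shiftAct κ L x.1 i| < ρ := by
  have h : ∀ i : Fin n, (i : ℕ) + 1 = k ↔ i = κ := fun i => by rw [Fin.ext_iff]; omega
  simp only [box, Set.mem_ofPred_eq, shiftAct, h]

end RotatorChain

theorem theorem1 (n k : ℕ) (hk : 2 ≤ k) (hkn : k ≤ n)
    (U : Fin (n - 1) → RotatorChain.Torus → ℝ)
    (hsmooth : ∀ i, RotatorChain.IsSmooth (U i))
    (hmodes : ∀ i, RotatorChain.HasFinitelyManyModes (U i))
    (hnondeg : ∀ i, RotatorChain.IsNondegenerate (U i))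
    (γ : ℝ) (hγ : 0 < γ) (α ρ : ℝ) (hα : 0 < α) (hρ : 0 < ρ) :
    ∃ L₀ ρs C₁ : ℝ, 0 < L₀ ∧ 0 < ρs ∧ 0 < C₁ ∧
      ∀ L T : ℝ, L₀ ≤ L → T = α * L ^ (2 * k - 3) →
        ∀ x₀ ∈ RotatorChain.box n k L ρ,
          (∃ x : ℝ → RotatorChain.Phase n,
            x 0 = x₀ ∧ RotatorChain.IsSolutionOn U γ T x) ∧
          ∀ x : ℝ → RotatorChain.Phase n,
            x 0 = x₀ → RotatorChain.IsSolutionOn U γ T x →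
              (∀ t ∈ Set.Icc 0 T, x t ∈ RotatorChain.box n k L ρs) ∧
              RotatorChain.hamiltonian U (x T) - RotatorChain.hamiltonian U (x 0)
                ≤ -C₁ * (T / L ^ (4 * k - 6)) := by
  set ι : Fin n := ⟨0, by omega⟩ with hι
  set κ : Fin n := ⟨k - 1, by omega⟩ with hκ
  have hικ : ι ≠ κ := fun h => by have := congrArg Fin.val h; simp [hι, hκ] at this; omega
  have hκk : (κ : ℕ) + 1 = k := by simp only [hκ]; omega
  have hm : (κ : ℕ) = (k - 2) + 1 := by simp only [hκ]; omega
  have hgap : 2 * RotatorChain.gap ι κ - 1 = 2 * k - 3 := by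
    simp only [RotatorChain.gap, hι, hκ]; omega
  choose u u' u'' hb using fun j => RotatorChain.exists_isBond (hsmooth j) (hmodes j) j
  obtain ⟨L₁, ρs, hL₁, hρs, hstab⟩ := RotatorChain.exists_stability hb hικ hγ hα hρ
  obtain ⟨C₁, L₂, hC₁, -, hdiss⟩ :=
    RotatorChain.exists_dissipation hsmooth hnondeg hb (ι := ι) rfl hm hγ hρs
  refine ⟨max L₁ (max L₂ (1 / α)), ρs, C₁, lt_max_of_lt_left (by linarith), hρs, hC₁,
    fun L T hL hT x₀ hx₀ => ?_⟩
  have hLL₁ : L₁ ≤ L := (le_max_left _ _).trans hL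
  have hLL₂ : L₂ ≤ L := (le_max_left _ _).trans ((le_max_right _ _).trans hL)
  have hLα : 1 / α ≤ L := (le_max_right _ _).trans ((le_max_right _ _).trans hL)
  -- the dissipation estimate needs a full unit time interval
  have hT1 : 1 ≤ T := by
    have h1 : L ≤ L ^ (2 * k - 3) := le_self_pow₀ (hL₁.trans hLL₁) (by omega)
    rw [div_le_iff₀ hα] at hLα
    have h2 := mul_le_mul_of_nonneg_left h1 hα.le
    linarith
  have hT0 : (0 : ℝ) ∈ Set.Icc 0 T := ⟨le_rfl, by linarith⟩
  have hTT : T ∈ Set.Icc 0 T := ⟨by linarith, le_rfl⟩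
  refine ⟨?_, fun x hx hsol => ?_⟩
  · choose θ₀ hθ₀ using fun i => QuotientAddGroup.mk_surjective (x₀.2 i)
    obtain ⟨I, θ, hI0, hθ0, h⟩ := RotatorChain.exists_traj (T := T) hsmooth ι hγ x₀.1 θ₀
    refine ⟨fun t => (I t, fun i => (θ t i : RotatorChain.Torus)), ?_,
      (RotatorChain.isSolutionOn_iff hsmooth rfl).2 ⟨θ, fun _ _ _ => rfl, h⟩⟩
    simp only [hI0, hθ0]
    exact Prod.ext rfl (funext hθ₀)
  · obtain ⟨θ, hθ, h⟩ := (RotatorChain.isSolutionOn_iff hsmooth (ι := ι) rfl).1 hsol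
    rw [← hx, RotatorChain.mem_box_iff hκk] at hx₀
    have hbox := hstab L T hLL₁ (by rw [hgap, hT]) _ θ h hx₀
    refine ⟨fun t ht => (RotatorChain.mem_box_iff hκk).2 (hbox t ht), ?_⟩
    rw [RotatorChain.hamiltonian_eq_chainEnergy U (hθ T hTT),
      RotatorChain.hamiltonian_eq_chainEnergy U (hθ 0 hT0)]
    have h1 := hdiss L T _ θ hLL₂ hT1 h fun t ht i => (hbox t ht i).le
    rwa [show 2 * (2 * (k - 2) + 1) = 4 * k - 6 by omega] at h1
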